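/- Let $G$ be a connected solvable real Lie group of dimension $4n$, let $\Gamma\subset G$ be a discrete subgroup such that the quotient manifold $M=\Gamma\backslash G$ is compact, and let $(I,J,K)$ be an invariant hypercomplex structure on $M$: integrable almost complex structures $I,J,K$ on $M$, induced by left-invariant tensors on $G$, with $IJ=-JI=K$. Suppose that $(M,I,J,K)$ is an $\mathrm{SL}(n,\mathbb H)$-manifold, i.e. the holonomy of its Obata connection (the torsion-free connection $\nabla$ with $\nabla I=\nabla J=\nabla K=0$) is contained in $\mathrm{SL}(n,\mathbb H)$. For a hyperhermitian metric $g$ on $M$ (a smooth Riemannian metric, not necessarily invariant, that is Hermitian with respect to $I$, $J$ and $K$) put $$\Omega_g=\tfrac12\bigl(g(J\cdot,\cdot)+i\,g(K\cdot,\cdot)\bigr),\qquad \omega_g=g(I\cdot,\cdot);$$ $g$ is called HKT if $\partial\Omega_g=0$, where $\partial$ is the $(1,0)$-part of $d$ with respect to $I$, and balanced if $d(\omega_g^{2n-1})=0$. If $(M,I,J,K)$ admits an HKT metric, then it admits an HKT metric that is also balanced. -/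

import Mathlib

open Set Bundle FiberBundle VectorField
open scoped Manifold ContDiff Topology

namespace HKTSolv

/-! ### Linear algebra of alternating forms on one tangent space -/

section Linear

variable {T : Type*} [AddCommGroup T] [Module ℝ T] [TopologicalSpace T]

/-- The alternating 2-form `(v, w) ↦ B v w` attached to a bilinear form with `B v v = 0`. -/
noncomputable def twoForm (B : T →L[ℝ] T →L[ℝ] ℝ) (hB : ∀ v, B v v = 0)
    (hc : Continuous fun p : T × T => B p.1 p.2) : T [⋀^Fin 2]→L[ℝ] ℝ where
  toFun v := B (v 0) (v 1)
  map_update_add' := by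
    intro inst v i x y
    have : inst = instDecidableEqFin 2 := Subsingleton.elim _ _
    subst this
    fin_cases i <;> simp
  map_update_smul' := by
    intro inst v i c x
    have : inst = instDecidableEqFin 2 := Subsingleton.elim _ _
    subst this
    fin_cases i <;> simp
  cont := by
    have h : Continuous fun v : Fin 2 → T => (v 0, v 1) :=
      (continuous_apply 0).prodMk (continuous_apply 1)
    exact hc.comp h
  map_eq_zero_of_eq' := by
    intro v i j h hij
    have h01 : v 0 = v 1 := by
      fin_cases i <;> fin_cases j <;> simp_all
    simp [h01, hB]

/-- The multilinear form `v ↦ ∏ⱼ β (v (j, 0), v (j, 1))`, that is `β ⊗ ⋯ ⊗ β` (`k` factors). -/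
noncomputable def tensorPow (β : T [⋀^Fin 2]→L[ℝ] ℝ) (k : ℕ) :
    ContinuousMultilinearMap ℝ (fun _ : Fin k × Fin 2 => T) ℝ where
  toFun v := ∏ j : Fin k, β fun r => v (j, r)
  map_update_add' := by
    classical
    intro inst v i x y
    have hi : inst = instDecidableEqProd := Subsingleton.elim _ _
    subst hi
    obtain ⟨j₀, r₀⟩ := i
    have h1 : ∀ z, (fun r => Function.update v (j₀, r₀) z (j₀, r)) =
        Function.update (fun r => v (j₀, r)) r₀ z := by
      intro z; ext r
      by_cases h : r = r₀
      · subst h; simp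
      · simp [Function.update, h]
    have h2 : ∀ z, ∀ j ∈ Finset.univ.erase j₀,
        β (fun r => Function.update v (j₀, r₀) z (j, r)) = β (fun r => v (j, r)) := by
      intro z j hj
      have hj' : j ≠ j₀ := Finset.ne_of_mem_erase hj
      congr 1; ext r
      simp [Function.update, hj']
    simp only [← Finset.mul_prod_erase Finset.univ _ (Finset.mem_univ j₀)]
    rw [Finset.prod_congr rfl (h2 _), Finset.prod_congr rfl (h2 _), Finset.prod_congr rfl (h2 _)]
    simp only [h1]
    rw [β.map_update_add, add_mul]
  map_update_smul' := by
    classical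
    intro inst v i c x
    have hi : inst = instDecidableEqProd := Subsingleton.elim _ _
    subst hi
    obtain ⟨j₀, r₀⟩ := i
    have h1 : ∀ z, (fun r => Function.update v (j₀, r₀) z (j₀, r)) =
        Function.update (fun r => v (j₀, r)) r₀ z := by
      intro z; ext r
      by_cases h : r = r₀
      · subst h; simp
      · simp [Function.update, h]
    have h2 : ∀ z, ∀ j ∈ Finset.univ.erase j₀,
        β (fun r => Function.update v (j₀, r₀) z (j, r)) = β (fun r => v (j, r)) := by
      intro z j hj
      have hj' : j ≠ j₀ := Finset.ne_of_mem_erase hj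
      congr 1; ext r
      simp [Function.update, hj']
    simp only [← Finset.mul_prod_erase Finset.univ _ (Finset.mem_univ j₀)]
    rw [Finset.prod_congr rfl (h2 _), Finset.prod_congr rfl (h2 _)]
    simp only [h1]
    rw [β.map_update_smul, smul_mul_assoc]
  cont := continuous_finsetProd _ fun j _ =>
    β.cont.comp (continuous_pi fun r => continuous_apply (j, r))

/-- The wedge power `β ∧ ⋯ ∧ β` (`k` factors) of a 2-form, a form of degree `k * 2`:
`βᵏ(v₁, …, v₂ₖ) = 2⁻ᵏ ∑_σ sgn σ ∏ⱼ β (v_σ(2j-1), v_σ(2j))`. -/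
noncomputable def wedgePow (β : T [⋀^Fin 2]→L[ℝ] ℝ) (k : ℕ) : T [⋀^Fin (k * 2)]→L[ℝ] ℝ :=
  ((2 : ℝ) ^ k)⁻¹ •
    ContinuousMultilinearMap.alternatization ((tensorPow β k).domDomCongr finProdFinEquiv)

/-- The value on `(X₁ + i Y₁, …, X_k + i Y_k)` of the complex multilinear extension to `T ⊗ ℂ`
of a complex valued real `k`-form on `T`. -/
noncomputable def complexExt {k : ℕ} (α : T [⋀^Fin k]→L[ℝ] ℂ) (X Y : Fin k → T) : ℂ :=
  ∑ S : Finset (Fin k), Complex.I ^ S.card * α (S.piecewise Y X)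

/-- The component of type `(p, k - p)`, with respect to the complex structure `A` of `T`, of a
complex valued `k`-form `α`: the sum over the sets `P` of `p` indices of
`α_ℂ(Z₁, …, Z_k)`, where `Z_j = (v_j - i A v_j) / 2` is the `(1,0)`-part of `v_j` for `j ∈ P` and
`Z_j = (v_j + i A v_j) / 2` is its `(0,1)`-part for `j ∉ P`. -/
noncomputable def typePart (A : T →L[ℝ] T) (p : ℕ) {k : ℕ} (α : T [⋀^Fin k]→L[ℝ] ℂ) (v : Fin k → T) : ℂ :=
  ∑ P ∈ Finset.powersetCard p (Finset.univ : Finset (Fin k)),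
    complexExt α (fun j => (1 / 2 : ℝ) • v j)
      (fun j => if j ∈ P then -((1 / 2 : ℝ) • A (v j)) else (1 / 2 : ℝ) • A (v j))

end Linear

/-! ### Smooth manifolds -/

section Manifold

variable {E : Type*} [NormedAddCommGroup E] [NormedSpace ℝ E]
  {M : Type*} [TopologicalSpace M] [ChartedSpace E M]

/-- The exterior derivative of a differential form on a manifold, computed at each point `x` in the
preferred chart at `x`. -/
noncomputable def mextDeriv {k : ℕ} {F : Type*} [NormedAddCommGroup F] [NormedSpace ℝ F]
    (α : Π x : M, TangentSpace 𝓘(ℝ, E) x [⋀^Fin k]→L[ℝ] F) (x : M) :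
    TangentSpace 𝓘(ℝ, E) x [⋀^Fin (k + 1)]→L[ℝ] F :=
  ContinuousAlternatingMap.compContinuousLinearMap
    (extDeriv (E := E) (fun y : E =>
        (α ((extChartAt 𝓘(ℝ, E) x).symm y)).compContinuousLinearMap
          (mfderiv 𝓘(ℝ, E) 𝓘(ℝ, E) (extChartAt 𝓘(ℝ, E) x).symm y))
      (extChartAt 𝓘(ℝ, E) x x))
    (mfderiv 𝓘(ℝ, E) 𝓘(ℝ, E) (extChartAt 𝓘(ℝ, E) x) x)

variable [IsManifold 𝓘(ℝ, E) ∞ M]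

variable (E M) in
/-- A smooth field of endomorphisms of the tangent bundle. -/
structure EndField where
  toFun : Π x : M, TangentSpace 𝓘(ℝ, E) x →L[ℝ] TangentSpace 𝓘(ℝ, E) x
  smooth : ContMDiff 𝓘(ℝ, E) (𝓘(ℝ, E).prod 𝓘(ℝ, E →L[ℝ] E)) ∞
    fun x => TotalSpace.mk' (E →L[ℝ] E)
      (E := fun x : M => TangentSpace 𝓘(ℝ, E) x →L[ℝ] TangentSpace 𝓘(ℝ, E) x) x (toFun x)

instance : CoeFun (EndField E M)
    (fun _ => Π x : M, TangentSpace 𝓘(ℝ, E) x →L[ℝ] TangentSpace 𝓘(ℝ, E) x) :=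
  ⟨EndField.toFun⟩

/-- `A` is a complex structure: `A² = -1` and `A` is integrable, that is its Nijenhuis tensor
vanishes. -/
structure EndField.IsComplexStructure (A : EndField E M) : Prop where
  sq : ∀ x v, A x (A x v) = -v
  nijenhuis : ∀ X Y : Π x : M, TangentSpace 𝓘(ℝ, E) x,
    ContMDiff 𝓘(ℝ, E) 𝓘(ℝ, E).tangent ∞ (fun x => (⟨x, X x⟩ : TangentBundle 𝓘(ℝ, E) M)) →
    ContMDiff 𝓘(ℝ, E) 𝓘(ℝ, E).tangent ∞ (fun x => (⟨x, Y x⟩ : TangentBundle 𝓘(ℝ, E) M)) →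
    ∀ x, mlieBracket 𝓘(ℝ, E) (fun y => A y (X y)) (fun y => A y (Y y)) x
      - A x (mlieBracket 𝓘(ℝ, E) (fun y => A y (X y)) Y x)
      - A x (mlieBracket 𝓘(ℝ, E) X (fun y => A y (Y y)) x)
      - mlieBracket 𝓘(ℝ, E) X Y x = 0

variable (E M) in
/-- A hypercomplex structure: three anticommuting complex structures with `IJ = K`. -/
structure HypercomplexStructure where
  I : EndField E M
  J : EndField E M
  K : EndField E M
  isComplex_I : I.IsComplexStructure
  isComplex_J : J.IsComplexStructure
  isComplex_K : K.IsComplexStructure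
  I_J : ∀ x v, I x (J x v) = K x v
  J_I : ∀ x v, J x (I x v) = -K x v

/-! ### The Obata connection and its holonomy -/

/-- The connection `∇` preserves `A`, that is `∇_w (A X) = A (∇_w X)`. -/
def Preserves (cov : CovariantDerivative 𝓘(ℝ, E) E (TangentSpace 𝓘(ℝ, E) : M → Type _))
    (A : EndField E M) : Prop :=
  ∀ (X : Π x : M, TangentSpace 𝓘(ℝ, E) x) (x : M),
    MDifferentiableAt 𝓘(ℝ, E) 𝓘(ℝ, E).tangent
      (fun y => (⟨y, X y⟩ : TangentBundle 𝓘(ℝ, E) M)) x →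
    ∀ w : TangentSpace 𝓘(ℝ, E) x, cov (fun y => A y (X y)) x w = A x (cov X x w)

/-- `∇` is the Obata connection of `(I, J, K)`: the smooth torsion-free connection with
`∇I = ∇J = ∇K = 0`. (Recall that `cov Y x (X x)` is `∇_X Y` at `x`.) -/
structure IsObata (cov : CovariantDerivative 𝓘(ℝ, E) E (TangentSpace 𝓘(ℝ, E) : M → Type _))
    (H : HypercomplexStructure E M) : Prop where
  smooth : ∀ X Y : Π x : M, TangentSpace 𝓘(ℝ, E) x,
    ContMDiff 𝓘(ℝ, E) 𝓘(ℝ, E).tangent ∞ (fun x => (⟨x, X x⟩ : TangentBundle 𝓘(ℝ, E) M)) →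
    ContMDiff 𝓘(ℝ, E) 𝓘(ℝ, E).tangent ∞ (fun x => (⟨x, Y x⟩ : TangentBundle 𝓘(ℝ, E) M)) →
    ContMDiff 𝓘(ℝ, E) 𝓘(ℝ, E).tangent ∞
      (fun x => (⟨x, cov Y x (X x)⟩ : TangentBundle 𝓘(ℝ, E) M))
  torsionFree : ∀ (X Y : Π x : M, TangentSpace 𝓘(ℝ, E) x) (x : M),
    MDifferentiableAt 𝓘(ℝ, E) 𝓘(ℝ, E).tangent
      (fun y => (⟨y, X y⟩ : TangentBundle 𝓘(ℝ, E) M)) x →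
    MDifferentiableAt 𝓘(ℝ, E) 𝓘(ℝ, E).tangent
      (fun y => (⟨y, Y y⟩ : TangentBundle 𝓘(ℝ, E) M)) x →
    cov Y x (X x) - cov X x (Y x) = mlieBracket 𝓘(ℝ, E) X Y x
  preserves_I : Preserves cov H.I
  preserves_J : Preserves cov H.J
  preserves_K : Preserves cov H.K

/-- The vector field `V` along the curve `t ↦ (V t).proj`, `t ∈ [0, 1]`, is parallel.

At the time `t` the field is written in the trivialization of `TM` given by the chart at
`x = (V t).proj`; as `V s = ∑ vᵢ(s) eᵢ` for the coordinate fields `eᵢ`, the equation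
`∇_{γ'} V = 0` at `t` reads `∑ vᵢ'(t) eᵢ = - ∇_{γ'(t)} (∑ vᵢ(t) eᵢ)`, and `∑ vᵢ(t) eᵢ` is the
local extension `extend E (V t).2` of the vector `V t`. -/
def IsParallelAlong (cov : CovariantDerivative 𝓘(ℝ, E) E (TangentSpace 𝓘(ℝ, E) : M → Type _))
    (V : ℝ → TangentBundle 𝓘(ℝ, E) M) : Prop :=
  ∀ t ∈ Icc (0 : ℝ) 1,
    HasDerivWithinAt
      (fun s => (trivializationAt E (TangentSpace 𝓘(ℝ, E) : M → Type _) (V t).proj (V s)).2)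
      (-(trivializationAt E (TangentSpace 𝓘(ℝ, E) : M → Type _) (V t).proj
          (⟨(V t).proj, cov (extend E (V t).2) (V t).proj
            (mfderivWithin 𝓘(ℝ, ℝ) 𝓘(ℝ, E) (fun s => (V s).proj) (Icc 0 1) t (1 : ℝ))⟩ :
            TangentBundle 𝓘(ℝ, E) M)).2)
      (Icc 0 1) t

/-- `A : T_x M → T_y M` is the parallel transport of `∇` along some piecewise smooth curve from `x`
to `y` (a finite concatenation of smooth curves). -/
inductive IsParallelTransport
    (cov : CovariantDerivative 𝓘(ℝ, E) E (TangentSpace 𝓘(ℝ, E) : M → Type _)) :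
    (x y : M) → (TangentSpace 𝓘(ℝ, E) x →L[ℝ] TangentSpace 𝓘(ℝ, E) y) → Prop
  | smooth (γ : ℝ → M) (hγ : ContMDiffOn 𝓘(ℝ, ℝ) 𝓘(ℝ, E) ∞ γ (Icc 0 1)) (x y : M)
      (A : TangentSpace 𝓘(ℝ, E) x →L[ℝ] TangentSpace 𝓘(ℝ, E) y)
      (hx : γ 0 = x) (hy : γ 1 = y)
      (hA : ∀ v : TangentSpace 𝓘(ℝ, E) x, ∃ V : ℝ → TangentBundle 𝓘(ℝ, E) M,
        (∀ t ∈ Icc (0 : ℝ) 1, (V t).proj = γ t) ∧ V 0 = ⟨x, v⟩ ∧ V 1 = ⟨y, A v⟩ ∧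
          IsParallelAlong cov V) :
      IsParallelTransport cov x y A
  | trans (x y z : M) (A : TangentSpace 𝓘(ℝ, E) x →L[ℝ] TangentSpace 𝓘(ℝ, E) y)
      (B : TangentSpace 𝓘(ℝ, E) y →L[ℝ] TangentSpace 𝓘(ℝ, E) z)
      (hA : IsParallelTransport cov x y A) (hB : IsParallelTransport cov y z B) :
      IsParallelTransport cov x z (B.comp A)

/-- The holonomy group of `∇` at `x`: the parallel transports along piecewise smooth loops. -/
def holonomy (cov : CovariantDerivative 𝓘(ℝ, E) E (TangentSpace 𝓘(ℝ, E) : M → Type _)) (x : M) :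
    Set (TangentSpace 𝓘(ℝ, E) x →L[ℝ] TangentSpace 𝓘(ℝ, E) x) :=
  {A | IsParallelTransport cov x x A}

/-- The group `SL(n, ℍ)` of the quaternionic vector space `(T_x M, I, J, K)`: the `ℍ`-linear
endomorphisms with real determinant `1`. (The real determinant on `GL(n, ℍ)` is a positive power of
the Dieudonné determinant, which is positive.) -/
def quaternionicSL (H : HypercomplexStructure E M) (x : M) :
    Set (TangentSpace 𝓘(ℝ, E) x →L[ℝ] TangentSpace 𝓘(ℝ, E) x) :=
  {A | (∀ v, A (H.I x v) = H.I x (A v)) ∧ (∀ v, A (H.J x v) = H.J x (A v)) ∧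
    (∀ v, A (H.K x v) = H.K x (A v)) ∧ LinearMap.det A.toLinearMap = 1}

/-- `(M, I, J, K)` is an `SL(n, ℍ)`-manifold: the holonomy of its Obata connection lies in
`SL(n, ℍ)`. -/
def IsSLManifold (H : HypercomplexStructure E M) : Prop :=
  ∃ cov : CovariantDerivative 𝓘(ℝ, E) E (TangentSpace 𝓘(ℝ, E) : M → Type _),
    IsObata cov H ∧ ∀ x, holonomy cov x ⊆ quaternionicSL H x

/-! ### Hyperhermitian, HKT and balanced metrics -/

/-- A smooth Riemannian metric that is Hermitian with respect to `I`, `J` and `K`. -/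
structure HyperhermitianMetric (H : HypercomplexStructure E M) extends
    ContMDiffRiemannianMetric 𝓘(ℝ, E) ∞ E (fun x : M => TangentSpace 𝓘(ℝ, E) x) where
  hermitian_I : ∀ x v w, inner x (H.I x v) (H.I x w) = inner x v w
  hermitian_J : ∀ x v w, inner x (H.J x v) (H.J x w) = inner x v w
  hermitian_K : ∀ x v w, inner x (H.K x v) (H.K x w) = inner x v w

namespace HyperhermitianMetric

variable {H : HypercomplexStructure E M} (g : HyperhermitianMetric H)

lemma inner_apply_self (g : HyperhermitianMetric H) (A : EndField E M)
    (hA : A.IsComplexStructure)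
    (h : ∀ x v w, g.inner x (A x v) (A x w) = g.inner x v w) (x : M)
    (v : TangentSpace 𝓘(ℝ, E) x) : g.inner x (A x v) v = 0 := by
  have h1 := h x (A x v) v
  rw [hA.sq, map_neg] at h1
  have h2 := g.symm x v (A x v)
  simp only [_root_.neg_apply] at h1
  linarith

/-- The fundamental 2-form `ω_A = g(A·, ·)` for a complex structure `A` for which `g` is
Hermitian. -/
noncomputable def fundamentalForm (g : HyperhermitianMetric H) (A : EndField E M) (hA : A.IsComplexStructure)
    (h : ∀ x v w, g.inner x (A x v) (A x w) = g.inner x v w) (x : M) :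
    TangentSpace 𝓘(ℝ, E) x [⋀^Fin 2]→L[ℝ] ℝ :=
  twoForm ((g.inner x).comp (A x)) (g.inner_apply_self A hA h x)
    (ContinuousLinearMap.continuous₂ (E := E) (F := E) ((g.inner x).comp (A x)))

/-- `ω_I = g(I·, ·)`. -/
noncomputable def omegaI (g : HyperhermitianMetric H) (x : M) : TangentSpace 𝓘(ℝ, E) x [⋀^Fin 2]→L[ℝ] ℝ :=
  g.fundamentalForm H.I H.isComplex_I g.hermitian_I x

/-- `ω_J = g(J·, ·)`. -/
noncomputable def omegaJ (g : HyperhermitianMetric H) (x : M) : TangentSpace 𝓘(ℝ, E) x [⋀^Fin 2]→L[ℝ] ℝ :=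
  g.fundamentalForm H.J H.isComplex_J g.hermitian_J x

/-- `ω_K = g(K·, ·)`. -/
noncomputable def omegaK (g : HyperhermitianMetric H) (x : M) : TangentSpace 𝓘(ℝ, E) x [⋀^Fin 2]→L[ℝ] ℝ :=
  g.fundamentalForm H.K H.isComplex_K g.hermitian_K x

/-- The `(2,0)`-form `Ω = (g(J·, ·) + i g(K·, ·)) / 2`. -/
noncomputable def Omega (g : HyperhermitianMetric H) (x : M) : TangentSpace 𝓘(ℝ, E) x [⋀^Fin 2]→L[ℝ] ℂ :=
  (1 / 2 : ℂ) • (Complex.ofRealCLM.compContinuousAlternatingMap (g.omegaJ x) +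
    Complex.I • Complex.ofRealCLM.compContinuousAlternatingMap (g.omegaK x))

/-- `g` is HKT: `∂Ω = 0`. As `Ω` is of type `(2,0)` with respect to `I`, the form `∂Ω` is the
`(3,0)`-component of `dΩ`. -/
def IsHKT (g : HyperhermitianMetric H) : Prop :=
  ∀ (x : M) (v : Fin 3 → TangentSpace 𝓘(ℝ, E) x),
    typePart (H.I x) 3 (mextDeriv g.Omega x) v = 0

/-- On a manifold of real dimension `4n`, hence of complex dimension `2n`, the Hermitian metric `g`
on `(M, I)` is balanced: `d(ω_I²ⁿ⁻¹) = 0`. -/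
def IsBalanced (n : ℕ) (g : HyperhermitianMetric H) : Prop :=
  ∀ x : M, mextDeriv (fun y => wedgePow (g.omegaI y) (2 * n - 1)) x = 0

end HyperhermitianMetric
end Manifold

/-! ### Solvmanifolds and invariant structures -/

section Solvmanifold

variable {E : Type*} [NormedAddCommGroup E] [NormedSpace ℝ E]
  {G : Type*} [Group G] [TopologicalSpace G] [ChartedSpace E G]
  {M : Type*} [TopologicalSpace M] [ChartedSpace E M]

/-- The map `q : G → M` exhibits the smooth manifold `M` as the quotient `Γ \ G` of the Lie group
`G` by left translations by elements of `Γ`: it is a surjective local diffeomorphism whose fibres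
are the cosets `Γ g`. -/
structure IsQuotientMap (Γ : Subgroup G) (q : G → M) : Prop where
  localDiffeo : IsLocalDiffeomorph 𝓘(ℝ, E) 𝓘(ℝ, E) ∞ q
  surjective : Function.Surjective q
  fibre : ∀ g h : G, q g = q h ↔ ∃ γ ∈ Γ, h = γ * g

variable [IsManifold 𝓘(ℝ, E) ∞ M]

/-- The endomorphism field `A` on `M = Γ \ G` is invariant, that is induced by a left-invariant
one on `G`: the latter is given by an endomorphism `A₀` of the Lie algebra, and sends the
left-invariant vector field of `v` to that of `A₀ v`. -/
def EndField.IsInvariant (q : G → M) (A : EndField E M) : Prop :=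
  ∃ A₀ : GroupLieAlgebra 𝓘(ℝ, E) G →L[ℝ] GroupLieAlgebra 𝓘(ℝ, E) G,
    ∀ (g : G) (v : GroupLieAlgebra 𝓘(ℝ, E) G),
      A (q g) (mfderiv 𝓘(ℝ, E) 𝓘(ℝ, E) q g (mulInvariantVectorField v g)) =
        mfderiv 𝓘(ℝ, E) 𝓘(ℝ, E) q g (mulInvariantVectorField (A₀ v) g)

/-- The hypercomplex structure on `M = Γ \ G` is invariant. -/
structure HypercomplexStructure.IsInvariant (q : G → M) (H : HypercomplexStructure E M) :
    Prop where
  I : H.I.IsInvariant q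
  J : H.J.IsInvariant q
  K : H.K.IsInvariant q

end Solvmanifold
end HKTSolv

/-! The left-invariant fields of `G` descend to a global frame of `M` with constant bracket
coefficients, in which `I`, `J`, `K` are constant matrices. A torsion-free connection preserving
them is unique (`eq_zero_of_symm_of_comm`), so the Obata connection also has constant coefficients
`Γ` in the frame (`conn_eq`). Three facts then give the theorem.

Averaging. A solvable group is amenable, so the right action of `G` on the compact space `M`
preserves a nonzero finite measure, and derivatives of functions along the frame integrate to zero.
Integrating the frame coefficients of an HKT metric therefore commutes with `d` on `Ω` and yields an
HKT metric with constant coefficients (`isHKT_of_average`).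

Trace. Parallel transport along the right translates `q (h * c t)` of a curve `c` has a matrix in
the frame that does not depend on `h`. By compactness of `M` every such path closes up to a loop
after composition with one of a controlled family of transports, and loops have determinant one.
Hence all the determinants are bounded; being closed under powers they have absolute value one
(`abs_det_eq_one`), and differentiating at the identity gives `tr Γ(v) = 0` (`trace_conn_eq_zero`).

Algebra. Let `h = -∇g`. Since `h` is skew for `I`, `J`, `K`, the HKT identity evaluated on `(e, J e,
z)` and summed over an orthonormal basis says, by the vanishing trace, that the divergence `∑ h(e;
e, z)` is zero (`sum_metricVariation_eq_zero`). On the other hand `ω^(2n-1)` is a multiple of the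
contraction of the top form `ω^(2n)` with the bivector dual to `ω`. The top form is parallel, again
by the vanishing trace, so `d(ω^(2n-1))` only sees the derivative of the bivector, and
antisymmetrization reduces it to that same divergence (`sum_wedgePow_update_eq_zero`). -/

namespace HKTSolv

/-! ### Alternating sums of products of pairs -/

section PairSum

open Equiv Finset

variable {T : Type*} {κ : Type*} [Fintype κ] [DecidableEq κ]

/-- The signed sum over all permutations of `∏ⱼ β (u (σ (j, 0)), u (σ (j, 1)))`. -/
noncomputable def pairSum (β : T → T → ℝ) (u : κ × Fin 2 → T) : ℝ :=
  ∑ σ : Perm (κ × Fin 2), ((Perm.sign σ : ℤ) : ℝ) * ∏ j, β (u (σ (j, 0))) (u (σ (j, 1)))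

/-- The family with the pair `(x, y)` put in front of the pairs of `w`. -/
def consPair (x y : T) (w : κ × Fin 2 → T) : Option κ × Fin 2 → T
  | (none, r) => if r = 0 then x else y
  | (some j, r) => w (j, r)

lemma pairSum_reindex {κ' : Type*} [Fintype κ'] [DecidableEq κ']
    (e : κ ≃ κ') (β : T → T → ℝ) (u : κ' × Fin 2 → T) :
    pairSum β (fun p : κ × Fin 2 => u (e p.1, p.2)) = pairSum β u := by
  unfold pairSum
  let E : κ × Fin 2 ≃ κ' × Fin 2 := e.prodCongr (Equiv.refl _)
  refine Fintype.sum_equiv (permCongr E) _ _ fun σ => ?_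
  rw [Perm.sign_permCongr]
  congr 1
  refine Fintype.prod_equiv e _ _ fun j => ?_
  simp [permCongr_apply, E, Prod.map]

/-- Each summand is unchanged when two pairs of positions are exchanged (an even permutation) or the
two entries of a pair are exchanged (an odd permutation, compensated by the skewness of `β`). These
symmetries act transitively on the `2 * card κ` positions, so the position where `σ` takes the value
`(j₀, 0)` may be normalized. -/
lemma pairSum_eq_fixed (β : T → T → ℝ) (hβ : ∀ x y, β x y = -β y x) (j₀ : κ)
    (u : κ × Fin 2 → T) :
    pairSum β u = 2 * Fintype.card κ * ∑ σ : Perm (κ × Fin 2),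
      if σ (j₀, 0) = (j₀, 0) then
        ((Perm.sign σ : ℤ) : ℝ) * ∏ j, β (u (σ (j, 0))) (u (σ (j, 1))) else 0 := by
  set G : Perm (κ × Fin 2) → ℝ := fun σ =>
    ((Perm.sign σ : ℤ) : ℝ) * ∏ j, β (u (σ (j, 0))) (u (σ (j, 1))) with hG
  have h1 : ∀ (j : κ) (σ : Perm (κ × Fin 2)),
      G (σ * prodCongrLeft fun _ : Fin 2 => swap j₀ j) = G σ := by
    intro j σ
    simp only [hG, Perm.sign_mul, Perm.sign_prodCongrLeft]
    congr 1
    · have : ∏ _k : Fin 2, Perm.sign (swap j₀ j) = 1 := by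
        rw [prod_const, card_univ, Fintype.card_fin, sq, Int.units_mul_self]
      rw [this, mul_one]
    · exact Fintype.prod_equiv (swap j₀ j) _ _ fun i => by simp
  have h2 : ∀ (r : Fin 2) (σ : Perm (κ × Fin 2)), G (σ * swap (j₀, 0) (j₀, r)) = G σ := by
    intro r σ
    rcases Fin.exists_fin_two.mp ⟨r, rfl⟩ with h | h
    · rw [h, swap_self]; exact congrArg G (mul_one σ)
    · rw [h]
      have hne : ((j₀, 0) : κ × Fin 2) ≠ (j₀, 1) := by simp
      simp only [hG, Perm.sign_mul, Perm.sign_swap hne]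
      rw [← mul_prod_erase univ _ (mem_univ j₀), ← mul_prod_erase univ _ (mem_univ j₀)]
      have h3 : ∀ j ∈ univ.erase j₀,
          β (u ((σ * swap (j₀, 0) (j₀, 1) : Perm (κ × Fin 2)) (j, 0)))
            (u ((σ * swap (j₀, 0) (j₀, 1) : Perm (κ × Fin 2)) (j, 1))) =
          β (u (σ (j, 0))) (u (σ (j, 1))) := by
        intro j hj
        have hj' : j ≠ j₀ := ne_of_mem_erase hj
        simp [swap_apply_of_ne_of_ne, hj']
      rw [prod_congr rfl h3, Perm.mul_apply, Perm.mul_apply, swap_apply_left, swap_apply_right,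
        hβ (u (σ (j₀, 1)))]
      push_cast
      ring
  have h3 : ∀ p : κ × Fin 2, ∑ σ : Perm (κ × Fin 2), (if σ p = (j₀, 0) then G σ else 0) =
      ∑ σ : Perm (κ × Fin 2), if σ (j₀, 0) = (j₀, 0) then G σ else 0 := by
    rintro ⟨j, r⟩
    let τ : Perm (κ × Fin 2) := (prodCongrLeft fun _ : Fin 2 => swap j₀ j) * swap (j₀, 0) (j₀, r)
    refine Fintype.sum_equiv (Equiv.mulRight τ) _ _ fun σ => ?_
    have hτ : τ (j₀, 0) = (j, r) := by simp [τ]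
    have hGτ : G (σ * τ) = G σ := by
      simp only [τ]; rw [← mul_assoc, h2, h1]
    simp only [coe_mulRight, Perm.mul_apply, hτ, hGτ]
  have h4 : ∀ σ : Perm (κ × Fin 2), G σ = ∑ p, if σ p = (j₀, 0) then G σ else 0 := by
    intro σ
    rw [Fintype.sum_eq_single (σ.symm (j₀, 0))]
    · simp
    · intro p hp
      rw [if_neg]
      intro h
      exact hp (by rw [← h]; simp)
  calc pairSum β u = ∑ σ, G σ := rfl
    _ = ∑ σ, ∑ p, if σ p = (j₀, 0) then G σ else 0 := Fintype.sum_congr _ _ h4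
    _ = ∑ p, ∑ σ, if σ p = (j₀, 0) then G σ else 0 := sum_comm
    _ = _ := by
      rw [Fintype.sum_congr _ _ h3, sum_const, card_univ, Fintype.card_prod, Fintype.card_fin,
        nsmul_eq_mul]
      push_cast
      ring

/-- The positions `Option κ × Fin 2` are the two positions of the first pair and the others. -/
def optionPairEquiv (κ : Type*) : Option (Option (κ × Fin 2)) ≃ Option κ × Fin 2 where
  toFun
    | none => (none, 0)
    | some none => (none, 1)
    | some (some (j, r)) => (some j, r)
  invFun
    | (none, r) => if r = 0 then none else some none
    | (some j, r) => some (some (j, r))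
  left_inv := by rintro (_ | _ | ⟨j, r⟩) <;> simp
  right_inv := by
    rintro ⟨_ | j, r⟩
    · rcases Fin.exists_fin_two.mp ⟨r, rfl⟩ with h | h <;> simp [h]
    · simp

/-- Expansion of `pairSum` along its first argument. -/
lemma pairSum_consPair (β : T → T → ℝ) (hβ : ∀ x y, β x y = -β y x) (x y : T)
    (w : κ × Fin 2 → T) :
    pairSum β (consPair x y w) = 2 * (Fintype.card κ + 1) *
      (β x y * pairSum β w - ∑ a, β x (w a) * pairSum β (Function.update w a y)) := by
  rw [pairSum_eq_fixed β hβ none, Fintype.card_option]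
  push_cast
  congr 1
  set E := optionPairEquiv κ
  -- A permutation of the positions is recorded by the images `i` and `q` of the first two positions
  -- and a permutation `τ` of the others. The normalization forces `i = none`. Then `q = none` pairs
  -- `x` with `y`, while `q = some a` pairs `x` with `w a` and puts `y` in the place of `w a`, at
  -- the cost of a sign.
  let D : Option (Option (κ × Fin 2)) × Option (κ × Fin 2) × Perm (κ × Fin 2) ≃
      Perm (Option κ × Fin 2) :=
    ((Perm.decomposeOption.trans ((Equiv.refl _).prodCongr Perm.decomposeOption)).symm).trans
      (permCongr E)
  have hD : ∀ i q τ, D (i, q, τ) =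
      permCongr E (swap none i * optionCongr (swap none q * optionCongr τ)) := fun i q τ => rfl
  rw [← D.sum_comp, Fintype.sum_prod_type, Fintype.sum_eq_single none]
  rotate_left
  · intro i hi
    refine sum_eq_zero fun p _ => if_neg ?_
    intro h
    rw [show p = (p.1, p.2) from rfl, hD, permCongr_apply, ← Equiv.eq_symm_apply] at h
    have : E.symm (none, 0) = none := by simp [E, optionPairEquiv]
    rw [this] at h
    simp at h
    exact hi h
  have hE0 : E.symm (none, 0) = none := by simp [E, optionPairEquiv]
  have hu1 : consPair x y w (E (some none)) = y := by simp [E, optionPairEquiv, consPair]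
  have hus : ∀ a, consPair x y w (E (some (some a))) = w a := fun a => by
    simp [E, optionPairEquiv, consPair]
  have hterm : ∀ (q : Option (κ × Fin 2)) (τ : Perm (κ × Fin 2)),
      (if D (none, q, τ) (none, 0) = (none, 0) then
        ((Perm.sign (D (none, q, τ)) : ℤ) : ℝ) * ∏ j,
          β (consPair x y w (D (none, q, τ) (j, 0))) (consPair x y w (D (none, q, τ) (j, 1)))
        else 0) =
      ((Perm.sign (swap none q) : ℤ) : ℝ) * ((Perm.sign τ : ℤ) : ℝ) *
        (β x (consPair x y w (E (some q))) *
        ∏ j, β (consPair x y w (E (some (swap none q (some (τ (j, 0)))))))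
          (consPair x y w (E (some (swap none q (some (τ (j, 1)))))))) := by
    intro q τ
    have h0 : D (none, q, τ) (none, 0) = (none, 0) := by
      rw [hD, permCongr_apply, hE0]
      simp [E, optionPairEquiv]
    rw [if_pos h0, Fintype.prod_option, h0]
    have hs : ((Perm.sign (D (none, q, τ)) : ℤ) : ℝ) =
        ((Perm.sign (swap none q) : ℤ) : ℝ) * ((Perm.sign τ : ℤ) : ℝ) := by
      rw [hD, Perm.sign_permCongr, Perm.sign_mul, swap_self, Perm.sign_refl, one_mul,
        optionCongr_sign, Perm.sign_mul, optionCongr_sign]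
      push_cast
      rfl
    rw [hs]
    rfl
  rw [Fintype.sum_prod_type]
  simp only [hterm]
  rw [Fintype.sum_option, sub_eq_add_neg]
  congr 1
  · simp only [swap_self, Perm.sign_refl, hu1, refl_apply, hus, pairSum, mul_sum]
    refine Fintype.sum_congr _ _ fun τ => ?_
    push_cast
    ring
  · rw [← sum_neg_distrib]
    refine Fintype.sum_congr _ _ fun a => ?_
    have hsw : ∀ b : κ × Fin 2, consPair x y w (E (some (swap none (some a) (some b)))) =
        Function.update w a y b := by
      intro b
      by_cases h : b = a
      · subst h; rw [swap_apply_right, hu1]; simp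
      · rw [swap_apply_of_ne_of_ne (by simp) (by simpa using h), hus]; simp [h]
    simp only [hsw, hus, pairSum, mul_sum]
    rw [← sum_neg_distrib]
    refine Fintype.sum_congr _ _ fun τ => ?_
    rw [Perm.sign_swap (by simp)]
    push_cast
    ring

end PairSum
end HKTSolv

namespace HKTSolv

/-! ### Contraction of wedge powers with the dual bivector -/

section Contraction

open Finset

variable {T : Type*} [AddCommGroup T] [Module ℝ T] [TopologicalSpace T]

lemma wedgePow_eq_pairSum (β : T [⋀^Fin 2]→L[ℝ] ℝ) (k : ℕ) (v : Fin (k * 2) → T) :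
    wedgePow β k v =
      ((2 : ℝ) ^ k)⁻¹ * pairSum (fun x y => β ![x, y]) (fun p => v (finProdFinEquiv p)) := by
  rw [wedgePow, ContinuousAlternatingMap.smul_apply, smul_eq_mul,
    ContinuousMultilinearMap.alternatization_apply_apply, pairSum]
  congr 1
  refine (Fintype.sum_equiv (Equiv.permCongr finProdFinEquiv) _ _ fun σ => ?_).symm
  rw [Equiv.Perm.sign_permCongr, Units.smul_def, zsmul_eq_mul]
  congr 1
  refine Fintype.prod_congr _ _ fun j => congrArg β ?_
  ext r
  rcases Fin.exists_fin_two.mp ⟨r, rfl⟩ with h | h <;> simp [h]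

/-- The positions of `Fin (k * 2 + 2)`, with those of the first pair put in front. -/
noncomputable def consPairFinEquiv (k : ℕ) : Option (Fin k) × Fin 2 ≃ Fin (k * 2 + 2) :=
  (((finSuccEquiv k).symm.prodCongr (Equiv.refl _)).trans finProdFinEquiv).trans
    (finCongr (by ring))

lemma consPairFinEquiv_none (k : ℕ) (r : Fin 2) :
    (consPairFinEquiv k (none, r) : ℕ) = r := by
  simp [consPairFinEquiv]

lemma consPairFinEquiv_some (k : ℕ) (j : Fin k) (r : Fin 2) :
    consPairFinEquiv k (some j, r) = (finProdFinEquiv (j, r)).succ.succ := by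
  ext
  simp [consPairFinEquiv]
  ring

/-- The wedge power `β^(k+1)`, with `k * 2 + 2` arguments. -/
noncomputable def wedgePowSucc (β : T [⋀^Fin 2]→L[ℝ] ℝ) (k : ℕ) : T [⋀^Fin (k * 2 + 2)]→ₗ[ℝ] ℝ :=
  ((wedgePow β (k + 1)).toAlternatingMap).domDomCongr (finCongr (by ring))

lemma wedgePowSucc_apply (β : T [⋀^Fin 2]→L[ℝ] ℝ) (k : ℕ) (x y : T) (w : Fin (k * 2) → T) :
    wedgePowSucc β k (Fin.cons x (Fin.cons y w)) = ((2 : ℝ) ^ (k + 1))⁻¹ *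
      pairSum (fun x y => β ![x, y]) (consPair x y fun p => w (finProdFinEquiv p)) := by
  have h1 : wedgePowSucc β k (Fin.cons x (Fin.cons y w)) =
      wedgePow β (k + 1) (fun i => (Fin.cons x (Fin.cons y w) : Fin (k * 2 + 2) → T)
        (finCongr (by ring) i)) := rfl
  rw [h1, wedgePow_eq_pairSum, ← pairSum_reindex (finSuccEquiv k).symm]
  congr 2
  ext ⟨j, r⟩
  have h2 : ∀ p : Option (Fin k) × Fin 2, (finCongr (by ring) (finProdFinEquiv
      ((finSuccEquiv k).symm p.1, p.2)) : Fin (k * 2 + 2)) = consPairFinEquiv k p := fun p => rfl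
  rw [h2]
  cases j with
  | some j => rw [consPairFinEquiv_some]; rfl
  | none =>
    rcases Fin.exists_fin_two.mp ⟨r, rfl⟩ with h | h
    · have : consPairFinEquiv k (none, r) = 0 := by
        ext; rw [consPairFinEquiv_none, h]; rfl
      rw [this, h]; simp [consPair]
    · have : consPairFinEquiv k (none, r) = 1 := by
        ext; rw [consPairFinEquiv_none, h]; simp
      rw [this, h]; simp [consPair]

/-- This is `ι_x β^(k+1) = (k+1) (ι_x β) ∧ β^k`, evaluated with `y` as first remaining argument. The
factor is `2 (k+1)` from `pairSum_consPair` times the ratio `1/2` of the normalizations. -/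
lemma wedgePowSucc_expand (β : T [⋀^Fin 2]→L[ℝ] ℝ) (k : ℕ) (x y : T) (w : Fin (k * 2) → T) :
    wedgePowSucc β k (Fin.cons x (Fin.cons y w)) = (k + 1) *
      (β ![x, y] * wedgePow β k w - ∑ a, β ![x, w a] * wedgePow β k (Function.update w a y)) := by
  have hβ : ∀ x y, β ![x, y] = -β ![y, x] := by
    intro x y
    have h := β.toAlternatingMap.map_swap ![y, x] (i := 0) (j := 1) (by simp)
    rw [← ContinuousAlternatingMap.coe_toAlternatingMap, ← h]
    congr 1
    ext i
    rcases Fin.exists_fin_two.mp ⟨i, rfl⟩ with h | h <;> simp [h]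
  rw [wedgePowSucc_apply, pairSum_consPair _ hβ, Fintype.card_fin, wedgePow_eq_pairSum]
  have h : ∑ a, β ![x, w a] * wedgePow β k (Function.update w a y) =
      ((2 : ℝ) ^ k)⁻¹ * ∑ p, β ![x, w (finProdFinEquiv p)] * pairSum (fun x y => β ![x, y])
        (Function.update (fun p => w (finProdFinEquiv p)) p y) := by
    rw [mul_sum]
    refine (Fintype.sum_equiv finProdFinEquiv _ _ fun p => ?_).symm
    rw [wedgePow_eq_pairSum]
    have : (fun q => Function.update w (finProdFinEquiv p) y (finProdFinEquiv q)) =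
        Function.update (fun p => w (finProdFinEquiv p)) p y := by
      ext q
      by_cases hq : q = p
      · subst hq; simp
      · simp [hq]
    rw [this]
    ring
  rw [h, pow_succ]
  field_simp

/-- `wedgePowSucc β k` contracted with the bivector `∑ e_a ∧ f_a` dual to `β` is a multiple of
`βᵏ`. -/
lemma sum_wedgePowSucc {ι : Type*} [Fintype ι] (β : T [⋀^Fin 2]→L[ℝ] ℝ) (k : ℕ) (e f : ι → T)
    (hef : ∀ x, ∑ a, β ![e a, x] • f a = x) (w : Fin (k * 2) → T) :
    ∑ a, wedgePowSucc β k (Fin.cons (e a) (Fin.cons (f a) w)) =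
      ((k + 1) * ((∑ a, β ![e a, f a]) - k * 2)) * wedgePow β k w := by
  simp only [wedgePowSucc_expand, ← mul_sum, sum_sub_distrib, ← sum_mul]
  rw [sum_comm]
  -- By duality `∑ β(e_a, w i) f_a = w i`, so each of the `2k` slots gives back `β^k(w)`.
  have h : ∀ i, ∑ a, β ![e a, w i] * wedgePow β k (Function.update w i (f a)) =
      wedgePow β k w := by
    intro i
    have h1 := (wedgePow β k).toAlternatingMap.toMultilinearMap.map_update_sum univ i
      (fun a => β ![e a, w i] • f a) w
    rw [hef, Function.update_eq_self] at h1
    refine Eq.trans ?_ h1.symm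
    refine sum_congr rfl fun a _ => ?_
    exact ((wedgePow β k).map_update_smul w i _ _).symm
  rw [sum_congr rfl fun i _ => h i, sum_const, card_univ, Fintype.card_fin, nsmul_eq_mul]
  push_cast
  ring

end Contraction
end HKTSolv

namespace HKTSolv

/-! ### Forms of top degree -/

section TopForms

open Finset

variable {T : Type*} [AddCommGroup T] [Module ℝ T]

/-- An endomorphism acts on top degree forms, as a derivation, by its trace. -/
lemma sum_update_eq_trace_mul {ι : Type*} [Fintype ι] [DecidableEq ι] (b : Module.Basis ι ℝ T)
    (W : T [⋀^ι]→ₗ[ℝ] ℝ) (A : T →ₗ[ℝ] T) (w : ι → T) :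
    ∑ j, W (Function.update w j (A (w j))) = LinearMap.trace ℝ T A * W w := by
  rw [W.eq_smul_basis_det b]
  simp only [AlternatingMap.smul_apply, smul_eq_mul, Module.Basis.det_apply, ← mul_sum]
  set M := b.toMatrix w
  -- In coordinates, column `j` of the matrix `M` of `w` is replaced by column `j` of `A M`.
  -- Cramer's rule turns the sum of these determinants into `tr (adj M * A M) = det M * tr A`.
  have h : ∀ j, b.toMatrix (Function.update w j (A (w j))) =
      M.updateCol j ((LinearMap.toMatrix b b A * M).col j) := by
    intro j
    ext i k
    by_cases hk : k = j
    · subst hk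
      simp [Module.Basis.toMatrix_apply, Matrix.col, M, Matrix.mul_apply, LinearMap.toMatrix_apply]
      have := congrArg (fun x => b.repr (A x) i) (b.sum_repr (w k)).symm
      simp only [map_sum, map_smul, Finsupp.coe_finsetSum, Finset.sum_apply, Finsupp.smul_apply,
        smul_eq_mul] at this
      rw [this]
    · simp [Module.Basis.toMatrix_apply, hk, M]
  simp only [h, ← Matrix.cramer_apply, Matrix.cramer_eq_adjugate_mulVec]
  have h2 : ∑ j, (M.adjugate.mulVec ((LinearMap.toMatrix b b A * M).col j)) j =
      (M.adjugate * (LinearMap.toMatrix b b A * M)).trace := by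
    simp [Matrix.trace, Matrix.mulVec, dotProduct, Matrix.mul_apply, Matrix.col]
  rw [h2, ← Matrix.mul_assoc, Matrix.trace_mul_comm, ← Matrix.mul_assoc, Matrix.mul_adjugate,
    Matrix.smul_mul, Matrix.one_mul, Matrix.trace_smul, LinearMap.trace_eq_matrix_trace ℝ b]
  simp only [smul_eq_mul]
  ring

/-- On a space of dimension `d + 2` the antisymmetrization of `L ⊗ W` over `d + 3` arguments
vanishes. -/
lemma sum_removeNth_eq {d : ℕ} [FiniteDimensional ℝ T] (hd : Module.finrank ℝ T = d + 2)
    (W : T [⋀^Fin (d + 2)]→ₗ[ℝ] ℝ) (L : T →ₗ[ℝ] ℝ) (x y : T) (v : Fin (d + 1) → T) :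
    ∑ i : Fin (d + 1), (-1) ^ (i : ℕ) * (L (v i) * W (Fin.cons x (Fin.cons y (i.removeNth v)))) =
      L y * W (Fin.cons x v) - L x * W (Fin.cons y v) := by
  let u : Fin (d + 3) → T := Fin.cons x (Fin.cons y v)
  -- An alternating form of degree `d + 3` vanishes in dimension `d + 2`. Its value on `(x, y, v)`
  -- splits according to whether `L` takes `x`, `y` or one of the `v i`.
  have h0 : (AlternatingMap.alternatizeUncurryFin (L.smulRight W)) u = 0 := by
    apply AlternatingMap.map_linearDependent
    intro hli
    have := hli.fintype_card_le_finrank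
    rw [Fintype.card_fin, hd] at this
    omega
  rw [AlternatingMap.alternatizeUncurryFin_apply, Fin.sum_univ_succ, Fin.sum_univ_succ] at h0
  have e0 : (0 : Fin (d + 3)).removeNth u = Fin.cons y v := by
    rw [Fin.removeNth_zero]; rfl
  have e1 : (Fin.succ (0 : Fin (d + 2))).removeNth u = Fin.cons x v := by
    ext i
    refine Fin.cases ?_ (fun i => ?_) i
    · rfl
    · simp [Fin.removeNth, u]
  have e2 : ∀ i : Fin (d + 1), (i.succ.succ).removeNth u =
      Fin.cons x (Fin.cons y (i.removeNth v)) := by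
    intro i
    ext j
    refine Fin.cases ?_ (fun j => Fin.cases ?_ (fun j => ?_) j) j
    · rfl
    · simp [Fin.removeNth, u]
    · simp [Fin.removeNth, u]
  simp only [e0, e1, e2] at h0
  simp [u, pow_succ] at h0
  linarith

end TopForms

/-! ### Linear algebra of the HKT and balanced conditions -/

section HyperhermitianAlgebra

open Finset

variable {T : Type*} [AddCommGroup T] [Module ℝ T] {ι : Type*} [Fintype ι] [DecidableEq ι]
  (B : T →ₗ[ℝ] T →ₗ[ℝ] ℝ) (e : Module.Basis ι ℝ T)

/-- The form `B (Γ x y) z + B y (Γ x z)`, that is minus the covariant derivative of `B`. -/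
def metricVariation (Γ : T →ₗ[ℝ] T →ₗ[ℝ] T) (x y z : T) : ℝ := B (Γ x y) z + B y (Γ x z)

variable {B e}

lemma repr_eq_of_orthonormal (he : ∀ a b, B (e a) (e b) = if a = b then 1 else 0) (x : T)
    (a : ι) : B (e a) x = e.repr x a := by
  have h := congrArg (B (e a)) (e.sum_repr x)
  simp only [map_sum, map_smul, he] at h
  simpa using h.symm

lemma sum_orthonormal_smul (he : ∀ a b, B (e a) (e b) = if a = b then 1 else 0) (x : T) :
    ∑ a, B (e a) x • e a = x := by
  simp only [repr_eq_of_orthonormal he, e.sum_repr]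

lemma trace_eq_sum_orthonormal (he : ∀ a b, B (e a) (e b) = if a = b then 1 else 0)
    (A : T →ₗ[ℝ] T) : LinearMap.trace ℝ T A = ∑ a, B (e a) (A (e a)) := by
  rw [LinearMap.trace_eq_matrix_trace ℝ e]
  refine sum_congr rfl fun a _ => ?_
  rw [Matrix.diag_apply, LinearMap.toMatrix_apply, repr_eq_of_orthonormal he]

/-- The vectors `A (e a)` form an orthonormal basis too; the expansion of `-(A x)` in `e`,
transported by `A`, is the expansion of `x` in them. -/
lemma sum_orthonormal_smul_isometry (he : ∀ a b, B (e a) (e b) = if a = b then 1 else 0)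
    {A : T →ₗ[ℝ] T} (hA : ∀ x, A (A x) = -x) (hB : ∀ x y, B (A x) (A y) = B x y) (x : T) :
    ∑ a, B (A (e a)) x • A (e a) = x := by
  have h := congrArg A (sum_orthonormal_smul he (-(A x)))
  rw [map_sum, map_neg, hA, neg_neg] at h
  refine Eq.trans (sum_congr rfl fun a _ => ?_) h
  rw [map_smul]
  congr 1
  rw [← hB (A (e a)) x, hA]
  simp

/-- The contraction of a bilinear form does not change under an orthogonal complex structure. -/
lemma sum_isometry (he : ∀ a b, B (e a) (e b) = if a = b then 1 else 0)
    (hs : ∀ x y, B x y = B y x)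
    {A : T →ₗ[ℝ] T} (hA : ∀ x, A (A x) = -x) (hB : ∀ x y, B (A x) (A y) = B x y)
    (β : T →ₗ[ℝ] T →ₗ[ℝ] ℝ) : ∑ a, β (A (e a)) (A (e a)) = ∑ a, β (e a) (e a) := by
  have h1 : ∀ a, β (A (e a)) (A (e a)) = ∑ b, B (e b) (A (e a)) * β (e b) (A (e a)) := by
    intro a
    conv_lhs => enter [1, 2]; rw [← sum_orthonormal_smul he (A (e a))]
    simp
  have h2 : ∀ b, β (e b) (e b) = ∑ a, B (e b) (A (e a)) * β (e b) (A (e a)) := by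
    intro b
    conv_lhs => enter [2]; rw [← sum_orthonormal_smul_isometry he hA hB (e b)]
    simp [hs (e b)]
  rw [sum_congr rfl fun a _ => h1 a, sum_congr rfl fun b _ => h2 b, sum_comm]

/-- For a hyperhermitian metric and a quaternionic connection of trace zero, the HKT condition
implies that the contraction of the covariant derivative of the metric vanishes. -/
lemma sum_metricVariation_eq_zero (he : ∀ a b, B (e a) (e b) = if a = b then 1 else 0)
    (hs : ∀ x y, B x y = B y x) {I J K : T →ₗ[ℝ] T}
    (hI : ∀ x, I (I x) = -x) (hJ : ∀ x, J (J x) = -x) (hK : ∀ x, K (K x) = -x)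
    (hIJ : ∀ x, I (J x) = K x)
    (hBI : ∀ x y, B (I x) (I y) = B x y) (hBJ : ∀ x y, B (J x) (J y) = B x y)
    (hBK : ∀ x y, B (K x) (K y) = B x y)
    {Γ : T →ₗ[ℝ] T →ₗ[ℝ] T} (hΓI : ∀ x y, Γ x (I y) = I (Γ x y))
    (hΓJ : ∀ x y, Γ x (J y) = J (Γ x y)) (hΓK : ∀ x y, Γ x (K y) = K (Γ x y))
    (htr : ∀ x, LinearMap.trace ℝ T (Γ x) = 0)
    (hHKT : ∀ x y z,
      metricVariation B Γ x (J y) z + metricVariation B Γ (I x) (K y) z +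
      metricVariation B Γ y (J z) x + metricVariation B Γ (I y) (K z) x +
      metricVariation B Γ z (J x) y + metricVariation B Γ (I z) (K x) y = 0) (z : T) :
    ∑ a, metricVariation B Γ (e a) (e a) z = 0 := by
  let h : T →ₗ[ℝ] T →ₗ[ℝ] T →ₗ[ℝ] ℝ := LinearMap.mk₂ ℝ
    (fun x y => B (Γ x y) + (B y).comp (Γ x))
    (fun x x' y => by ext z; simp; ring) (fun c x y => by ext z; simp)
    (fun x y y' => by ext z; simp; ring) (fun c x y => by ext z; simp)
  have hh : ∀ x y z, metricVariation B Γ x y z = h x y z := fun x y z => rfl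
  -- Both `Γ x` and `B` are compatible with `A`, so `h x` inherits from `B` the skewness of `A`.
  have skew : ∀ A : T →ₗ[ℝ] T, (∀ x, A (A x) = -x) → (∀ x y, B (A x) (A y) = B x y) →
      (∀ x y, Γ x (A y) = A (Γ x y)) → ∀ x y z, h x (A y) z = -h x y (A z) := by
    intro A hA hB hΓ x y z
    have hsk : ∀ y z, B (A y) z = -B y (A z) := by
      intro y z
      rw [← hB y (A z), hA]; simp
    simp only [← hh, metricVariation, hΓ, hsk]
    ring
  have sym : ∀ x y z, h x y z = h x z y := by
    intro x y z
    simp only [← hh, metricVariation, hs y, hs _ z]; ring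
  simp only [hh] at hHKT ⊢
  let β : T →ₗ[ℝ] T →ₗ[ℝ] ℝ := LinearMap.mk₂ ℝ (fun x y => h x y z)
    (by intros; simp) (by intros; simp) (by intros; simp) (by intros; simp)
  have hβ : ∀ x y, h x y z = β x y := fun x y => rfl
  have htr' : ∀ x, ∑ a, h x (e a) (e a) = 0 := by
    intro x
    have h1 : ∑ a, h x (e a) (e a) = ∑ a, (B (e a) (Γ x (e a)) + B (e a) (Γ x (e a))) := by
      refine sum_congr rfl fun a _ => ?_
      rw [← hh, metricVariation, hs]
    rw [h1, sum_add_distrib, ← trace_eq_sum_orthonormal he, htr]; simp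
  have hJe : ∑ a, h z (J (e a)) (J (e a)) = 0 := by
    rw [sum_isometry he hs hJ hBJ (h z), htr' z]
  -- The HKT identity on `(e a, J (e a), z)`. Its sixth term is `h (I z) (I u) u` with `u = J (e
  -- a)`, which is zero as `h` is symmetric and skew for `I`. After summation the first four terms
  -- are equal, and the last one is a trace of `Γ z`.
  have key : ∀ a, -β (e a) (e a) - β (I (e a)) (I (e a)) - β (J (e a)) (J (e a)) -
      β (K (e a)) (K (e a)) + h z (J (e a)) (J (e a)) = 0 := by
    intro a
    have h0 := hHKT (e a) (J (e a)) z
    have hKJ : K (J (e a)) = -I (e a) := by rw [← hIJ, hJ, map_neg]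
    rw [hJ, hKJ, hIJ, map_neg, LinearMap.neg_apply, map_neg, LinearMap.neg_apply] at h0
    rw [skew J hJ hBJ hΓJ (J (e a)) z, sym _ z, skew K hK hBK hΓK _ z, sym _ z] at h0
    have h1 : h (I z) (K (e a)) (J (e a)) = 0 := by
      have h2 : h (I z) (I (J (e a))) (J (e a)) = 0 := by
        have := skew I hI hBI hΓI (I z) (J (e a)) (J (e a))
        rw [sym _ (J (e a)) (I _)] at this
        linarith
      rwa [hIJ] at h2
    rw [h1] at h0
    simp only [hβ] at h0
    linarith
  have hsum := sum_eq_zero fun a (_ : a ∈ Finset.univ) => key a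
  simp only [sum_add_distrib, sum_sub_distrib, sum_neg_distrib, hJe,
    sum_isometry he hs hI hBI β, sum_isometry he hs hJ hBJ β, sum_isometry he hs hK hBK β]
    at hsum
  simp only [hβ]
  linarith

variable [TopologicalSpace T]

/-- If the contraction of the covariant derivative of a Hermitian metric vanishes, for a complex
connection of trace zero, then `θ^m` is closed, for its
fundamental form `θ`, where `dim T = 2 m + 2`. -/
lemma sum_wedgePow_update_eq_zero (he : ∀ a b, B (e a) (e b) = if a = b then 1 else 0)
    (hs : ∀ x y, B x y = B y x) {I : T →ₗ[ℝ] T} (hI : ∀ x, I (I x) = -x)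
    (hBI : ∀ x y, B (I x) (I y) = B x y) {Γ : T →ₗ[ℝ] T →ₗ[ℝ] T}
    (hΓI : ∀ x y, Γ x (I y) = I (Γ x y)) (htr : ∀ x, LinearMap.trace ℝ T (Γ x) = 0)
    (hσ : ∀ z, ∑ a, metricVariation B Γ (e a) (e a) z = 0) (θ : T [⋀^Fin 2]→L[ℝ] ℝ)
    (hθ : ∀ x y, θ ![x, y] = B (I x) y) {m : ℕ} (hm : Module.finrank ℝ T = m * 2 + 2)
    (v : Fin (m * 2 + 1) → T) :
    ∑ i : Fin (m * 2 + 1), (-1) ^ (i : ℕ) * ∑ j, wedgePow θ m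
      (Function.update (i.removeNth v) j (Γ (v i) (i.removeNth v j))) = 0 := by
  have : FiniteDimensional ℝ T := Module.finite_of_finrank_pos (by omega)
  set V := wedgePowSucc θ m
  -- Here `V` is the top form `θ^(m+1)`, and `F w` is `V` with all but its first two arguments
  -- filled by `w`.
  let F : (Fin (m * 2) → T) → T →ₗ[ℝ] T →ₗ[ℝ] ℝ := fun w => LinearMap.mk₂ ℝ
    (fun x y => (V.curryLeft x).curryLeft y w)
    (by intros; simp) (by intros; simp) (by intros; simp) (by intros; simp)
  have hF : ∀ w x y, V (Fin.cons x (Fin.cons y w)) = F w x y := fun w x y => rfl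
  have hcard : Fintype.card ι = m * 2 + 2 := by rw [← hm, Module.finrank_eq_card_basis e]
  -- The constant is `(m + 1) * (dim T - 2 m)`, since `θ (e a, I (e a)) = 1`.
  have hC : ∀ w, ∑ a, F w (e a) (I (e a)) = (2 * (m + 1)) * wedgePow θ m w := by
    intro w
    have h := sum_wedgePowSucc θ m e (fun a => I (e a))
      (fun x => by simpa only [hθ] using sum_orthonormal_smul_isometry he hI hBI x) w
    have h2 : ∑ a, θ ![e a, I (e a)] = m * 2 + 2 := by
      simp only [hθ, hBI, he, if_true, sum_const, Finset.card_univ, hcard]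
      simp
    rw [h2] at h
    simp only [← hF]
    rw [h]; ring
  -- As `Γ x` has trace zero it annihilates `V`, so its action on `θ^m` is moved to the bivector `∑
  -- e_a ∧ I e_a`; the resulting coefficients are those of the metric variation.
  have hder : ∀ (x : T) (w : Fin (m * 2) → T),
      (2 * (m + 1)) * ∑ j, wedgePow θ m (Function.update w j (Γ x (w j))) =
        -∑ a, ∑ b, metricVariation B Γ x (e a) (e b) * F w (e b) (I (e a)) := by
    intro x w
    have h1 : ∀ y z, ∑ j, F (Function.update w j (Γ x (w j))) y z =
        -F w (Γ x y) z - F w y (Γ x z) := by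
      intro y z
      have h := sum_update_eq_trace_mul (Module.finBasisOfFinrankEq ℝ T hm) V (Γ x)
        (Fin.cons y (Fin.cons z w))
      rw [htr, zero_mul, Fin.sum_univ_succ, Fin.sum_univ_succ] at h
      simp only [Fin.cons_zero, Fin.cons_succ, Fin.update_cons_zero, ← Fin.cons_update, hF] at h
      linarith
    rw [mul_sum]
    simp only [← hC]
    rw [sum_comm]
    simp only [h1, hΓI]
    rw [sum_sub_distrib, sum_neg_distrib]
    have h2 : ∑ a, F w (Γ x (e a)) (I (e a)) =
        ∑ a, ∑ b, B (Γ x (e a)) (e b) * F w (e b) (I (e a)) := by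
      refine sum_congr rfl fun a _ => ?_
      conv_lhs => rw [← sum_orthonormal_smul he (Γ x (e a))]
      simp [hs _ (Γ x (e a))]
    have h3 : ∑ a, F w (e a) (I (Γ x (e a))) =
        ∑ a, ∑ b, B (e a) (Γ x (e b)) * F w (e b) (I (e a)) := by
      rw [sum_comm]
      refine sum_congr rfl fun a _ => ?_
      conv_lhs => rw [← sum_orthonormal_smul he (Γ x (e a))]
      simp
    rw [h2, h3]
    simp only [metricVariation, add_mul, sum_add_distrib]
    ring
  have hmain : (2 * ((m : ℝ) + 1)) * ∑ i : Fin (m * 2 + 1), (-1) ^ (i : ℕ) * ∑ j, wedgePow θ m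
      (Function.update (i.removeNth v) j (Γ (v i) (i.removeNth v j))) = 0 := by
    let L : T → T → T →ₗ[ℝ] ℝ := fun y z =>
      { toFun := fun x => metricVariation B Γ x y z
        map_add' := by intros; simp [metricVariation]; ring
        map_smul' := by intros; simp [metricVariation]; ring }
    have h1 : (2 * ((m : ℝ) + 1)) * ∑ i : Fin (m * 2 + 1), (-1) ^ (i : ℕ) * ∑ j, wedgePow θ m
        (Function.update (i.removeNth v) j (Γ (v i) (i.removeNth v j))) =
        -∑ a, ∑ b, ∑ i : Fin (m * 2 + 1), (-1) ^ (i : ℕ) * (L (e a) (e b) (v i) *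
          V (Fin.cons (e b) (Fin.cons (I (e a)) (i.removeNth v)))) := by
      rw [mul_sum]
      have : ∀ i : Fin (m * 2 + 1), (2 * ((m : ℝ) + 1)) * ((-1) ^ (i : ℕ) * ∑ j, wedgePow θ m
        (Function.update (i.removeNth v) j (Γ (v i) (i.removeNth v j)))) =
        -∑ a, ∑ b, (-1) ^ (i : ℕ) * (L (e a) (e b) (v i) *
          V (Fin.cons (e b) (Fin.cons (I (e a)) (i.removeNth v)))) := by
        intro i
        rw [mul_left_comm, hder]
        simp only [← mul_sum]
        rw [mul_neg]
        rfl
      rw [sum_congr rfl fun i _ => this i, sum_neg_distrib, sum_comm]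
      congr 1
      exact sum_congr rfl fun a _ => sum_comm
    rw [h1]
    -- Antisymmetrization over `v` leaves only terms where `L (e a) (e b)` is evaluated on one of
    -- the two bivector entries, `I (e a)` or `e b`; each of these sums is a divergence of the
    -- metric variation.
    simp only [sum_removeNth_eq hm V]
    simp only [sum_sub_distrib]
    have h2 : ∑ a, ∑ b, L (e a) (e b) (I (e a)) * V (Fin.cons (e b) v) = 0 := by
      rw [sum_comm]
      refine sum_eq_zero fun b _ => ?_
      rw [← sum_mul]
      have h3 : ∑ a, L (e a) (e b) (I (e a)) = 0 := by
        let β : T →ₗ[ℝ] T →ₗ[ℝ] ℝ := LinearMap.mk₂ ℝ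
          (fun x y => metricVariation B Γ x y (I (e b)))
          (by intros; simp [metricVariation]; ring) (by intros; simp [metricVariation]; ring)
          (by intros; simp [metricVariation]; ring) (by intros; simp [metricVariation]; ring)
        have h4 := sum_isometry he hs hI hBI β
        -- Applying `I` to both metric arguments replaces `(I e_a; e_a, e_b)` by `(I e_a; I e_a, I
        -- e_b)`, and the contraction over the basis `I e_a` equals that over `e_a`.
        have h5 : ∑ a, β (e a) (e a) = 0 := hσ (I (e b))
        rw [h5] at h4
        refine Eq.trans (sum_congr rfl fun a _ => ?_) h4
        change metricVariation B Γ _ _ _ = metricVariation B Γ _ _ _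
        simp only [metricVariation, hΓI, hBI]
      rw [h3, zero_mul]
    have h3 : ∑ a, ∑ b, L (e a) (e b) (e b) * V (Fin.cons (I (e a)) v) = 0 := by
      refine sum_eq_zero fun a _ => ?_
      rw [← sum_mul]
      have : ∑ b, L (e a) (e b) (e b) = 0 := by
        rw [← hσ (e a)]
        refine sum_congr rfl fun b _ => ?_
        change metricVariation B Γ _ _ _ = metricVariation B Γ _ _ _
        simp only [metricVariation]
        rw [hs (e a), hs _ (e b)]; ring
      rw [this, zero_mul]
    rw [h2, h3]; simp
  have hpos : (2 * ((m : ℝ) + 1)) ≠ 0 := by positivity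
  exact (mul_eq_zero.mp hmain).resolve_left hpos

end HyperhermitianAlgebra
end HKTSolv

namespace HKTSolv

/-! ### The exterior derivative in a frame -/

section ExtDeriv

open Finset

/-- The mechanism behind `d² = 0`: alternating successively in the two arguments of a symmetric map
gives zero. It shows that the choice of torsion-free connection does not affect the exterior
derivative. -/
lemma sum_update_symm_eq_zero {T F : Type*} [AddCommGroup T] [Module ℝ T] [AddCommGroup F]
    [Module ℝ F] {k : ℕ} (α : T [⋀^Fin k]→ₗ[ℝ] F) (S : T →ₗ[ℝ] T →ₗ[ℝ] T)
    (hS : ∀ x y, S x y = S y x) (v : Fin (k + 1) → T) :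
    ∑ i : Fin (k + 1), (-1 : ℤ) ^ (i : ℕ) • ∑ j, α (Function.update (i.removeNth v) j
      (S (v i) (i.removeNth v j))) = 0 := by
  cases k with
  | zero => simp
  | succ k =>
    let f : T →ₗ[ℝ] T →ₗ[ℝ] T [⋀^Fin k]→ₗ[ℝ] F := LinearMap.mk₂ ℝ
      (fun x y => α.curryLeft (S x y)) (by intros; simp) (by intros; simp) (by intros; simp)
      (by intros; simp)
    have h := congrArg (fun g => g v)
      (AlternatingMap.alternatizeUncurryFin_alternatizeUncurryFinLM_comp_of_symmetric (f := f)
        (fun x y => by simp [f, hS x y]))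
    refine Eq.trans ?_ h
    rw [AlternatingMap.alternatizeUncurryFin_apply]
    refine sum_congr rfl fun i _ => ?_
    rw [LinearMap.comp_apply, AlternatingMap.alternatizeUncurryFinLM_apply,
      AlternatingMap.alternatizeUncurryFin_apply]
    congr 1
    refine sum_congr rfl fun j _ => ?_
    rw [← Fin.insertNth_removeNth, AlternatingMap.map_insertNth]
    rfl

variable {E F : Type*} [NormedAddCommGroup E] [NormedSpace ℝ E] [NormedAddCommGroup F]
  [NormedSpace ℝ F]

/-- The exterior derivative in terms of a frame `Ψ` and a torsion-free connection `Γ`. -/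
lemma extDeriv_apply_frame {k : ℕ} {a : E → E [⋀^Fin k]→L[ℝ] F} {Ψ : E → E →L[ℝ] E} {y : E}
    (ha : DifferentiableAt ℝ a y) (hΨ : DifferentiableAt ℝ Ψ y) (Φ : E ≃L[ℝ] E)
    (hΦ : ∀ v, Ψ y v = Φ v) (Γ : E →ₗ[ℝ] E →ₗ[ℝ] E)
    (hΓ : ∀ v w, lieBracket ℝ (fun z => Ψ z v) (fun z => Ψ z w) y = Φ (Γ v w - Γ w v))
    (v : Fin (k + 1) → E) :
    extDeriv a y (fun i => Φ (v i)) = ∑ i : Fin (k + 1), (-1 : ℤ) ^ (i : ℕ) •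
      (fderiv ℝ (fun z => a z (fun j => Ψ z (i.removeNth v j))) y (Φ (v i)) -
        ∑ j, a y (fun l => Φ (Function.update (i.removeNth v) j
          (Γ (v i) (i.removeNth v j)) l))) := by
  have hΨ' : ∀ w, DifferentiableAt ℝ (fun z => Ψ z w) y := fun w => by fun_prop
  -- The difference between `Γ` and the flat connection of `E`, read through the frame. Both are
  -- torsion-free, hence `S` is symmetric, and the formula differs from the one for constant fields
  -- exactly by the alternation of `S`.
  let S : E →ₗ[ℝ] E →ₗ[ℝ] E := LinearMap.mk₂ ℝ
    (fun x z => Φ (Γ (Φ.symm x) (Φ.symm z)) - fderiv ℝ Ψ y x (Φ.symm z))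
    (by intros; simp; abel) (by intros; simp [smul_sub]) (by intros; simp; abel)
    (by intros; simp [smul_sub])
  have hD : ∀ w u, fderiv ℝ (fun z => Ψ z w) y u = fderiv ℝ Ψ y u w := by
    intro w u
    have := fderiv_clm_apply hΨ (differentiableAt_const w)
    rw [this]
    simp
  have hS : ∀ x z, S x z = S z x := by
    intro x z
    have h := hΓ (Φ.symm x) (Φ.symm z)
    rw [lieBracket, hD, hD, hΦ, hΦ] at h
    simp only [ContinuousLinearEquiv.apply_symm_apply, map_sub] at h
    simp only [S, LinearMap.mk₂_apply]
    rw [sub_eq_sub_iff_add_eq_add] at h ⊢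
    exact h.symm.trans (add_comm _ _)
  have h0 := sum_update_symm_eq_zero (a y).toAlternatingMap S hS (fun i => Φ (v i))
  rw [extDeriv_apply ha, ← sub_eq_zero]
  refine Eq.trans ?_ h0
  rw [← sum_sub_distrib]
  refine sum_congr rfl fun i _ => ?_
  rw [fderiv_continuousAlternatingMap_apply_apply ha (fun j => hΨ' _),
    fderiv_continuousAlternatingMap_apply_const_apply ha, ← smul_sub]
  congr 1
  have h1 : (fun j => Ψ y (i.removeNth v j)) = i.removeNth fun i => Φ (v i) := by
    ext j; simp [Fin.removeNth, hΦ]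
  have h2 : ∀ j, (fun l => Φ (Function.update (i.removeNth v) j
      (Γ (v i) (i.removeNth v j)) l)) = Function.update (i.removeNth fun i => Φ (v i)) j
        (Φ (Γ (v i) (i.removeNth v j))) := by
    intro j
    ext l
    by_cases hl : l = j
    · subst hl; simp
    · simp [hl, Fin.removeNth]
  simp only [h1, h2, hD]
  rw [sub_eq_iff_eq_add]
  have h3 : ∀ j, a y (Function.update (i.removeNth fun i => Φ (v i)) j
      (S (Φ (v i)) (i.removeNth (fun i => Φ (v i)) j))) =
      a y (Function.update (i.removeNth fun i => Φ (v i)) j (Φ (Γ (v i) (i.removeNth v j)))) -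
      a y (Function.update (i.removeNth fun i => Φ (v i)) j
        (fderiv ℝ Ψ y (Φ (v i)) (i.removeNth v j))) := by
    intro j
    rw [← ContinuousAlternatingMap.map_update_sub]
    simp [S, Fin.removeNth]
  simp only [ContinuousAlternatingMap.coe_toAlternatingMap, h3, sum_sub_distrib]
  abel

end ExtDeriv
end HKTSolv

namespace HKTSolv

/-! ### Regularity tested on vectors -/

section FiniteDim

variable {E F E' : Type*} [NormedAddCommGroup E] [NormedSpace ℝ E] [FiniteDimensional ℝ E]
  [NormedAddCommGroup F] [NormedSpace ℝ F] [NormedAddCommGroup E'] [NormedSpace ℝ E']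

/-- Evaluation on tuples of basis vectors embeds the alternating forms linearly in a finite product
of copies of `F`; a left inverse recovers `b` from its components. -/
lemma differentiableAt_alternating_of_apply [FiniteDimensional ℝ F] {k : ℕ}
    {b : E' → E [⋀^Fin k]→L[ℝ] F} {y : E'}
    (h : ∀ v, DifferentiableAt ℝ (fun z => b z v) y) : DifferentiableAt ℝ b y := by
  let e := Module.finBasis ℝ E
  let ev : E [⋀^Fin k]→L[ℝ] F →ₗ[ℝ] ((Fin k → Fin (Module.finrank ℝ E)) → F) :=
    { toFun := fun α s => α fun i => e (s i)
      map_add' := fun _ _ => rfl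
      map_smul' := fun _ _ => rfl }
  have hev : LinearMap.ker ev = ⊥ := by
    rw [LinearMap.ker_eq_bot]
    intro α β hαβ
    apply ContinuousAlternatingMap.toAlternatingMap_injective
    exact Module.Basis.ext_alternating e fun s _ => congrFun hαβ s
  obtain ⟨L, hL⟩ := ev.exists_leftInverse_of_injective hev
  have hb : b = fun z => LinearMap.toContinuousLinearMap L (ev (b z)) := by
    ext1 z
    exact (LinearMap.congr_fun hL (b z)).symm
  rw [hb]
  apply (LinearMap.toContinuousLinearMap L).differentiableAt.comp
  exact differentiableAt_pi.mpr fun s => h _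

lemma contMDiffAt_clm_of_apply {M : Type*} [TopologicalSpace M] [ChartedSpace E' M]
    {Φ : M → E →L[ℝ] F} {x : M} {n : WithTop ℕ∞}
    (h : ∀ v, ContMDiffAt 𝓘(ℝ, E') 𝓘(ℝ, F) n (fun p => Φ p v) x) :
    ContMDiffAt 𝓘(ℝ, E') 𝓘(ℝ, E →L[ℝ] F) n Φ x := by
  let e := Module.finBasis ℝ E
  let c : Fin (Module.finrank ℝ E) → F →L[ℝ] (E →L[ℝ] F) := fun i =>
    ContinuousLinearMap.smulRightL ℝ E F (LinearMap.toContinuousLinearMap (e.coord i))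
  have hΦ : Φ = fun p => ∑ i, c i (Φ p (e i)) := by
    ext p v
    simp only [c, sum_apply, ContinuousLinearMap.smulRightL_apply_apply]
    conv_lhs => rw [← e.sum_repr v]
    simp only [map_sum, map_smul]
    rfl
  rw [hΦ]
  apply ContMDiffAt.sum
  intro i _
  exact (c i).contDiff.contMDiff.contMDiffAt.comp x (h (e i))

end FiniteDim

/-! ### Global frames with constant structure coefficients -/

section Frame

variable {E : Type*} [NormedAddCommGroup E] [NormedSpace ℝ E]
  {M : Type*} [TopologicalSpace M] [ChartedSpace E M] [IsManifold 𝓘(ℝ, E) ∞ M]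

variable (E M) in
/-- A global frame of the tangent bundle whose Lie brackets have constant coefficients. -/
structure LieFrame where
  toFun : Π x : M, E ≃L[ℝ] TangentSpace 𝓘(ℝ, E) x
  smooth : ∀ v, ContMDiff 𝓘(ℝ, E) 𝓘(ℝ, E).tangent ∞
    (fun x => (⟨x, toFun x v⟩ : TangentBundle 𝓘(ℝ, E) M))
  bracket : E → E → E
  mlieBracket_eq : ∀ v w x, mlieBracket 𝓘(ℝ, E) (fun y => (toFun y v : TangentSpace 𝓘(ℝ, E) y))
    (fun y => (toFun y w : TangentSpace 𝓘(ℝ, E) y)) x = toFun x (bracket v w)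

namespace LieFrame

variable (φ : LieFrame E M)

/-- The frame in the trivialization of `TM` at `x`. -/
noncomputable def coord (x p : M) : E →L[ℝ] E :=
  ((trivializationAt E (TangentSpace 𝓘(ℝ, E) : M → Type _) x).continuousLinearMapAt ℝ p).comp
    (φ.toFun p : E →L[ℝ] TangentSpace 𝓘(ℝ, E) p)

lemma coord_eq {x p : M} (hp : p ∈ (chartAt E x).source) (v : E) :
    φ.coord x p v = mfderiv 𝓘(ℝ, E) 𝓘(ℝ, E) (extChartAt 𝓘(ℝ, E) x) p (φ.toFun p v) := by
  rw [coord, TangentBundle.continuousLinearMapAt_trivializationAt hp]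
  rfl

lemma coord_apply {x p : M} (hp : p ∈ (chartAt E x).source) (v : E) :
    φ.coord x p v = (trivializationAt E (TangentSpace 𝓘(ℝ, E) : M → Type _) x
      (⟨p, φ.toFun p v⟩ : TangentBundle 𝓘(ℝ, E) M)).2 := by
  simp only [coord, ContinuousLinearMap.comp_apply]
  rw [Trivialization.continuousLinearMapAt_apply, Trivialization.coe_linearMapAt_of_mem]
  · rfl
  · simpa using hp

/-- The frame at `p` in the trivialization at `x`, as an equivalence. -/
noncomputable def coordEquiv {x p : M} (hp : p ∈ (chartAt E x).source) : E ≃L[ℝ] E :=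
  (φ.toFun p).trans ((trivializationAt E (TangentSpace 𝓘(ℝ, E) : M → Type _)
    x).continuousLinearEquivAt ℝ p (by simpa using hp))

lemma coordEquiv_apply {x p : M} (hp : p ∈ (chartAt E x).source) (v : E) :
    φ.coordEquiv hp v = φ.coord x p v := by
  rw [φ.coord_apply hp]
  simp [coordEquiv]

variable [FiniteDimensional ℝ E]

lemma contMDiffAt_coord (x : M) {p : M} (hp : p ∈ (chartAt E x).source) :
    ContMDiffAt 𝓘(ℝ, E) 𝓘(ℝ, E →L[ℝ] E) ∞ (φ.coord x) p := by
  apply contMDiffAt_clm_of_apply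
  intro v
  have h := ((trivializationAt E (TangentSpace 𝓘(ℝ, E) : M → Type _) x).contMDiffAt_section_iff
    (IB := 𝓘(ℝ, E)) (n := ∞) (s := fun q => φ.toFun q v) (x₀ := p) (by simpa using hp)).mp
    (φ.smooth v p)
  refine h.congr_of_eventuallyEq ?_
  filter_upwards [(chartAt E x).open_source.mem_nhds hp] with q hq
  exact φ.coord_apply hq v

end LieFrame
end Frame
end HKTSolv

namespace HKTSolv

/-! ### Frames read in a chart -/

section Frame

lemma extChartAt_symm_mem {E : Type*} [NormedAddCommGroup E] [NormedSpace ℝ E]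
    {M : Type*} [TopologicalSpace M] [ChartedSpace E M] {x : M} {y : E} (hy : y ∈ (extChartAt 𝓘(ℝ, E) x).target) :
    (extChartAt 𝓘(ℝ, E) x).symm y ∈ (chartAt E x).source := by
  have := (extChartAt 𝓘(ℝ, E) x).map_target hy
  rwa [extChartAt_source] at this

variable {E : Type*} [NormedAddCommGroup E] [NormedSpace ℝ E]
  {M : Type*} [TopologicalSpace M] [ChartedSpace E M] [IsManifold 𝓘(ℝ, E) ∞ M]

namespace LieFrame

variable (φ : LieFrame E M)

/-- The frame in the chart at `x`. -/
noncomputable def chartFrame (x : M) (y : E) : E →L[ℝ] E :=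
  φ.coord x ((extChartAt 𝓘(ℝ, E) x).symm y)

lemma differentiableAt_chartFrame [FiniteDimensional ℝ E] (x : M) :
    DifferentiableAt ℝ (φ.chartFrame x) (extChartAt 𝓘(ℝ, E) x x) := by
  have h1 : ContMDiffAt 𝓘(ℝ, E) 𝓘(ℝ, E) ∞ (extChartAt 𝓘(ℝ, E) x).symm
      (extChartAt 𝓘(ℝ, E) x x) :=
    (contMDiffOn_extChartAt_symm x).contMDiffAt (extChartAt_target_mem_nhds x)
  have h2 : ContMDiffAt 𝓘(ℝ, E) 𝓘(ℝ, E →L[ℝ] E) ∞ (φ.coord x)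
      ((extChartAt 𝓘(ℝ, E) x).symm (extChartAt 𝓘(ℝ, E) x x)) := by
    rw [extChartAt_to_inv]
    exact φ.contMDiffAt_coord x (mem_chart_source E x)
  exact (h2.comp _ h1).contDiffAt.differentiableAt (by simp)

lemma mfderiv_symm_chartFrame {x : M} {y : E} (hy : y ∈ (extChartAt 𝓘(ℝ, E) x).target) (v : E) :
    mfderiv 𝓘(ℝ, E) 𝓘(ℝ, E) (extChartAt 𝓘(ℝ, E) x).symm y (φ.chartFrame x y v) =
      φ.toFun _ v := by
  have h := mfderivWithin_extChartAt_symm_comp_mfderiv_extChartAt (I := 𝓘(ℝ, E)) hy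
  rw [modelWithCornersSelf_coe, range_id, mfderivWithin_univ] at h
  rw [chartFrame, φ.coord_eq (extChartAt_symm_mem hy)]
  exact congrArg (fun L => L (φ.toFun _ v)) h

lemma mpullbackWithin_eq_chartFrame {x : M} {y : E} (hy : y ∈ (extChartAt 𝓘(ℝ, E) x).target)
    (v : E) :
    mpullbackWithin 𝓘(ℝ, E) 𝓘(ℝ, E) (extChartAt 𝓘(ℝ, E) x).symm
      (fun y => (φ.toFun y v : TangentSpace 𝓘(ℝ, E) y)) univ y = φ.chartFrame x y v := by
  have h := mfderivWithin_extChartAt_symm_comp_mfderiv_extChartAt (I := 𝓘(ℝ, E)) hy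
  have h' := mfderiv_extChartAt_comp_mfderivWithin_extChartAt_symm (I := 𝓘(ℝ, E)) hy
  rw [modelWithCornersSelf_coe, range_id] at h h'
  rw [mpullbackWithin_apply, ContinuousLinearMap.inverse_eq h h', chartFrame,
    φ.coord_eq (extChartAt_symm_mem hy)]
  rfl

/-- The bracket on `M` is by definition computed in the chart at `x`, where the pulled back frame
fields agree with `chartFrame` near the base point. -/
lemma lieBracket_chartFrame [FiniteDimensional ℝ E] (x : M) (v w : E) :
    lieBracket ℝ (fun z => φ.chartFrame x z v) (fun z => φ.chartFrame x z w)
      (extChartAt 𝓘(ℝ, E) x x) = φ.coord x x (φ.bracket v w) := by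
  let V : E → E → E := fun v y => mpullbackWithin 𝓘(ℝ, E) 𝓘(ℝ, E) (extChartAt 𝓘(ℝ, E) x).symm
    (fun y => (φ.toFun y v : TangentSpace 𝓘(ℝ, E) y)) univ y
  have he : ∀ v, V v =ᶠ[𝓝 (extChartAt 𝓘(ℝ, E) x x)] fun z => φ.chartFrame x z v := fun v => by
    filter_upwards [extChartAt_target_mem_nhds x] with y hy
    exact φ.mpullbackWithin_eq_chartFrame hy v
  have h0 := φ.mlieBracket_eq v w x
  rw [← mlieBracketWithin_univ, mlieBracketWithin_apply, preimage_univ, univ_inter,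
    modelWithCornersSelf_coe, range_id] at h0
  let L : TangentSpace 𝓘(ℝ, E) x →L[ℝ] E := mfderiv 𝓘(ℝ, E) 𝓘(ℝ, E) (extChartAt 𝓘(ℝ, E) x) x
  have h : L.inverse (lieBracketWithin ℝ (V v) (V w) univ (extChartAt 𝓘(ℝ, E) x x)) =
    φ.toFun x (φ.bracket v w) := h0
  rw [lieBracketWithin_univ, (he v).lieBracket_vectorField_eq (he w)] at h
  have hinv : L.IsInvertible :=
    isInvertible_mfderiv_extChartAt (I := 𝓘(ℝ, E)) (mem_extChartAt_source (I := 𝓘(ℝ, E)) x)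
  rw [φ.coord_eq (mem_chart_source E x), ← h]
  exact (hinv.self_apply_inverse _).symm

variable [FiniteDimensional ℝ E] {F : Type*} [NormedAddCommGroup F] [NormedSpace ℝ F] [FiniteDimensional ℝ F]

/-- The derivative of a function along a field of the frame. -/
noncomputable def dirDeriv (f : M → F) (x : M) (v : E) : F :=
  mfderiv 𝓘(ℝ, E) 𝓘(ℝ, F) f x (φ.toFun x v)

/-- The exterior derivative of a form evaluated on a frame, in terms of a torsion-free connection
with constant coefficients `Γ`. -/
theorem mextDeriv_apply {k : ℕ} (α : Π x : M, TangentSpace 𝓘(ℝ, E) x [⋀^Fin k]→L[ℝ] F) (x : M)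
    (hα : ∀ v : Fin k → E, MDifferentiableAt 𝓘(ℝ, E) 𝓘(ℝ, F)
      (fun y => α y fun i => φ.toFun y (v i)) x)
    (Γ : E →ₗ[ℝ] E →ₗ[ℝ] E) (hΓ : ∀ v w, Γ v w - Γ w v = φ.bracket v w) (v : Fin (k + 1) → E) :
    mextDeriv α x (fun i => φ.toFun x (v i)) = ∑ i : Fin (k + 1), (-1 : ℤ) ^ (i : ℕ) •
      (φ.dirDeriv (fun y => α y fun j => φ.toFun y (i.removeNth v j)) x (v i) -
        ∑ j, α x (fun l => φ.toFun x (Function.update (i.removeNth v) j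
          (Γ (v i) (i.removeNth v j)) l))) := by
  set y₀ := extChartAt 𝓘(ℝ, E) x x with hy₀
  set a : E → E [⋀^Fin k]→L[ℝ] F := fun y =>
    (α ((extChartAt 𝓘(ℝ, E) x).symm y)).compContinuousLinearMap
      (mfderiv 𝓘(ℝ, E) 𝓘(ℝ, E) (extChartAt 𝓘(ℝ, E) x).symm y) with ha_def
  have hx : x ∈ (chartAt E x).source := mem_chart_source E x
  have hy₀t : y₀ ∈ (extChartAt 𝓘(ℝ, E) x).target := mem_extChartAt_target x
  have hmem : ∀ᶠ y in 𝓝 y₀, y ∈ (extChartAt 𝓘(ℝ, E) x).target := extChartAt_target_mem_nhds x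
  have hsymm : (extChartAt 𝓘(ℝ, E) x).symm y₀ = x := extChartAt_to_inv x
  have hsymmd : MDifferentiableAt 𝓘(ℝ, E) 𝓘(ℝ, E) (extChartAt 𝓘(ℝ, E) x).symm y₀ :=
    ((contMDiffOn_extChartAt_symm (n := ∞) x).contMDiffAt hmem).mdifferentiableAt (by simp)
  let f : (Fin k → E) → M → F := fun w y => α y fun i => φ.toFun y (w i)
  have haf : ∀ y ∈ (extChartAt 𝓘(ℝ, E) x).target, ∀ w : Fin k → E,
      a y (fun i => φ.chartFrame x y (w i)) = f w ((extChartAt 𝓘(ℝ, E) x).symm y) := by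
    intro y hy w
    change α _ (fun i => mfderiv 𝓘(ℝ, E) 𝓘(ℝ, E) (extChartAt 𝓘(ℝ, E) x).symm y
      (φ.chartFrame x y (w i))) = α _ fun i => φ.toFun _ (w i)
    congr 1
    funext i
    exact φ.mfderiv_symm_chartFrame hy (w i)
  let D : (Fin k → E) → E →L[ℝ] F := fun w =>
    ContinuousLinearMap.comp (M₂ := E) (mfderiv 𝓘(ℝ, E) 𝓘(ℝ, F) (f w) x : E →L[ℝ] F)
      (mfderiv 𝓘(ℝ, E) 𝓘(ℝ, E) (extChartAt 𝓘(ℝ, E) x).symm y₀ : E →L[ℝ] E)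
  have hfd : ∀ w, HasFDerivAt (fun y => f w ((extChartAt 𝓘(ℝ, E) x).symm y)) (D w) y₀ := by
    intro w
    have h1 := (hα w).hasMFDerivAt
    rw [← hsymm] at h1
    have h2 := (h1.comp y₀ hsymmd.hasMFDerivAt).hasFDerivAt
    rw [hsymm] at h2
    exact h2
  have hΨ := φ.differentiableAt_chartFrame x
  have hΦ : ∀ v, φ.chartFrame x y₀ v = φ.coordEquiv hx v := by
    intro v
    rw [chartFrame, hsymm, coordEquiv_apply]
  -- Only the frame components of `α` are assumed differentiable: they give the form `b` pulled back
  -- by the frame, and `a` is recovered from `b` by the inverse frame.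
  have ha : DifferentiableAt ℝ a y₀ := by
    let b : E → E [⋀^Fin k]→L[ℝ] F := fun y => (a y).compContinuousLinearMap (φ.chartFrame x y)
    have hb : DifferentiableAt ℝ b y₀ := by
      apply differentiableAt_alternating_of_apply
      intro w
      refine (hfd w).differentiableAt.congr_of_eventuallyEq ?_
      filter_upwards [hmem] with y hy
      exact haf y hy w
    have hinv : DifferentiableAt ℝ (fun y => (φ.chartFrame x y).inverse) y₀ := by
      have h1 : ((φ.coordEquiv hx : E ≃L[ℝ] E) : E →L[ℝ] E) = φ.chartFrame x y₀ := by
        ext v; exact (hΦ v).symm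
      have h2 := contDiffAt_map_inverse (n := 1) (φ.coordEquiv hx)
      rw [h1] at h2
      exact (h2.differentiableAt (by simp)).comp y₀ hΨ
    refine (hb.continuousAlternatingMapCompContinuousLinearMap hinv).congr_of_eventuallyEq ?_
    filter_upwards [hmem] with y hy
    have hy' := extChartAt_symm_mem hy
    have h1 : φ.chartFrame x y = (φ.coordEquiv hy' : E →L[ℝ] E) := by
      ext v; rw [chartFrame]; exact (φ.coordEquiv_apply hy' v).symm
    ext w
    simp only [b, h1, ContinuousAlternatingMap.compContinuousLinearMap_apply,
      ContinuousLinearMap.inverse_equiv]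
    congr 1
    ext i
    simp
  have key := extDeriv_apply_frame ha hΨ (φ.coordEquiv hx) hΦ Γ (fun v w => by
    rw [hΓ, coordEquiv_apply]; exact φ.lieBracket_chartFrame x v w) v
  have hleft : mextDeriv α x (fun i => φ.toFun x (v i)) =
      extDeriv a y₀ (fun i => φ.coordEquiv hx (v i)) := by
    change extDeriv a y₀ (fun i => mfderiv 𝓘(ℝ, E) 𝓘(ℝ, E) (extChartAt 𝓘(ℝ, E) x) x
      (φ.toFun x (v i))) = _
    congr 1
    funext i
    rw [coordEquiv_apply]
    exact (φ.coord_eq hx (v i)).symm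
  rw [hleft, key]
  refine Finset.sum_congr rfl fun i _ => ?_
  congr 1
  have hback : ∀ v, mfderiv 𝓘(ℝ, E) 𝓘(ℝ, E) (extChartAt 𝓘(ℝ, E) x).symm y₀
      (φ.coordEquiv hx v) = φ.toFun x v := by
    intro v
    rw [← hΦ, φ.mfderiv_symm_chartFrame hy₀t, hsymm]
  congr 1
  · have h1 : (fun z => a z fun j => φ.chartFrame x z (i.removeNth v j)) =ᶠ[𝓝 y₀]
        fun y => f (i.removeNth v) ((extChartAt 𝓘(ℝ, E) x).symm y) := by
      filter_upwards [hmem] with y hy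
      exact haf y hy _
    rw [h1.fderiv_eq]
    have h2 := (hfd (i.removeNth v)).fderiv
    let L : TangentSpace 𝓘(ℝ, E) x →L[ℝ] F := mfderiv 𝓘(ℝ, E) 𝓘(ℝ, F) (f (i.removeNth v)) x
    exact (congrArg (fun A : E →L[ℝ] F => A (φ.coordEquiv hx (v i))) h2).trans
      (congrArg L (hback (v i)))
  · refine Finset.sum_congr rfl fun j _ => ?_
    have h1 := haf y₀ hy₀t (Function.update (i.removeNth v) j (Γ (v i) (i.removeNth v j)))
    rw [hsymm] at h1
    simp only [hΦ] at h1
    exact h1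

end LieFrame
end Frame
end HKTSolv

namespace HKTSolv

/-! ### The Obata connection has constant coefficients -/

section Obata

variable {E : Type*} [NormedAddCommGroup E] [NormedSpace ℝ E]
  {M : Type*} [TopologicalSpace M] [ChartedSpace E M] [IsManifold 𝓘(ℝ, E) ∞ M]

/-- The hypercomplex structure has constant coefficients `I₀`, `J₀`, `K₀` in the frame. -/
structure LieFrame.IsAdapted (φ : LieFrame E M) (H : HypercomplexStructure E M)
    (I₀ J₀ K₀ : E →L[ℝ] E) : Prop where
  I : ∀ x v, H.I x (φ.toFun x v) = φ.toFun x (I₀ v)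
  J : ∀ x v, H.J x (φ.toFun x v) = φ.toFun x (J₀ v)
  K : ∀ x v, H.K x (φ.toFun x v) = φ.toFun x (K₀ v)

namespace LieFrame

variable (φ : LieFrame E M)

namespace IsAdapted

variable {φ} {H : HypercomplexStructure E M} {I₀ J₀ K₀ : E →L[ℝ] E} [Nonempty M]

lemma I_sq (h : φ.IsAdapted H I₀ J₀ K₀) (v : E) : I₀ (I₀ v) = -v := by
  obtain ⟨x⟩ := ‹Nonempty M›
  apply (φ.toFun x).injective
  rw [← h.I, ← h.I, H.isComplex_I.sq, map_neg]

lemma J_sq (h : φ.IsAdapted H I₀ J₀ K₀) (v : E) : J₀ (J₀ v) = -v := by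
  obtain ⟨x⟩ := ‹Nonempty M›
  apply (φ.toFun x).injective
  rw [← h.J, ← h.J, H.isComplex_J.sq, map_neg]

lemma K_sq (h : φ.IsAdapted H I₀ J₀ K₀) (v : E) : K₀ (K₀ v) = -v := by
  obtain ⟨x⟩ := ‹Nonempty M›
  apply (φ.toFun x).injective
  rw [← h.K, ← h.K, H.isComplex_K.sq, map_neg]

lemma I_J (h : φ.IsAdapted H I₀ J₀ K₀) (v : E) : I₀ (J₀ v) = K₀ v := by
  obtain ⟨x⟩ := ‹Nonempty M›
  apply (φ.toFun x).injective
  rw [← h.I, ← h.J, H.I_J, h.K]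

lemma J_I (h : φ.IsAdapted H I₀ J₀ K₀) (v : E) : J₀ (I₀ v) = -K₀ v := by
  obtain ⟨x⟩ := ‹Nonempty M›
  apply (φ.toFun x).injective
  rw [← h.J, ← h.I, H.J_I, h.K, map_neg]

end IsAdapted

lemma mdifferentiableAt (v : E) (x : M) : MDifferentiableAt 𝓘(ℝ, E) 𝓘(ℝ, E).tangent
    (fun x => (⟨x, φ.toFun x v⟩ : TangentBundle 𝓘(ℝ, E) M)) x :=
  (φ.smooth v x).mdifferentiableAt (by simp)

variable (cov : CovariantDerivative 𝓘(ℝ, E) E (TangentSpace 𝓘(ℝ, E) : M → Type _))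

/-- The connection coefficients in the frame. -/
noncomputable def conn (x : M) : E →ₗ[ℝ] E →ₗ[ℝ] E :=
  LinearMap.mk₂ ℝ (fun v w => (φ.toFun x).symm (cov (fun y => φ.toFun y w) x (φ.toFun x v)))
    (by intros; simp only [map_add]) (by intros; simp only [map_smul])
    (by
      intro v w w'
      have h : (fun y => φ.toFun y (w + w') : Π y, TangentSpace 𝓘(ℝ, E) y) =
        (fun y => φ.toFun y w) + (fun y => φ.toFun y w') := by
        ext1 y; exact map_add (φ.toFun y) w w'
      rw [h, cov.isCovariantDerivativeOn.add (φ.mdifferentiableAt w x) (φ.mdifferentiableAt w' x),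
        _root_.add_apply, map_add])
    (by
      intro c v w
      have h : (fun y => φ.toFun y (c • w) : Π y, TangentSpace 𝓘(ℝ, E) y) =
        c • (fun y => φ.toFun y w) := by
        ext1 y; exact map_smul (φ.toFun y) c w
      rw [h, cov.isCovariantDerivativeOn.smul_const c (φ.mdifferentiableAt w x),
        _root_.smul_apply, map_smul])

variable {cov}

lemma toFun_conn (x : M) (v w : E) :
    φ.toFun x (φ.conn cov x v w) = cov (fun y => φ.toFun y w) x (φ.toFun x v) := by
  simp [conn]

lemma conn_sub_conn {H : HypercomplexStructure E M} (h : IsObata cov H) (x : M) (v w : E) :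
    φ.conn cov x v w - φ.conn cov x w v = φ.bracket v w := by
  apply (φ.toFun x).injective
  rw [map_sub, toFun_conn, toFun_conn, ← φ.mlieBracket_eq]
  exact h.torsionFree _ _ x (φ.mdifferentiableAt v x) (φ.mdifferentiableAt w x)

lemma conn_comm {A : EndField E M} (hA : Preserves cov A) {A₀ : E →L[ℝ] E}
    (h : ∀ x v, A x (φ.toFun x v) = φ.toFun x (A₀ v)) (x : M) (v w : E) :
    φ.conn cov x v (A₀ w) = A₀ (φ.conn cov x v w) := by
  apply (φ.toFun x).injective
  rw [← h, toFun_conn, toFun_conn, ← hA _ x (φ.mdifferentiableAt w x)]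
  congr 2
  ext1 y
  exact (h y w).symm

/-- A symmetric bilinear map commuting with a quaternionic structure in one argument vanishes. -/
lemma eq_zero_of_symm_of_comm {T : Type*} [AddCommGroup T] [Module ℝ T] {I J K : T →ₗ[ℝ] T}
    {S : T → T → T} (hK : ∀ x, K (K x) = -x)
    (hIJ : ∀ x, I (J x) = K x) (hJI : ∀ x, J (I x) = -K x) (hS : ∀ x y, S x y = S y x)
    (hSI : ∀ x y, S x (I y) = I (S x y)) (hSJ : ∀ x y, S x (J y) = J (S x y)) (x y : T) :
    S x y = 0 := by
  -- The two orders of pulling `I` and `J` out of `S`, allowed by its symmetry, produce `J I = -K`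
  -- and `I J = K`.
  have h1 : S (I x) (J y) = -K (S x y) := by
    rw [hSJ, hS, hSI, hJI, hS]
  have h2 : S (I x) (J y) = K (S x y) := by
    rw [hS, hSI, hS, hSJ, hIJ]
  have h3 : K (S x y) = 0 := by
    have h4 : (2 : ℝ) • K (S x y) = 0 := by
      rw [two_smul]
      nth_rewrite 1 [← h2]
      rw [h1, neg_add_cancel]
    exact (smul_eq_zero.mp h4).resolve_left two_ne_zero
  have := hK (S x y)
  rw [h3, map_zero] at this
  exact neg_eq_zero.mp this.symm

/-- At every point the antisymmetric part of the coefficients is the same constant bracket, so the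
difference between two points is symmetric; it also commutes with the constant matrices `I₀` and
`J₀`. The uniqueness argument for the Obata connection then applies. -/
lemma conn_eq {H : HypercomplexStructure E M} (h : IsObata cov H) {I₀ J₀ K₀ : E →L[ℝ] E}
    (hφ : φ.IsAdapted H I₀ J₀ K₀) (x y : M) : φ.conn cov x = φ.conn cov y := by
  have : Nonempty M := ⟨x⟩
  refine LinearMap.ext₂ fun v w => sub_eq_zero.mp ?_
  refine eq_zero_of_symm_of_comm (I := I₀.toLinearMap) (J := J₀.toLinearMap)
    (K := K₀.toLinearMap)
    (S := fun v w => φ.conn cov x v w - φ.conn cov y v w)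
    hφ.K_sq hφ.I_J hφ.J_I ?_ ?_ ?_ v w
  · intro v w
    have h1 := φ.conn_sub_conn h x v w
    have h2 := φ.conn_sub_conn h y v w
    rw [← h2] at h1
    rw [sub_eq_sub_iff_add_eq_add] at h1 ⊢
    rw [add_comm (φ.conn cov x w v), add_comm, ← add_comm, h1, add_comm]
  · intro v w
    simp only [ContinuousLinearMap.coe_coe, φ.conn_comm h.preserves_I hφ.I, map_sub]
  · intro v w
    simp only [ContinuousLinearMap.coe_coe, φ.conn_comm h.preserves_J hφ.J, map_sub]

/-- The covariant derivative of a vector field given by its components in the frame. -/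
lemma cov_apply [FiniteDimensional ℝ E] {u : M → E} {x : M}
    (hu : MDifferentiableAt 𝓘(ℝ, E) 𝓘(ℝ, E) u x) (v : E) :
    cov (fun y => φ.toFun y (u y)) x (φ.toFun x v) =
      φ.toFun x (φ.dirDeriv u x v + φ.conn cov x v (u x)) := by
  let e := Module.finBasis ℝ E
  let c : Fin (Module.finrank ℝ E) → E →L[ℝ] ℝ := fun i =>
    LinearMap.toContinuousLinearMap (e.coord i)
  have hc : ∀ z : E, ∑ i, c i z • e i = z := fun z => e.sum_repr z
  have hd : ∀ i, HasMFDerivAt 𝓘(ℝ, E) 𝓘(ℝ, ℝ) (fun y => c i (u y)) x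
      ((c i).comp (mfderiv 𝓘(ℝ, E) 𝓘(ℝ, E) u x)) := fun i =>
    (c i).hasMFDerivAt.comp x hu.hasMFDerivAt
  -- Additivity of `cov` requires differentiable summands, so differentiability of the partial sums
  -- is carried along the induction.
  have key : ∀ s : Finset (Fin (Module.finrank ℝ E)),
      MDifferentiableAt 𝓘(ℝ, E) 𝓘(ℝ, E).tangent (fun y =>
        (⟨y, (∑ i ∈ s, (fun y => c i (u y)) • fun y => φ.toFun y (e i) :
          Π y, TangentSpace 𝓘(ℝ, E) y) y⟩ : TangentBundle 𝓘(ℝ, E) M)) x ∧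
      cov (∑ i ∈ s, (fun y => c i (u y)) • fun y => φ.toFun y (e i) :
        Π y, TangentSpace 𝓘(ℝ, E) y) x (φ.toFun x v) =
      ∑ i ∈ s, φ.toFun x (c i (φ.dirDeriv u x v) • e i +
        c i (u x) • φ.conn cov x v (e i)) := by
    intro s
    induction s using Finset.induction_on with
    | empty =>
      simp only [Finset.sum_empty]
      refine ⟨mdifferentiableAt_zeroSection .., ?_⟩
      rw [cov.isCovariantDerivativeOn.zero]; rfl
    | insert i s hi ih =>
      simp only [Finset.sum_insert hi]
      have h1 : MDifferentiableAt 𝓘(ℝ, E) 𝓘(ℝ, E).tangent (fun y =>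
        (⟨y, ((fun y => c i (u y)) • fun y => φ.toFun y (e i) :
          Π y, TangentSpace 𝓘(ℝ, E) y) y⟩ : TangentBundle 𝓘(ℝ, E) M)) x :=
        (hd i).mdifferentiableAt.smul_section (φ.mdifferentiableAt (e i) x)
      refine ⟨mdifferentiableAt_add_section h1 ih.1, ?_⟩
      rw [cov.isCovariantDerivativeOn.add h1 ih.1, _root_.add_apply, ih.2]
      congr 1
      rw [cov.isCovariantDerivativeOn.leibniz (φ.mdifferentiableAt (e i) x)
        (hd i).mdifferentiableAt]
      simp only [_root_.add_apply, _root_.smul_apply, map_add, map_smul, toFun_conn,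
        ContinuousLinearMap.smulRight_apply]
      rw [add_comm]
      congr 2
      rw [mvfderiv, (hd i).mfderiv]
      rfl
  have h := (key Finset.univ).2
  rw [← map_sum, Finset.sum_add_distrib, hc] at h
  have h3 : ∑ i, c i (u x) • φ.conn cov x v (e i) = φ.conn cov x v (u x) := by
    conv_rhs => rw [← hc (u x)]
    simp only [map_sum, map_smul]
  rw [h3] at h
  rw [← h]
  congr 2
  ext1 y
  conv_lhs => rw [← hc (u y)]
  simp only [map_sum, map_smul, Finset.sum_apply]
  rfl

end LieFrame
end Obata
end HKTSolv

namespace HKTSolv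

/-! ### Metrics with constant coefficients -/

section InvariantMetric

variable {E : Type*} [NormedAddCommGroup E] [NormedSpace ℝ E] [FiniteDimensional ℝ E]
  {M : Type*} [TopologicalSpace M] [ChartedSpace E M] [IsManifold 𝓘(ℝ, E) ∞ M]

lemma isVonNBounded_of_pos (B : E →L[ℝ] E →L[ℝ] ℝ) (hpos : ∀ v, v ≠ 0 → 0 < B v v) :
    Bornology.IsVonNBounded ℝ {v : E | B v v < 1} := by
  have hc : Continuous fun v => B v v := by fun_prop
  obtain ⟨m, hm, hmle⟩ : ∃ m > 0, ∀ v ∈ Metric.sphere (0 : E) 1, m ≤ B v v := by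
    rcases (Metric.sphere (0 : E) 1).eq_empty_or_nonempty with h | h
    · exact ⟨1, one_pos, by simp [h]⟩
    · obtain ⟨v, hv, hmin⟩ := (isCompact_sphere (0 : E) 1).exists_isMinOn h hc.continuousOn
      refine ⟨B v v, hpos v ?_, fun w hw => hmin hw⟩
      rintro rfl
      simp at hv
  rw [NormedSpace.isVonNBounded_iff, Metric.isBounded_iff_subset_closedBall 0]
  -- With `m` the minimum of the form on the unit sphere, `‖v‖ > 1 + 1/m` would give both `‖v‖ > 1`
  -- and `m ‖v‖ > 1`, hence `B v v ≥ m ‖v‖² > 1`.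
  refine ⟨1 + m⁻¹, fun v hv => ?_⟩
  rw [mem_closedBall_zero_iff]
  by_contra! hlt
  have hm' : 0 < m⁻¹ := inv_pos.mpr hm
  have hv0 : v ≠ 0 := by
    rintro rfl
    simp at hlt; linarith
  have hn : 0 < ‖v‖ := norm_pos_iff.mpr hv0
  have h1 := hmle (‖v‖⁻¹ • v) (by simp [norm_smul, hn.ne'])
  simp only [map_smul, _root_.smul_apply, smul_eq_mul] at h1
  have h2 : m * (‖v‖ * ‖v‖) ≤ B v v := by
    calc m * (‖v‖ * ‖v‖) ≤ (‖v‖⁻¹ * (‖v‖⁻¹ * B v v)) * (‖v‖ * ‖v‖) := by gcongr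
      _ = B v v := by field_simp
  have h3 : m * (‖v‖ * ‖v‖) < 1 := h2.trans_lt hv
  have h4 : 1 < ‖v‖ := by linarith
  have h5 : 1 < m * ‖v‖ := by
    calc 1 = m * m⁻¹ := (mul_inv_cancel₀ hm.ne').symm
      _ < m * ‖v‖ := by gcongr; linarith
  nlinarith

namespace LieFrame

variable (φ : LieFrame E M)

lemma contMDiffAt_coord_inverse (x : M) {p : M} (hp : p ∈ (chartAt E x).source) :
    ContMDiffAt 𝓘(ℝ, E) 𝓘(ℝ, E →L[ℝ] E) ∞ (fun p => (φ.coord x p).inverse) p := by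
  have h1 : ((φ.coordEquiv hp : E ≃L[ℝ] E) : E →L[ℝ] E) = φ.coord x p := by
    ext v; exact φ.coordEquiv_apply hp v
  have h2 := contDiffAt_map_inverse (n := ∞) (φ.coordEquiv hp)
  rw [h1] at h2
  exact h2.contMDiffAt.comp p (φ.contMDiffAt_coord x hp)

lemma toFun_symm_trivializationAt_symm {x p : M} (hp : p ∈ (chartAt E x).source) (v : E) :
    (φ.toFun p).symm ((trivializationAt E (TangentSpace 𝓘(ℝ, E) : M → Type _) x).symm p v) =
      (φ.coord x p).inverse v := by
  have h1 : φ.coord x p = ((φ.coordEquiv hp : E ≃L[ℝ] E) : E →L[ℝ] E) := by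
    ext v; exact (φ.coordEquiv_apply hp v).symm
  rw [h1, ContinuousLinearMap.inverse_equiv]
  rfl

/-- The field of bilinear forms with constant coefficients `B` in the frame. -/
noncomputable def bilin (B : E →L[ℝ] E →L[ℝ] ℝ) (x : M) :
    TangentSpace 𝓘(ℝ, E) x →L[ℝ] TangentSpace 𝓘(ℝ, E) x →L[ℝ] ℝ :=
  (ContinuousLinearMap.precomp ℝ ((φ.toFun x).symm : TangentSpace 𝓘(ℝ, E) x →L[ℝ] E)).comp
    (B.comp ((φ.toFun x).symm : TangentSpace 𝓘(ℝ, E) x →L[ℝ] E))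

lemma bilin_apply (B : E →L[ℝ] E →L[ℝ] ℝ) (x : M) (v w : TangentSpace 𝓘(ℝ, E) x) :
    φ.bilin B x v w = B ((φ.toFun x).symm v) ((φ.toFun x).symm w) := rfl

lemma bilin_toFun (B : E →L[ℝ] E →L[ℝ] ℝ) (x : M) (v w : E) :
    φ.bilin B x (φ.toFun x v) (φ.toFun x w) = B v w := by
  simp [bilin_apply]

lemma contMDiff_bilin (B : E →L[ℝ] E →L[ℝ] ℝ) :
    ContMDiff 𝓘(ℝ, E) (𝓘(ℝ, E).prod 𝓘(ℝ, E →L[ℝ] E →L[ℝ] ℝ)) ∞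
      (fun x => TotalSpace.mk' (E →L[ℝ] E →L[ℝ] ℝ)
        (E := fun x : M => TangentSpace 𝓘(ℝ, E) x →L[ℝ] TangentSpace 𝓘(ℝ, E) x →L[ℝ] ℝ) x (φ.bilin B x)) := by
  intro x
  rw [contMDiffAt_hom_bundle]
  refine ⟨contMDiffAt_id, ?_⟩
  refine contMDiffAt_clm_of_apply fun v => contMDiffAt_clm_of_apply fun w => ?_
  have hC := φ.contMDiffAt_coord_inverse x (mem_chart_source E x)
  have h1 : ContMDiffAt 𝓘(ℝ, E) 𝓘(ℝ, ℝ) ∞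
      (fun p => B ((φ.coord x p).inverse v) ((φ.coord x p).inverse w)) x := by
    have h2 := hC.clm_apply (contMDiffAt_const (c := v))
    have h3 := hC.clm_apply (contMDiffAt_const (c := w))
    exact ((B.contMDiff.contMDiffAt.comp x h2)).clm_apply h3
  refine h1.congr_of_eventuallyEq ?_
  filter_upwards [(chartAt E x).open_source.mem_nhds (mem_chart_source E x)] with p hp
  rw [inCoordinates_apply_eq₂ (by simpa using hp) (by simpa using hp) (by simp)]
  rw [← φ.toFun_symm_trivializationAt_symm hp, ← φ.toFun_symm_trivializationAt_symm hp]
  simp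
  rfl

/-- The invariant metric with constant coefficients `B` in the frame. -/
noncomputable def metric {H : HypercomplexStructure E M} {I₀ J₀ K₀ : E →L[ℝ] E}
    (hφ : φ.IsAdapted H I₀ J₀ K₀) (B : E →L[ℝ] E →L[ℝ] ℝ) (hs : ∀ v w, B v w = B w v)
    (hpos : ∀ v, v ≠ 0 → 0 < B v v) (hI : ∀ v w, B (I₀ v) (I₀ w) = B v w)
    (hJ : ∀ v w, B (J₀ v) (J₀ w) = B v w) (hK : ∀ v w, B (K₀ v) (K₀ w) = B v w) :
    HyperhermitianMetric H where
  inner x := φ.bilin B x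
  symm x v w := hs _ _
  pos x v hv := hpos _ fun h => hv <| (φ.toFun x).symm.injective (h.trans (map_zero (φ.toFun x).symm).symm)
  isVonNBounded x := by
    have h := (isVonNBounded_of_pos B hpos).image (φ.toFun x : E →L[ℝ] TangentSpace 𝓘(ℝ, E) x)
    refine h.subset ?_
    intro v hv
    exact ⟨(φ.toFun x).symm v, hv, by simp⟩
  contMDiff := φ.contMDiff_bilin B
  hermitian_I x v w := by
    obtain ⟨v, rfl⟩ := (φ.toFun x).surjective v
    obtain ⟨w, rfl⟩ := (φ.toFun x).surjective w
    rw [hφ.I, hφ.I, bilin_toFun, bilin_toFun, hI]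
  hermitian_J x v w := by
    obtain ⟨v, rfl⟩ := (φ.toFun x).surjective v
    obtain ⟨w, rfl⟩ := (φ.toFun x).surjective w
    rw [hφ.J, hφ.J, bilin_toFun, bilin_toFun, hJ]
  hermitian_K x v w := by
    obtain ⟨v, rfl⟩ := (φ.toFun x).surjective v
    obtain ⟨w, rfl⟩ := (φ.toFun x).surjective w
    rw [hφ.K, hφ.K, bilin_toFun, bilin_toFun, hK]

lemma contMDiff_inner {H : HypercomplexStructure E M} (g : HyperhermitianMetric H) (v w : E) :
    ContMDiff 𝓘(ℝ, E) 𝓘(ℝ, ℝ) ∞ (fun x => g.inner x (φ.toFun x v) (φ.toFun x w)) := by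
  intro x
  have h := ContMDiffAt.clm_bundle_apply₂ (F₃ := ℝ) (E₃ := Bundle.Trivial M ℝ)
    (g.contMDiff x) (φ.smooth v x) (φ.smooth w x)
  exact ((contMDiffAt_totalSpace (F := ℝ) (E := Bundle.Trivial M ℝ)).mp h).2

end LieFrame
end InvariantMetric
end HKTSolv

namespace HKTSolv

/-! ### The (3,0)-component of a 3-form -/

section TypePart

variable {T T' : Type*} [AddCommGroup T] [Module ℝ T] [TopologicalSpace T]
  [AddCommGroup T'] [Module ℝ T'] [TopologicalSpace T']

lemma typePart_comp {A : T →L[ℝ] T} {A' : T' →L[ℝ] T'} (L : T' →L[ℝ] T)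
    (h : ∀ v, A (L v) = L (A' v)) (p : ℕ) {k : ℕ} (α : T [⋀^Fin k]→L[ℝ] ℂ) (v : Fin k → T') :
    typePart A p α (fun i => L (v i)) =
      typePart A' p (α.compContinuousLinearMap L) v := by
  unfold typePart complexExt
  refine Finset.sum_congr rfl fun P _ => Finset.sum_congr rfl fun S _ => ?_
  congr 1
  change α _ = α _
  congr 1
  funext j
  simp only [Finset.piecewise, h, ← map_smul, ← map_neg]
  split_ifs <;> rfl

/-- In top type only the full index set contributes, and the formula is the expansion of `α` on the
three vectors `(v - i A v) / 2`, one term for each set of slots containing `A`. -/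
lemma typePart_three (A : T →L[ℝ] T) (α : T [⋀^Fin 3]→L[ℝ] ℂ) (x y z : T) :
    typePart A 3 α ![x, y, z] = (1 / 8 : ℂ) * (α ![x, y, z] -
      Complex.I * (α ![A x, y, z] + α ![x, A y, z] + α ![x, y, A z]) -
      (α ![A x, A y, z] + α ![A x, y, A z] + α ![x, A y, A z]) +
      Complex.I * α ![A x, A y, A z]) := by
  have huniv : (Finset.univ : Finset (Finset (Fin 3))) =
    {∅, {0}, {1}, {2}, {0, 1}, {0, 2}, {1, 2}, {0, 1, 2}} := by decide
  have hP : Finset.powersetCard 3 (Finset.univ : Finset (Fin 3)) = {Finset.univ} := by decide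
  have hsm : ∀ (c₀ c₁ c₂ : ℝ) (u₀ u₁ u₂ : T), α ![c₀ • u₀, c₁ • u₁, c₂ • u₂] =
      ((c₀ * c₁ * c₂ : ℝ) : ℂ) * α ![u₀, u₁, u₂] := by
    intro c₀ c₁ c₂ u₀ u₁ u₂
    have h := α.toMultilinearMap.map_smul_univ ![c₀, c₁, c₂] ![u₀, u₁, u₂]
    have h1 : (fun i => (![c₀, c₁, c₂] : Fin 3 → ℝ) i • (![u₀, u₁, u₂] : Fin 3 → T) i) =
        ![c₀ • u₀, c₁ • u₁, c₂ • u₂] := by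
      funext i; fin_cases i <;> rfl
    rw [h1] at h
    refine h.trans ?_
    rw [Fin.prod_univ_three]
    exact Complex.real_smul
  have hpw : ∀ S : Finset (Fin 3), S.piecewise
      (fun j => if j ∈ (Finset.univ : Finset (Fin 3)) then
        -((1 / 2 : ℝ) • A ((![x, y, z] : Fin 3 → T) j)) else (1 / 2 : ℝ) • A ((![x, y, z] : Fin 3 → T) j))
      (fun j => (1 / 2 : ℝ) • (![x, y, z] : Fin 3 → T) j) =
      ![(if 0 ∈ S then -(1 / 2 : ℝ) else 1 / 2) • (if 0 ∈ S then A x else x),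
        (if 1 ∈ S then -(1 / 2 : ℝ) else 1 / 2) • (if 1 ∈ S then A y else y),
        (if 2 ∈ S then -(1 / 2 : ℝ) else 1 / 2) • (if 2 ∈ S then A z else z)] := by
    intro S
    funext i
    fin_cases i <;> simp [Finset.piecewise] <;> split_ifs <;> simp
  unfold typePart complexExt
  rw [hP, Finset.sum_singleton, huniv]
  simp only [hpw, hsm]
  rw [Finset.sum_insert (by decide), Finset.sum_insert (by decide), Finset.sum_insert (by decide),
    Finset.sum_insert (by decide), Finset.sum_insert (by decide), Finset.sum_insert (by decide),
    Finset.sum_insert (by decide), Finset.sum_singleton]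
  have hc : (({0, 1} : Finset (Fin 3)).card = 2) ∧ (({0, 2} : Finset (Fin 3)).card = 2) ∧
    (({1, 2} : Finset (Fin 3)).card = 2) ∧ (({0, 1, 2} : Finset (Fin 3)).card = 3) := by decide
  simp [hc]
  ring_nf

/-- The real part of the `(3,0)`-component of `dΩ`, for an invariant hyperhermitian metric. -/
lemma metricVariation_of_typePart {B : T →ₗ[ℝ] T →ₗ[ℝ] ℝ} {I J K : T →L[ℝ] T}
    (hI : ∀ x, I (I x) = -x) (hIJ : ∀ x, I (J x) = K x)
    (hJI : ∀ x, J (I x) = -K x)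
    (hBI : ∀ x y, B (I x) (I y) = B x y)
    {Γ : T →ₗ[ℝ] T →ₗ[ℝ] T} (hΓI : ∀ x y, Γ x (I y) = I (Γ x y))
    (α : T [⋀^Fin 3]→L[ℝ] ℂ)
    (hα : ∀ x y z, α ![x, y, z] = -(1 / 2 : ℂ) * (
      ((metricVariation B Γ x (J y) z + metricVariation B Γ y (J z) x +
        metricVariation B Γ z (J x) y : ℝ) : ℂ) + Complex.I *
      ((metricVariation B Γ x (K y) z + metricVariation B Γ y (K z) x +
        metricVariation B Γ z (K x) y : ℝ) : ℂ)))
    (h : ∀ v, typePart I 3 α v = 0) (x y z : T) :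
    metricVariation B Γ x (J y) z + metricVariation B Γ (I x) (K y) z +
      metricVariation B Γ y (J z) x + metricVariation B Γ (I y) (K z) x +
      metricVariation B Γ z (J x) y + metricVariation B Γ (I z) (K x) y = 0 := by
  have hKI : ∀ x, K (I x) = J x := fun x => by
    rw [← hIJ, hJI, map_neg, ← hIJ, hI, neg_neg]
  have hIK : ∀ x, I (K x) = -J x := fun x => by rw [← hIJ, hI]
  have hsk : ∀ x y z, metricVariation B Γ x y (I z) = -metricVariation B Γ x (I y) z := by
    have hs : ∀ y z, B y (I z) = -B (I y) z := by
      intro y z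
      rw [← hBI y (I z), hI]; simp
    intro x y z
    simp only [metricVariation, hΓI, hs]; ring
  have hneg : ∀ x y z, metricVariation B Γ x (-y) z = -metricVariation B Γ x y z := by
    intro x y z
    simp [metricVariation]; ring
  have h0 := h ![x, y, z]
  rw [typePart_three] at h0
  -- The quaternion relations and the skewness for `I` express all eight values of `α` through
  -- variations whose middle argument carries `J` or `K`; the real part of the vanishing sum is the
  -- claim.
  simp only [hα, hsk, hKI, hJI, hIK, hIJ, map_neg, hneg, neg_neg] at h0
  have h1 := congrArg Complex.re h0
  simp at h1
  linarith

end TypePart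

/-! ### Averaging preserves the HKT condition -/

section Averaging

open MeasureTheory

variable {E : Type*} [NormedAddCommGroup E] [NormedSpace ℝ E] [FiniteDimensional ℝ E]
  {M : Type*} [TopologicalSpace M] [ChartedSpace E M] [IsManifold 𝓘(ℝ, E) ∞ M]

namespace LieFrame

variable (φ : LieFrame E M)

lemma contMDiff_dirDeriv {f : M → ℂ} (hf : ContMDiff 𝓘(ℝ, E) 𝓘(ℝ, ℂ) ∞ f) (v : E) :
    ContMDiff 𝓘(ℝ, E) 𝓘(ℝ, ℂ) ∞ (fun x => φ.dirDeriv f x v) := by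
  have h := (hf.contMDiff_tangentMap (m := ∞) le_rfl).comp (φ.smooth v)
  exact (contMDiff_snd_tangentBundle_modelSpace ℂ 𝓘(ℝ, ℂ)).comp h

lemma dirDeriv_const (c : ℂ) (x : M) (v : E) : φ.dirDeriv (fun _ => c) x v = 0 := by
  rw [dirDeriv, mfderiv_const]
  rfl

variable {H : HypercomplexStructure E M} {I₀ J₀ K₀ : E →L[ℝ] E}

lemma Omega_toFun (hφ : φ.IsAdapted H I₀ J₀ K₀) (g : HyperhermitianMetric H) (x : M)
    (v : Fin 2 → E) : g.Omega x (fun i => φ.toFun x (v i)) = (1 / 2 : ℂ) *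
      ((g.inner x (φ.toFun x (J₀ (v 0))) (φ.toFun x (v 1)) : ℝ) + Complex.I *
        (g.inner x (φ.toFun x (K₀ (v 0))) (φ.toFun x (v 1)) : ℝ)) := by
  rw [← hφ.J, ← hφ.K]
  rfl

lemma contMDiff_Omega (hφ : φ.IsAdapted H I₀ J₀ K₀) (g : HyperhermitianMetric H)
    (v : Fin 2 → E) : ContMDiff 𝓘(ℝ, E) 𝓘(ℝ, ℂ) ∞
      (fun x => g.Omega x (fun i => φ.toFun x (v i))) := by
  simp only [φ.Omega_toFun hφ]
  have h : ∀ v w, ContMDiff 𝓘(ℝ, E) 𝓘(ℝ, ℂ) ∞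
      (fun x => ((g.inner x (φ.toFun x v) (φ.toFun x w) : ℝ) : ℂ)) := fun v w =>
    Complex.ofRealCLM.contDiff.contMDiff.comp (φ.contMDiff_inner g v w)
  let c : ℂ →L[ℝ] ℂ := (1 / 2 : ℂ) • ContinuousLinearMap.id ℝ ℂ
  let d : ℂ →L[ℝ] ℂ := Complex.I • ContinuousLinearMap.id ℝ ℂ
  exact c.contDiff.contMDiff.comp ((h _ _).add (d.contDiff.contMDiff.comp (h _ _)))

variable [MeasurableSpace M] [BorelSpace M] [CompactSpace M] {ν : Measure M} [IsFiniteMeasure ν]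

lemma integrable_of_contMDiff {F : Type*} [NormedAddCommGroup F] [NormedSpace ℝ F]
    [SecondCountableTopologyEither M F] {f : M → F}
    (hf : ContMDiff 𝓘(ℝ, E) 𝓘(ℝ, F) ∞ f) : Integrable f ν :=
  hf.continuous.integrable_of_hasCompactSupport (HasCompactSupport.of_compactSpace f)

lemma integral_Omega (hφ : φ.IsAdapted H I₀ J₀ K₀) (g g' : HyperhermitianMetric H)
    (hg : ∀ x v w, g'.inner x (φ.toFun x v) (φ.toFun x w) =
      ∫ y, g.inner y (φ.toFun y v) (φ.toFun y w) ∂ν) (x : M) (v : Fin 2 → E) :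
    ∫ y, g.Omega y (fun i => φ.toFun y (v i)) ∂ν = g'.Omega x (fun i => φ.toFun x (v i)) := by
  have hi : ∀ v w, Integrable (fun y => ((g.inner y (φ.toFun y v) (φ.toFun y w) : ℝ) : ℂ)) ν :=
    fun v w => (integrable_of_contMDiff (φ.contMDiff_inner g v w)).ofReal
  simp only [φ.Omega_toFun hφ, hg]
  rw [integral_const_mul, integral_add (hi _ _) ((hi _ _).const_mul _), integral_const_mul,
    integral_complex_ofReal, integral_complex_ofReal]

/-- In the frame formula for `dΩ` the derivative terms integrate to zero by `hν`. The others are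
linear in the components of `Ω` with constant coefficients, so they integrate to the corresponding
terms for `g'`, whose own derivative terms vanish. -/
lemma integral_mextDeriv_Omega (hφ : φ.IsAdapted H I₀ J₀ K₀)
    {Γ : E →ₗ[ℝ] E →ₗ[ℝ] E} (hΓ : ∀ v w, Γ v w - Γ w v = φ.bracket v w)
    (hν : ∀ f : M → ℂ, ContMDiff 𝓘(ℝ, E) 𝓘(ℝ, ℂ) ∞ f → ∀ v, ∫ y, φ.dirDeriv f y v ∂ν = 0)
    (g g' : HyperhermitianMetric H)
    (hg : ∀ x v w, g'.inner x (φ.toFun x v) (φ.toFun x w) =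
      ∫ y, g.inner y (φ.toFun y v) (φ.toFun y w) ∂ν) (x : M) (v : Fin 3 → E) :
    Integrable (fun y => mextDeriv g.Omega y (fun i => φ.toFun y (v i))) ν ∧
    ∫ y, mextDeriv g.Omega y (fun i => φ.toFun y (v i)) ∂ν =
      mextDeriv g'.Omega x (fun i => φ.toFun x (v i)) := by
  have hs := φ.contMDiff_Omega hφ g
  have hs' := φ.contMDiff_Omega hφ g'
  have hi := fun v => integrable_of_contMDiff (ν := ν) (hs v)
  have hconst : ∀ (y : M) (w : Fin 2 → E), g'.Omega y (fun i => φ.toFun y (w i)) =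
      g'.Omega x (fun i => φ.toFun x (w i)) := fun y w => by
    rw [← φ.integral_Omega hφ g g' hg x, ← φ.integral_Omega hφ g g' hg y]
  have hd : ∀ (w : Fin 2 → E) (u : E),
      φ.dirDeriv (fun y => g'.Omega y (fun i => φ.toFun y (w i))) x u = 0 := by
    intro w u
    simp only [hconst]
    exact φ.dirDeriv_const _ x u
  rw [φ.mextDeriv_apply g'.Omega x (fun v => (hs' v x).mdifferentiableAt (by simp)) Γ hΓ v]
  simp only [fun y => φ.mextDeriv_apply g.Omega y
    (fun v => (hs v y).mdifferentiableAt (by simp)) Γ hΓ v, hd, zsmul_eq_mul]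
  have hi' : ∀ i : Fin 3, Integrable (fun y =>
      φ.dirDeriv (fun y => g.Omega y fun j => φ.toFun y (i.removeNth v j)) y (v i) -
        ∑ j, g.Omega y (fun l => φ.toFun y (Function.update (i.removeNth v) j
          (Γ (v i) (i.removeNth v j)) l))) ν := fun i =>
    (integrable_of_contMDiff (φ.contMDiff_dirDeriv (hs _) _)).sub
      (integrable_finsetSum _ fun j _ => hi _)
  refine ⟨integrable_finsetSum _ fun i _ => (hi' i).const_mul _, ?_⟩
  rw [integral_finsetSum _ fun i _ => (hi' i).const_mul _]
  refine Finset.sum_congr rfl fun i _ => ?_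
  rw [integral_const_mul, integral_sub (integrable_of_contMDiff (φ.contMDiff_dirDeriv (hs _) _))
    (integrable_finsetSum _ fun j _ => hi _), hν _ (hs _), integral_finsetSum _ fun j _ => hi _]
  simp only [φ.integral_Omega hφ g g' hg x]

/-- Averaging an HKT metric in a unimodular frame yields an HKT metric. -/
lemma isHKT_of_average (hφ : φ.IsAdapted H I₀ J₀ K₀)
    {Γ : E →ₗ[ℝ] E →ₗ[ℝ] E} (hΓ : ∀ v w, Γ v w - Γ w v = φ.bracket v w)
    (hν : ∀ f : M → ℂ, ContMDiff 𝓘(ℝ, E) 𝓘(ℝ, ℂ) ∞ f → ∀ v, ∫ y, φ.dirDeriv f y v ∂ν = 0)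
    (g g' : HyperhermitianMetric H)
    (hg : ∀ x v w, g'.inner x (φ.toFun x v) (φ.toFun x w) =
      ∫ y, g.inner y (φ.toFun y v) (φ.toFun y w) ∂ν) (hHKT : g.IsHKT) : g'.IsHKT := by
  intro x v
  obtain ⟨v, rfl⟩ : ∃ w : Fin 3 → E, v = fun i => φ.toFun x (w i) :=
    ⟨fun i => (φ.toFun x).symm (v i), by simp⟩
  have hy : ∀ y, typePart I₀ 3 ((mextDeriv g.Omega y).compContinuousLinearMap
      (φ.toFun y : E →L[ℝ] TangentSpace 𝓘(ℝ, E) y)) v = 0 := by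
    intro y
    rw [← typePart_comp (A := H.I y) (φ.toFun y : E →L[ℝ] TangentSpace 𝓘(ℝ, E) y)
      (fun w => hφ.I y w)]
    exact hHKT y _
  have hx : typePart (H.I x) 3 (mextDeriv g'.Omega x) (fun i => φ.toFun x (v i)) = _ :=
    typePart_comp (A := H.I x) (φ.toFun x : E →L[ℝ] TangentSpace 𝓘(ℝ, E) x)
      (fun w => hφ.I x w) 3 _ v
  rw [hx]
  have hint := φ.integral_mextDeriv_Omega hφ hΓ hν g g' hg x
  have h0 : ∫ y, typePart I₀ 3 ((mextDeriv g.Omega y).compContinuousLinearMap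
      (φ.toFun y : E →L[ℝ] TangentSpace 𝓘(ℝ, E) y)) v ∂ν = 0 := by
    simp only [hy, integral_zero]
  rw [← h0]
  -- Since `I₀` is constant, taking the type component is a fixed finite linear combination of
  -- evaluations, and so commutes with the integral.
  unfold typePart complexExt
  have hi : ∀ w : Fin 3 → E, Integrable (fun y => (mextDeriv g.Omega y).compContinuousLinearMap
      (φ.toFun y : E →L[ℝ] TangentSpace 𝓘(ℝ, E) y) w) ν := fun w => (hint w).1
  rw [integral_finsetSum _ fun P _ => integrable_finsetSum _ fun S _ => (hi _).const_mul _]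
  refine Finset.sum_congr rfl fun P _ => ?_
  rw [integral_finsetSum _ fun S _ => (hi _).const_mul _]
  refine Finset.sum_congr rfl fun S _ => ?_
  rw [integral_const_mul]
  congr 1
  exact (hint _).2.symm

end LieFrame
end Averaging
end HKTSolv

namespace HKTSolv

/-! ### Invariant HKT metrics are balanced -/

section Balanced

lemma exists_orthonormal_basis {T : Type*} [AddCommGroup T] [Module ℝ T] [FiniteDimensional ℝ T]
    (B : T →ₗ[ℝ] T →ₗ[ℝ] ℝ) (hs : ∀ v w, B v w = B w v) (hpos : ∀ v, v ≠ 0 → 0 < B v v) :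
    ∃ e : Module.Basis (Fin (Module.finrank ℝ T)) ℝ T,
      ∀ a b, B (e a) (e b) = if a = b then 1 else 0 := by
  let core : InnerProductSpace.Core ℝ T :=
    { inner := fun v w => B v w
      conj_inner_symm := fun v w => hs w v
      re_inner_nonneg := fun v => by
        rcases eq_or_ne v 0 with rfl | h
        · simp
        · exact (hpos v h).le
      add_left := fun v w u => by simp
      smul_left := fun v w c => by simp
      definite := fun v h => by
        by_contra hv
        exact (hpos v hv).ne' h }
  let _ : NormedAddCommGroup T := core.toNormedAddCommGroup
  let _ : InnerProductSpace ℝ T := InnerProductSpace.ofCore core.toCore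
  refine ⟨(stdOrthonormalBasis ℝ T).toBasis, fun a b => ?_⟩
  have h := orthonormal_iff_ite.mp (stdOrthonormalBasis ℝ T).orthonormal a b
  simp only [OrthonormalBasis.coe_toBasis]
  exact h

lemma wedgePow_compContinuousLinearMap {T T' : Type*} [AddCommGroup T] [Module ℝ T]
    [TopologicalSpace T] [AddCommGroup T'] [Module ℝ T'] [TopologicalSpace T']
    (β : T [⋀^Fin 2]→L[ℝ] ℝ) (L : T' →L[ℝ] T) (k : ℕ) (v : Fin (k * 2) → T') :
    wedgePow β k (fun i => L (v i)) = wedgePow (β.compContinuousLinearMap L) k v := by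
  simp only [wedgePow, ContinuousAlternatingMap.smul_apply,
    ContinuousMultilinearMap.alternatization_apply_apply]
  rfl

variable {E : Type*} [NormedAddCommGroup E] [NormedSpace ℝ E] [FiniteDimensional ℝ E]
  {M : Type*} [TopologicalSpace M] [ChartedSpace E M] [IsManifold 𝓘(ℝ, E) ∞ M]
  {H : HypercomplexStructure E M} {I₀ J₀ K₀ : E →L[ℝ] E} {φ : LieFrame E M}

lemma dirDeriv_const_real (c : ℝ) (x : M) (v : E) : φ.dirDeriv (fun _ => c) x v = 0 := by
  rw [LieFrame.dirDeriv, mfderiv_const]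
  rfl

/-- An invariant HKT metric is balanced if the Obata connection has trace zero. -/
theorem isBalanced_of_isHKT [Nonempty M] (hφ : φ.IsAdapted H I₀ J₀ K₀)
    {Γ : E →ₗ[ℝ] E →ₗ[ℝ] E} (hΓ : ∀ v w, Γ v w - Γ w v = φ.bracket v w)
    (hΓI : ∀ x y, Γ x (I₀ y) = I₀ (Γ x y)) (hΓJ : ∀ x y, Γ x (J₀ y) = J₀ (Γ x y))
    (hΓK : ∀ x y, Γ x (K₀ y) = K₀ (Γ x y))
    (htr : ∀ v, LinearMap.trace ℝ E (Γ v) = 0) {n : ℕ} (hn : Module.finrank ℝ E = 4 * n)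
    (B : E →ₗ[ℝ] E →ₗ[ℝ] ℝ) (g : HyperhermitianMetric H)
    (hg : ∀ x v w, g.inner x (φ.toFun x v) (φ.toFun x w) = B v w) (hHKT : g.IsHKT) :
    g.IsBalanced n := by
  obtain ⟨x₀⟩ := ‹Nonempty M›
  have : Nonempty M := ⟨x₀⟩
  have hs : ∀ v w, B v w = B w v := fun v w => by rw [← hg x₀, ← hg x₀, g.symm]
  have hpos : ∀ v, v ≠ 0 → 0 < B v v := fun v hv => by
    rw [← hg x₀]
    exact g.pos x₀ _ fun h => hv ((φ.toFun x₀).injective (h.trans (map_zero (φ.toFun x₀)).symm))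
  have hBI : ∀ v w, B (I₀ v) (I₀ w) = B v w := fun v w => by
    rw [← hg x₀, ← hg x₀, ← hφ.I, ← hφ.I, g.hermitian_I]
  have hBJ : ∀ v w, B (J₀ v) (J₀ w) = B v w := fun v w => by
    rw [← hg x₀, ← hg x₀, ← hφ.J, ← hφ.J, g.hermitian_J]
  have hBK : ∀ v w, B (K₀ v) (K₀ w) = B v w := fun v w => by
    rw [← hg x₀, ← hg x₀, ← hφ.K, ← hφ.K, g.hermitian_K]
  obtain ⟨e, he⟩ := exists_orthonormal_basis B hs hpos
  have hOm : ∀ (x : M) (v : Fin 2 → E), g.Omega x (fun i => φ.toFun x (v i)) =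
      (1 / 2 : ℂ) * ((B (J₀ (v 0)) (v 1) : ℝ) + Complex.I * (B (K₀ (v 0)) (v 1) : ℝ)) := by
    intro x v
    rw [φ.Omega_toFun hφ, hg, hg]
  have hσ : ∀ z, ∑ a, metricVariation B Γ (e a) (e a) z = 0 := by
    refine sum_metricVariation_eq_zero he hs (I := I₀.toLinearMap) (J := J₀.toLinearMap)
      (K := K₀.toLinearMap) hφ.I_sq hφ.J_sq hφ.K_sq hφ.I_J hBI hBJ hBK hΓI hΓJ hΓK htr ?_
    refine metricVariation_of_typePart hφ.I_sq hφ.I_J hφ.J_I hBI hΓI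
      ((mextDeriv g.Omega x₀).compContinuousLinearMap
        (φ.toFun x₀ : E →L[ℝ] TangentSpace 𝓘(ℝ, E) x₀)) ?_ ?_
    · intro x y z
      have h := φ.mextDeriv_apply g.Omega x₀ (fun v =>
        (φ.contMDiff_Omega hφ g v x₀).mdifferentiableAt (by simp)) Γ hΓ ![x, y, z]
      refine Eq.trans h ((Fin.sum_univ_three _).trans ?_)
      -- The components of `Ω` are constant, so only the connection terms remain; they combine into
      -- metric variations.
      simp only [hOm, φ.dirDeriv_const, Fin.sum_univ_two]
      have h1 : ∀ v : Fin 3 → E, ((0 : Fin 3).removeNth v : Fin 2 → E) = ![v 1, v 2] := by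
        intro v; funext i; fin_cases i <;> rfl
      have h2 : ∀ v : Fin 3 → E, ((1 : Fin 3).removeNth v : Fin 2 → E) = ![v 0, v 2] := by
        intro v; funext i; fin_cases i <;> rfl
      have h3 : ∀ v : Fin 3 → E, ((2 : Fin 3).removeNth v : Fin 2 → E) = ![v 0, v 1] := by
        intro v; funext i; fin_cases i <;> rfl
      have hskJ : ∀ v w, B (J₀ v) w = - B (J₀ w) v := fun v w => by
        rw [← hBJ, hφ.J_sq, hs]; simp
      have hskK : ∀ v w, B (K₀ v) w = - B (K₀ w) v := fun v w => by
        rw [← hBK, hφ.K_sq, hs]; simp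
      simp [h1, h2, h3, metricVariation, hΓJ, hΓK]
      rw [hskJ (Γ y x) z, hskJ x (Γ y z), hskK (Γ y x) z, hskK x (Γ y z)]
      push_cast
      ring
    · intro v
      rw [← typePart_comp (A := H.I x₀) (φ.toFun x₀ : E →L[ℝ] TangentSpace 𝓘(ℝ, E) x₀)
        (fun w => hφ.I x₀ w)]
      exact hHKT x₀ _
  intro x
  -- For `n = 0` the exponent `2 * n - 1` truncates to `0` and `4 * n = (2 * n - 1) * 2 + 2` fails,
  -- but then the claim concerns a 1-form on a zero space.
  rcases Nat.eq_zero_or_pos n with rfl | hnpos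
  · have hE : Subsingleton E := Module.finrank_zero_iff.mp (by simpa using hn)
    ext v
    have hv : v 0 = 0 := (φ.toFun x).symm.injective (Subsingleton.elim _ _)
    exact ContinuousAlternatingMap.map_coord_zero _ 0 hv
  let θ : E [⋀^Fin 2]→L[ℝ] ℝ := (g.omegaI x).compContinuousLinearMap
    (φ.toFun x : E →L[ℝ] TangentSpace 𝓘(ℝ, E) x)
  have hθx : ∀ y, (g.omegaI y).compContinuousLinearMap
      (φ.toFun y : E →L[ℝ] TangentSpace 𝓘(ℝ, E) y) = θ := by
    have h : ∀ (y : M) (v : Fin 2 → E), (g.omegaI y).compContinuousLinearMap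
      (φ.toFun y : E →L[ℝ] TangentSpace 𝓘(ℝ, E) y) v = B (I₀ (v 0)) (v 1) := by
      intro y v
      rw [← hg y, ← hφ.I]
      rfl
    intro y
    ext v
    exact (h y v).trans (h x v).symm
  have hθ : ∀ v w, θ ![v, w] = B (I₀ v) w := by
    intro v w
    rw [← hg x, ← hφ.I]
    rfl
  have hw : ∀ y (v : Fin ((2 * n - 1) * 2) → E),
      wedgePow (g.omegaI y) (2 * n - 1) (fun i => φ.toFun y (v i)) = wedgePow θ (2 * n - 1) v := by
    intro y v
    rw [← hθx y]
    exact wedgePow_compContinuousLinearMap _ (φ.toFun y : E →L[ℝ] TangentSpace 𝓘(ℝ, E) y) _ v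
  ext v
  obtain ⟨v, rfl⟩ : ∃ w : Fin ((2 * n - 1) * 2 + 1) → E, v = fun i => φ.toFun x (w i) :=
    ⟨fun i => (φ.toFun x).symm (v i), by simp⟩
  rw [φ.mextDeriv_apply _ x (fun v => by simpa only [hw] using mdifferentiableAt_const) Γ hΓ v]
  simp only [hw, dirDeriv_const_real]
  have h := sum_wedgePow_update_eq_zero he hs (I := I₀.toLinearMap) hφ.I_sq hBI hΓI htr hσ θ hθ
    (m := 2 * n - 1) (by omega) v
  refine Eq.trans ?_ (neg_eq_zero.mpr h)
  rw [← Finset.sum_neg_distrib]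
  refine Finset.sum_congr rfl fun i _ => ?_
  simp [zsmul_eq_mul]

end Balanced
end HKTSolv

namespace HKTSolv

/-! ### The frame of the quotient induced by left-invariant fields -/

section QuotientFrame

lemma minSmoothness_le_infty (n : ℕ) : minSmoothness ℝ n ≤ ∞ := by
  rw [minSmoothness_of_isRCLikeNormedField]
  exact_mod_cast le_top

variable {E : Type*} [NormedAddCommGroup E] [NormedSpace ℝ E]
  {G : Type*} [Group G] [TopologicalSpace G] [ChartedSpace E G] [LieGroup 𝓘(ℝ, E) ∞ G]

/-- The field is the tangent map of the multiplication `G × G → G` applied to the smooth section `g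
↦ (0 at g, v at 1)`. -/
lemma contMDiff_mulInvariantVectorField_infty (v : GroupLieAlgebra 𝓘(ℝ, E) G) :
    ContMDiff 𝓘(ℝ, E) 𝓘(ℝ, E).tangent ∞
      (fun g : G => (⟨g, mulInvariantVectorField v g⟩ : TangentBundle 𝓘(ℝ, E) G)) := by
  let fg : G → TangentBundle 𝓘(ℝ, E) G := fun g => TotalSpace.mk' E g 0
  have sfg : ContMDiff 𝓘(ℝ, E) 𝓘(ℝ, E).tangent ∞ fg := contMDiff_zeroSection _ _
  let fv : G → TangentBundle 𝓘(ℝ, E) G := fun _ => TotalSpace.mk' E 1 v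
  have sfv : ContMDiff 𝓘(ℝ, E) 𝓘(ℝ, E).tangent ∞ fv := contMDiff_const
  have S₁ := sfg.prodMk sfv
  have S₂ : ContMDiff _ _ ∞ (equivTangentBundleProd 𝓘(ℝ, E) G 𝓘(ℝ, E) G).symm :=
    contMDiff_equivTangentBundleProd_symm
  have S₃ : ContMDiff (𝓘(ℝ, E).prod 𝓘(ℝ, E)).tangent 𝓘(ℝ, E).tangent ∞
      (tangentMap (𝓘(ℝ, E).prod 𝓘(ℝ, E)) 𝓘(ℝ, E) (fun p : G × G => p.1 * p.2)) :=
    ContMDiff.contMDiff_tangentMap (contMDiff_mul 𝓘(ℝ, E) ∞) (m := ∞) le_rfl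
  convert! (S₃.comp S₂).comp S₁ with g
  · simp [fg, fv]
  · simp only [Function.comp_apply, tangentMap, fg, fv]
    rw [mfderiv_prod_eq_add_apply ((contMDiff_mul 𝓘(ℝ, E) ∞).mdifferentiableAt (by simp))]
    change (mfderiv 𝓘(ℝ, E) 𝓘(ℝ, E) (g * ·) (1 : G) : E →L[ℝ] E) v =
      (mfderiv 𝓘(ℝ, E) 𝓘(ℝ, E) (fun z : G => z * 1) g : E →L[ℝ] E) 0 +
        (mfderiv 𝓘(ℝ, E) 𝓘(ℝ, E) (fun z : G => g * z) (1 : G) : E →L[ℝ] E) v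
    rw [map_zero, zero_add]

lemma mulInvariantVectorField_mul (v : E) (k g : G) :
    (mulInvariantVectorField (I := 𝓘(ℝ, E)) (G := G) v (k * g) : E) =
      mfderiv 𝓘(ℝ, E) 𝓘(ℝ, E) (k * ·) g (mulInvariantVectorField (I := 𝓘(ℝ, E)) v g) := by
  have h : ∀ a : G, MDifferentiable 𝓘(ℝ, E) 𝓘(ℝ, E) (a * · : G → G) := fun a =>
    (contMDiff_mul_left (I := 𝓘(ℝ, E)) (n := ∞) (a := a)).mdifferentiable (by simp)
  have h1 := mfderiv_comp (1 : G) (h k (g * 1)) (h g 1)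
  have h2 : (fun x => k * x) ∘ (fun x => g * x) = fun x => (k * g) * x := by
    ext x; simp [mul_assoc]
  rw [h2] at h1
  have h3 : ∀ a : G, a = g → (mfderiv 𝓘(ℝ, E) 𝓘(ℝ, E) (k * ·) a : E →L[ℝ] E) =
      mfderiv 𝓘(ℝ, E) 𝓘(ℝ, E) (k * ·) g := by rintro _ rfl; rfl
  have h4 := congrArg (fun L : E →L[ℝ] E => L v) h1
  refine h4.trans ?_
  exact congrArg (fun L : E →L[ℝ] E => L (mulInvariantVectorField (I := 𝓘(ℝ, E)) v g))
    (h3 (g * 1) (mul_one g))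

lemma isInvertible_mfderiv_mul_left (g h : G) :
    (mfderiv 𝓘(ℝ, E) 𝓘(ℝ, E) (g * ·) h : E →L[ℝ] E).IsInvertible := by
  have hl : IsLocalDiffeomorph 𝓘(ℝ, E) 𝓘(ℝ, E) ∞ (g * · : G → G) :=
    Diffeomorph.isLocalDiffeomorph (Φ :=
      { toEquiv := Equiv.mulLeft g
        contMDiff_toFun := contMDiff_mul_left
        contMDiff_invFun := contMDiff_mul_left })
  exact ⟨hl.mfderivToContinuousLinearEquiv (by simp) h, rfl⟩

/-- Left translation identifies the Lie algebra with the tangent space at `g`. -/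
noncomputable def leftTranslationEquiv (g : G) : E ≃L[ℝ] TangentSpace 𝓘(ℝ, E) g :=
  (isInvertible_mfderiv_mul_left (E := E) g 1).choose

lemma leftTranslationEquiv_apply (g : G) (v : E) :
    leftTranslationEquiv g v = mulInvariantVectorField (I := 𝓘(ℝ, E)) (G := G) v g :=
  congrArg (fun L : E →L[ℝ] E => L v) (isInvertible_mfderiv_mul_left (E := E) g 1).choose_spec

variable {M : Type*} [TopologicalSpace M] [ChartedSpace E M]
  {Γ : Subgroup G} {q : G → M}

namespace IsQuotientMap

/-- Left-invariant fields descend: `h = γ g`, `q ∘ (γ * ·) = q`, and left translation by `γ`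
preserves the field. -/
lemma mfderiv_eq_of_eq (hq : IsQuotientMap (E := E) Γ q) {g h : G} (hgh : q g = q h) (v : E) :
    (mfderiv 𝓘(ℝ, E) 𝓘(ℝ, E) q g (mulInvariantVectorField (I := 𝓘(ℝ, E)) v g) : E) =
      mfderiv 𝓘(ℝ, E) 𝓘(ℝ, E) q h (mulInvariantVectorField (I := 𝓘(ℝ, E)) v h) := by
  obtain ⟨γ, hγ, rfl⟩ := (hq.fibre g h).mp hgh
  have h1 : q ∘ (γ * ·) = q := by
    ext x
    exact ((hq.fibre x (γ * x)).mpr ⟨γ, hγ, rfl⟩).symm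
  have h2 := mfderiv_comp g (hq.localDiffeo.mdifferentiable (by simp) (γ * g))
    ((contMDiff_mul_left (I := 𝓘(ℝ, E)) (n := ∞) (a := γ)).mdifferentiable (by simp) g)
  rw [h1] at h2
  refine (congrArg (fun L : E →L[ℝ] E =>
    L (mulInvariantVectorField (I := 𝓘(ℝ, E)) v g)) h2).trans ?_
  exact congrArg (mfderiv 𝓘(ℝ, E) 𝓘(ℝ, E) q (γ * g) : E →L[ℝ] E)
    (mulInvariantVectorField_mul v γ g).symm

/-- The frame of the quotient induced by left-invariant vector fields, at one point. -/
noncomputable def frameEquiv (hq : IsQuotientMap (E := E) Γ q) (x : M) :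
    E ≃L[ℝ] TangentSpace 𝓘(ℝ, E) x :=
  (leftTranslationEquiv (Function.surjInv hq.surjective x)).trans
    (hq.localDiffeo.mfderivToContinuousLinearEquiv (by simp) (Function.surjInv hq.surjective x))

lemma frameEquiv_apply (hq : IsQuotientMap (E := E) Γ q) (g : G) (v : E) :
    hq.frameEquiv (q g) v =
      mfderiv 𝓘(ℝ, E) 𝓘(ℝ, E) q g (mulInvariantVectorField (I := 𝓘(ℝ, E)) v g) := by
  have h := hq.mfderiv_eq_of_eq (Function.surjInv_eq hq.surjective (q g)) v
  rw [← leftTranslationEquiv_apply] at h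
  exact h

lemma contMDiff_frameEquiv [IsManifold 𝓘(ℝ, E) ∞ M] (hq : IsQuotientMap (E := E) Γ q) (v : E) :
    ContMDiff 𝓘(ℝ, E) 𝓘(ℝ, E).tangent ∞
      (fun x => (⟨x, hq.frameEquiv x v⟩ : TangentBundle 𝓘(ℝ, E) M)) := by
  intro x
  obtain ⟨g, rfl⟩ := hq.surjective x
  have hl := hq.localDiffeo g
  have h1 : ContMDiff 𝓘(ℝ, E) 𝓘(ℝ, E).tangent ∞ (fun g : G => tangentMap 𝓘(ℝ, E) 𝓘(ℝ, E) q
      ⟨g, mulInvariantVectorField (I := 𝓘(ℝ, E)) v g⟩) :=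
    (hq.localDiffeo.contMDiff.contMDiff_tangentMap (m := ∞) le_rfl).comp
      (contMDiff_mulInvariantVectorField_infty v)
  have h2 := h1.contMDiffAt.comp (q g) hl.localInverse_contMDiffAt
  refine h2.congr_of_eventuallyEq ?_
  filter_upwards [hl.localInverse_eventuallyEq_right] with y hy
  have h3 : ∀ k : G, (⟨q k, hq.frameEquiv (q k) v⟩ : TangentBundle 𝓘(ℝ, E) M) =
      tangentMap 𝓘(ℝ, E) 𝓘(ℝ, E) q ⟨k, mulInvariantVectorField (I := 𝓘(ℝ, E)) v k⟩ := by
    intro k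
    rw [hq.frameEquiv_apply]
    rfl
  have hy' : q (hl.localInverse y) = y := hy
  refine Eq.trans ?_ (h3 (hl.localInverse y))
  rw [hy']

/-- The pullback of the frame by the local diffeomorphism `q` consists of left-invariant fields,
pullback commutes with brackets, and brackets of left-invariant fields are left-invariant. -/
lemma mlieBracket_frameEquiv [FiniteDimensional ℝ E] [IsManifold 𝓘(ℝ, E) ∞ M]
    (hq : IsQuotientMap (E := E) Γ q) (v w : E) (x : M) :
    mlieBracket 𝓘(ℝ, E) (fun y => (hq.frameEquiv y v : TangentSpace 𝓘(ℝ, E) y))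
      (fun y => (hq.frameEquiv y w : TangentSpace 𝓘(ℝ, E) y)) x =
    hq.frameEquiv x (mlieBracket 𝓘(ℝ, E) (mulInvariantVectorField (I := 𝓘(ℝ, E)) (G := G) v)
      (mulInvariantVectorField (I := 𝓘(ℝ, E)) (G := G) w) 1) := by
  have : CompleteSpace E := FiniteDimensional.complete ℝ E
  have : LieGroup 𝓘(ℝ, E) (minSmoothness ℝ 3) G :=
    LieGroup.of_le (n := ∞) (minSmoothness_le_infty _)
  have : IsManifold 𝓘(ℝ, E) (minSmoothness ℝ 3) M :=
    IsManifold.of_le (n := ∞) (minSmoothness_le_infty _)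
  have : IsManifold 𝓘(ℝ, E) (minSmoothness ℝ 2) M :=
    IsManifold.of_le (n := ∞) (minSmoothness_le_infty _)
  have : IsManifold 𝓘(ℝ, E) (minSmoothness ℝ 2) G :=
    IsManifold.of_le (n := ∞) (minSmoothness_le_infty _)
  obtain ⟨g, rfl⟩ := hq.surjective x
  have hpb : ∀ v : E, mpullback 𝓘(ℝ, E) 𝓘(ℝ, E) q
      (fun y => (hq.frameEquiv y v : TangentSpace 𝓘(ℝ, E) y)) =
      mulInvariantVectorField (I := 𝓘(ℝ, E)) (G := G) v := by
    intro v
    ext k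
    rw [mpullback_apply, hq.frameEquiv_apply,
      ← hq.localDiffeo.mfderivToContinuousLinearEquiv_coe (by simp) k,
      ContinuousLinearMap.inverse_equiv]
    exact (hq.localDiffeo.mfderivToContinuousLinearEquiv (by simp) k).symm_apply_apply _
  have h := mpullback_mlieBracket (n := ∞) (x₀ := g)
    ((hq.contMDiff_frameEquiv v (q g)).mdifferentiableAt (by simp))
    ((hq.contMDiff_frameEquiv w (q g)).mdifferentiableAt (by simp))
    (hq.localDiffeo.contMDiff g) (minSmoothness_le_infty 2)
  have h1 := congrFun (mulInvariantVector_mlieBracket (I := 𝓘(ℝ, E)) (G := G) v w) g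
  rw [hpb, hpb] at h
  replace h := h.trans h1.symm
  rw [mpullback_apply, ← hq.localDiffeo.mfderivToContinuousLinearEquiv_coe (by simp) g,
    ContinuousLinearMap.inverse_equiv] at h
  refine Eq.trans ?_ (hq.frameEquiv_apply g _).symm
  have h' := congrArg (hq.localDiffeo.mfderivToContinuousLinearEquiv (by simp) g) h
  refine Eq.trans ?_ h'
  exact ((hq.localDiffeo.mfderivToContinuousLinearEquiv (by simp) g).apply_symm_apply _).symm

/-- The frame of the quotient induced by left-invariant vector fields. -/
noncomputable def frame [FiniteDimensional ℝ E] [IsManifold 𝓘(ℝ, E) ∞ M]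
    (hq : IsQuotientMap (E := E) Γ q) : LieFrame E M where
  toFun := hq.frameEquiv
  smooth := hq.contMDiff_frameEquiv
  bracket v w := mlieBracket 𝓘(ℝ, E) (mulInvariantVectorField (I := 𝓘(ℝ, E)) (G := G) v)
    (mulInvariantVectorField (I := 𝓘(ℝ, E)) (G := G) w) 1
  mlieBracket_eq := hq.mlieBracket_frameEquiv

lemma frame_apply [FiniteDimensional ℝ E] [IsManifold 𝓘(ℝ, E) ∞ M]
    (hq : IsQuotientMap (E := E) Γ q) (g : G) (v : E) : hq.frame.toFun (q g) v =
      mfderiv 𝓘(ℝ, E) 𝓘(ℝ, E) q g (mulInvariantVectorField (I := 𝓘(ℝ, E)) v g) :=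
  hq.frameEquiv_apply g v

lemma exists_isAdapted [FiniteDimensional ℝ E] [IsManifold 𝓘(ℝ, E) ∞ M]
    (hq : IsQuotientMap (E := E) Γ q) {H : HypercomplexStructure E M} (hinv : H.IsInvariant q) :
    ∃ I₀ J₀ K₀ : E →L[ℝ] E, hq.frame.IsAdapted H I₀ J₀ K₀ := by
  obtain ⟨⟨I₀, hI⟩, ⟨J₀, hJ⟩, ⟨K₀, hK⟩⟩ := hinv
  refine ⟨I₀, J₀, K₀, ⟨?_, ?_, ?_⟩⟩
  · intro x v
    obtain ⟨g, rfl⟩ := hq.surjective x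
    exact ((congrArg (H.I (q g)) (hq.frame_apply g v)).trans (hI g v)).trans
      (hq.frame_apply g _).symm
  · intro x v
    obtain ⟨g, rfl⟩ := hq.surjective x
    exact ((congrArg (H.J (q g)) (hq.frame_apply g v)).trans (hJ g v)).trans
      (hq.frame_apply g _).symm
  · intro x v
    obtain ⟨g, rfl⟩ := hq.surjective x
    exact ((congrArg (H.K (q g)) (hq.frame_apply g v)).trans (hK g v)).trans
      (hq.frame_apply g _).symm

end IsQuotientMap
end QuotientFrame
end HKTSolv

namespace HKTSolv

/-! ### Invariant measures for solvable group actions -/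

section InvariantMean

open Filter

variable {X : Type*}

/-- A continuous linear action of the natural numbers on a compact convex set has a fixed point. -/
lemma exists_comp_eq_of_isCompact {C : Set (X → ℝ)} (hC : IsCompact C) (hconv : Convex ℝ C)
    (hne : C.Nonempty) {T : X → X} (hT : ∀ Λ ∈ C, Λ ∘ T ∈ C) : ∃ Λ ∈ C, Λ ∘ T = Λ := by
  obtain ⟨c, hc⟩ := hne
  have hck : ∀ k, c ∘ T^[k] ∈ C := by
    intro k
    induction k with
    | zero => exact hc
    | succ k ih =>
      rw [Function.iterate_succ, ← Function.comp_assoc]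
      exact hT _ ih
  -- Cesàro means of an orbit, as in the Markov–Kakutani theorem. Their limit is taken along an
  -- ultrafilter because `C` need not be sequentially compact; the defect of invariance telescopes
  -- and is at most `2 b / (N + 1)`.
  let a : ℕ → X → ℝ := fun N => ∑ k ∈ Finset.range (N + 1), ((N : ℝ) + 1)⁻¹ • (c ∘ T^[k])
  have ha : ∀ N, a N ∈ C := by
    intro N
    refine hconv.sum_mem (fun _ _ => by positivity) ?_ (fun k _ => hck k)
    rw [Finset.sum_const, Finset.card_range, nsmul_eq_mul]
    push_cast
    exact mul_inv_cancel₀ (by positivity)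
  obtain ⟨Λ, hΛ, hlim⟩ := hC.ultrafilter_le_nhds ((hyperfilter ℕ).map a) (by
    rw [le_principal_iff]
    exact Filter.mem_map.mpr (Filter.univ_mem' ha))
  refine ⟨Λ, hΛ, ?_⟩
  have hlim' : Tendsto a (hyperfilter ℕ) (𝓝 Λ) := hlim
  rw [tendsto_pi_nhds] at hlim'
  ext f
  obtain ⟨b, hb⟩ := (hC.image (continuous_apply f)).isBounded.exists_norm_le
  have hbk : ∀ k, |c (T^[k] f)| ≤ b := fun k => hb _ ⟨_, hck k, rfl⟩
  have hsub : Tendsto (fun N => a N (T f) - a N f) (hyperfilter ℕ) (𝓝 (Λ (T f) - Λ f)) :=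
    (hlim' (T f)).sub (hlim' f)
  have hzero : Tendsto (fun N => a N (T f) - a N f) atTop (𝓝 0) := by
    have h1 : ∀ N, a N (T f) - a N f = ((N : ℝ) + 1)⁻¹ * (c (T^[N + 1] f) - c f) := by
      intro N
      have h2 := Finset.sum_range_sub (fun k => c (T^[k] f)) (N + 1)
      simp only [a, Finset.sum_apply, Pi.smul_apply, smul_eq_mul, Function.comp_apply]
      rw [← Finset.sum_sub_distrib]
      simp only [← mul_sub, ← Finset.mul_sum]
      congr 1
    refine squeeze_zero_norm (a := fun N : ℕ => (1 / ((N : ℝ) + 1)) * (2 * b)) ?_ ?_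
    · intro N
      rw [h1, norm_mul, one_div, Real.norm_of_nonneg (by positivity)]
      gcongr
      have h3 := hbk (N + 1)
      have h4 := hbk 0
      calc ‖c (T^[N + 1] f) - c f‖ ≤ ‖c (T^[N + 1] f)‖ + ‖c f‖ := norm_sub_le _ _
        _ ≤ b + b := add_le_add h3 h4
        _ = 2 * b := by ring
    · have h2 := (tendsto_one_div_add_atTop_nhds_zero_nat (𝕜 := ℝ)).mul_const (2 * b)
      simpa using h2
  have h := tendsto_nhds_unique hsub (hzero.mono_left (Nat.hyperfilter_le_atTop))
  exact sub_eq_zero.mp h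

/-- A solvable group acting linearly on a compact convex set has a fixed point. -/
lemma exists_fixed_of_isSolvable {G : Type*} [Group G] [Group.IsSolvable G] {ρ : G → X → X}
    (hone : ρ 1 = id) (hmul : ∀ g h, ρ (g * h) = ρ g ∘ ρ h) {K : Set (X → ℝ)}
    (hK : IsCompact K) (hconv : Convex ℝ K) (hne : K.Nonempty)
    (hρ : ∀ g, ∀ Λ ∈ K, Λ ∘ ρ g ∈ K) : ∃ Λ ∈ K, ∀ g, Λ ∘ ρ g = Λ := by
  let Fix : Set G → Set (X → ℝ) := fun s => {Λ | ∀ g ∈ s, Λ ∘ ρ g = Λ}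
  have hclosed : ∀ s, IsClosed (Fix s) := by
    intro s
    simp only [Fix, Set.ofPred_forall]
    refine isClosed_biInter fun g _ => isClosed_eq ?_ continuous_id
    exact continuous_pi fun f => continuous_apply _
  have hcx : ∀ s, Convex ℝ (Fix s) := by
    intro s Λ hΛ Λ' hΛ' a b _ _ _ g hg
    ext f
    have h1 := congrFun (hΛ g hg) f
    have h2 := congrFun (hΛ' g hg) f
    simp only [Function.comp_apply] at h1 h2
    simp [h1, h2]
  -- Descent along the derived series. The set fixed by the smaller group is stable under `G` by
  -- normality, and on it the larger group acts through commuting maps. Finitely many of these have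
  -- a common fixed point by induction, and compactness passes to the whole group.
  have hstep : ∀ n, (K ∩ Fix (derivedSeries G (n + 1))).Nonempty →
      (K ∩ Fix (derivedSeries G n)).Nonempty := by
    intro n hn
    set C := K ∩ Fix (derivedSeries G (n + 1)) with hCdef
    have hinv : ∀ g, ∀ Λ ∈ C, Λ ∘ ρ g ∈ C := by
      intro g Λ hΛ
      refine ⟨hρ g Λ hΛ.1, fun h hh => ?_⟩
      have h1 : g * h * g⁻¹ ∈ derivedSeries G (n + 1) :=
        (inferInstance : (derivedSeries G (n + 1)).Normal).conj_mem h hh g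
      rw [Function.comp_assoc, ← hmul, show g * h = (g * h * g⁻¹) * g by group, hmul,
        ← Function.comp_assoc, hΛ.2 _ h1]
    have hcomm : ∀ g ∈ derivedSeries G n, ∀ g' ∈ derivedSeries G n, ∀ Λ ∈ C,
        Λ ∘ ρ (g * g') = Λ ∘ ρ (g' * g) := by
      intro g hg g' hg' Λ hΛ
      have h1 : g * g' * g⁻¹ * g'⁻¹ ∈ derivedSeries G (n + 1) := Subgroup.commutator_mem_commutator hg hg'
      rw [show g * g' = (g * g' * g⁻¹ * g'⁻¹) * (g' * g) by group, hmul,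
        ← Function.comp_assoc, hΛ.2 _ h1]
    have hfin : ∀ s : Finset G, ↑s ⊆ (derivedSeries G n : Set G) → (C ∩ Fix s).Nonempty := by
      classical
      intro s
      induction s using Finset.induction_on with
      | empty => exact fun _ => by simpa [Fix] using hn
      | insert g s hgs ih =>
        intro hs
        rw [Finset.coe_insert, Set.insert_subset_iff] at hs
        have hcomp : IsCompact (C ∩ Fix s) :=
          (hK.inter_right (hclosed _)).inter_right (hclosed _)
        obtain ⟨Λ, hΛ, hfix⟩ := exists_comp_eq_of_isCompact hcomp
          ((hconv.inter (hcx _)).inter (hcx _)) (ih hs.2) (T := ρ g) (by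
            intro Λ hΛ
            refine ⟨hinv g Λ hΛ.1, fun h hh => ?_⟩
            rw [Function.comp_assoc, ← hmul, hcomm g hs.1 h (hs.2 hh) Λ hΛ.1, hmul,
              ← Function.comp_assoc, hΛ.2 h hh])
        refine ⟨Λ, hΛ.1, fun h hh => ?_⟩
        rw [Finset.coe_insert] at hh
        rcases hh with rfl | hh
        · exact hfix
        · exact hΛ.2 h hh
    have hcompC : IsCompact C := hK.inter_right (hclosed _)
    obtain ⟨Λ, hΛ⟩ := hcompC.inter_iInter_nonempty
      (fun g : derivedSeries G n => Fix {(g : G)}) (fun g => hclosed _) (by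
        classical
        intro s
        obtain ⟨Λ, hΛ, hΛs⟩ := hfin (s.image Subtype.val) (by
          intro g hg
          obtain ⟨g', _, rfl⟩ := Finset.mem_image.mp (Finset.mem_coe.mp hg)
          exact g'.2)
        refine ⟨Λ, hΛ, ?_⟩
        simp only [Set.mem_iInter]
        intro g hg h hh
        rw [Set.mem_singleton_iff] at hh
        subst hh
        exact hΛs _ (Finset.mem_coe.mpr (Finset.mem_image_of_mem _ hg)))
    refine ⟨Λ, hΛ.1.1, fun g hg => ?_⟩
    have := Set.mem_iInter.mp hΛ.2 ⟨g, hg⟩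
    exact this g rfl
  obtain ⟨N, hN⟩ := ‹Group.IsSolvable G›
  have hbase : (K ∩ Fix (derivedSeries G N)).Nonempty := by
    obtain ⟨Λ, hΛ⟩ := hne
    refine ⟨Λ, hΛ, fun g hg => ?_⟩
    rw [hN] at hg
    rw [Subgroup.mem_bot.mp hg, hone]
    rfl
  have hall : ∀ n, (K ∩ Fix (derivedSeries G n)).Nonempty → (K ∩ Fix (derivedSeries G 0)).Nonempty := by
    intro n
    induction n with
    | zero => exact id
    | succ n ih => exact fun h => ih (hstep n h)
  obtain ⟨Λ, hΛ, hfix⟩ := hall N hbase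
  exact ⟨Λ, hΛ, fun g => hfix g (by simp)⟩

open MeasureTheory

/-- A solvable group acting on a compact space has an invariant probability measure. -/
lemma exists_invariant_measure {G : Type*} [Group G] [Group.IsSolvable G] {M : Type*}
    [TopologicalSpace M] [CompactSpace M] [T2Space M] [MeasurableSpace M] [BorelSpace M]
    [Nonempty M] (R : G → C(M, M)) (hone : R 1 = ContinuousMap.id M)
    (hmul : ∀ g h, R (g * h) = (R h).comp (R g)) :
    ∃ ν : Measure M, IsFiniteMeasure ν ∧ ν ≠ 0 ∧
      ∀ g, ∀ f : C(M, ℝ), ∫ x, f (R g x) ∂ν = ∫ x, f x ∂ν := by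
  -- The states on `C(M, ℝ)`, compact for pointwise convergence as a closed subset of the product of
  -- the intervals `[-‖f‖, ‖f‖]`. An invariant state becomes a measure by the Riesz representation
  -- theorem.
  let K : Set (C(M, ℝ) → ℝ) := {Λ | (∀ f g, Λ (f + g) = Λ f + Λ g) ∧
    (∀ (c : ℝ) f, Λ (c • f) = c * Λ f) ∧ (∀ f, 0 ≤ f → 0 ≤ Λ f) ∧ Λ 1 = 1}
  have hbd : ∀ Λ ∈ K, ∀ f : C(M, ℝ), Λ f ∈ Icc (-‖f‖) ‖f‖ := by
    rintro Λ ⟨hadd, hsmul, hpos, h1⟩ f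
    have h2 := hpos (‖f‖ • 1 + f) (fun x => by
      have := (abs_le.mp (f.norm_coe_le_norm x)).1
      change (0 : ℝ) ≤ ‖f‖ * 1 + f x
      linarith)
    have h3 := hpos (‖f‖ • 1 + (-1 : ℝ) • f) (fun x => by
      have := (abs_le.mp (f.norm_coe_le_norm x)).2
      change (0 : ℝ) ≤ ‖f‖ * 1 + (-1) * f x
      linarith)
    rw [hadd, hsmul, h1] at h2 h3
    rw [hsmul] at h3
    constructor <;> linarith
  have hclosed : IsClosed K := by
    have hc : ∀ f : C(M, ℝ), Continuous fun Λ : C(M, ℝ) → ℝ => Λ f := continuous_apply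
    have h1 : IsClosed {Λ : C(M, ℝ) → ℝ | ∀ f g, Λ (f + g) = Λ f + Λ g} := by
      simp only [Set.ofPred_forall]
      exact isClosed_iInter fun f => isClosed_iInter fun g => isClosed_eq (hc _) ((hc _).add (hc _))
    have h2 : IsClosed {Λ : C(M, ℝ) → ℝ | ∀ (c : ℝ) f, Λ (c • f) = c * Λ f} := by
      simp only [Set.ofPred_forall]
      exact isClosed_iInter fun c => isClosed_iInter fun f =>
        isClosed_eq (hc _) (continuous_const.mul (hc _))
    have h3 : IsClosed {Λ : C(M, ℝ) → ℝ | ∀ f, 0 ≤ f → 0 ≤ Λ f} := by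
      simp only [Set.ofPred_forall]
      exact isClosed_iInter fun f => isClosed_iInter fun _ => isClosed_le continuous_const (hc _)
    have h4 : IsClosed {Λ : C(M, ℝ) → ℝ | Λ 1 = 1} := isClosed_eq (hc _) continuous_const
    exact h1.inter (h2.inter (h3.inter h4))
  have hK : IsCompact K := (isCompact_univ_pi fun f : C(M, ℝ) => isCompact_Icc).of_isClosed_subset
    hclosed fun Λ hΛ f _ => hbd Λ hΛ f
  have hconv : Convex ℝ K := by
    rintro Λ ⟨h1, h2, h3, h4⟩ Λ' ⟨h1', h2', h3', h4'⟩ a b ha hb hab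
    refine ⟨fun f g => ?_, fun c f => ?_, fun f hf => ?_, ?_⟩
    · simp only [Pi.add_apply, Pi.smul_apply, smul_eq_mul, h1, h1']; ring
    · simp only [Pi.add_apply, Pi.smul_apply, smul_eq_mul, h2, h2']; ring
    · have := h3 f hf
      have := h3' f hf
      simp only [Pi.add_apply, Pi.smul_apply, smul_eq_mul]; positivity
    · simp [h4, h4', hab]
  obtain ⟨x₀⟩ := ‹Nonempty M›
  have hne : K.Nonempty := ⟨fun f => f x₀, fun _ _ => rfl, fun _ _ => rfl, fun f hf => hf x₀, rfl⟩
  obtain ⟨Λ, ⟨hadd, hsmul, hpos, h1⟩, hfix⟩ := exists_fixed_of_isSolvable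
    (ρ := fun (g : G) (f : C(M, ℝ)) => f.comp (R g)) (by ext f x; simp [hone])
    (by intro g h; ext f x; simp [hmul]) hK hconv hne (by
      rintro g Λ ⟨h1, h2, h3, h4⟩
      exact ⟨fun f f' => h1 (f.comp (R g)) (f'.comp (R g)), fun c f => h2 c (f.comp (R g)),
        fun f hf => h3 (f.comp (R g)) fun x => hf (R g x), h4⟩)
  let L : CompactlySupportedContinuousMap M ℝ →ₚ[ℝ] ℝ := PositiveLinearMap.mk₀
    { toFun := fun f => Λ f.toContinuousMap
      map_add' := fun _ _ => hadd _ _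
      map_smul' := fun _ _ => hsmul _ _ } (fun f hf => hpos _ hf)
  have hL : ∀ f : C(M, ℝ), ∫ x, f x ∂(RealRMK.rieszMeasure L) = Λ f := fun f =>
    RealRMK.integral_rieszMeasure L ⟨f, HasCompactSupport.of_compactSpace f⟩
  refine ⟨RealRMK.rieszMeasure L, inferInstance, ?_, fun g f => ?_⟩
  · intro h0
    have := hL 1
    rw [h0, h1, integral_zero_measure] at this
    exact zero_ne_one this
  · have h2 := hL (f.comp (R g))
    rw [hL f]
    exact h2.trans (congrFun (hfix g) f)

end InvariantMean
end HKTSolv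

namespace HKTSolv

/-! ### The right action of the group and integration by parts -/

section RightAction

variable {E : Type*} [NormedAddCommGroup E] [NormedSpace ℝ E] [FiniteDimensional ℝ E]
  {G : Type*} [Group G] [TopologicalSpace G] [ChartedSpace E G] [LieGroup 𝓘(ℝ, E) ∞ G]

/-- Viewing `G` as its own quotient makes the frame constructions available on `G` itself. -/
lemma isQuotientMap_id : IsQuotientMap (E := E) (⊥ : Subgroup G) (id : G → G) where
  localDiffeo := (Diffeomorph.refl 𝓘(ℝ, E) G ∞).isLocalDiffeomorph
  surjective := Function.surjective_id
  fibre g h := by simp [eq_comm]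

variable (E G) in
/-- The left-invariant frame of a Lie group. -/
noncomputable def leftFrame : LieFrame E G := isQuotientMap_id.frame

lemma leftFrame_apply (g : G) (v : E) :
    (leftFrame E G).toFun g v = mulInvariantVectorField (I := 𝓘(ℝ, E)) v g := by
  refine (isQuotientMap_id.frame_apply (E := E) g v).trans ?_
  rw [mfderiv_id]
  rfl

variable (E G) in
/-- The left Maurer-Cartan form in the chart at the identity. -/
noncomputable def chartMaurerCartan (y : E) : E →L[ℝ] E :=
  ((leftFrame E G).chartFrame 1 y).inverse

lemma chartMaurerCartan_eq {y : E} (hy : y ∈ (extChartAt 𝓘(ℝ, E) (1 : G)).target) :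
    ∃ e : E ≃L[ℝ] E, (leftFrame E G).chartFrame 1 y = e ∧ chartMaurerCartan E G y = e.symm := by
  have h : (leftFrame E G).chartFrame 1 y =
      ((leftFrame E G).coordEquiv (extChartAt_symm_mem hy) : E →L[ℝ] E) := by
    ext v; exact ((leftFrame E G).coordEquiv_apply (extChartAt_symm_mem hy) v).symm
  refine ⟨_, h, ?_⟩
  rw [chartMaurerCartan, h, ContinuousLinearMap.inverse_equiv]

lemma contDiffAt_chartMaurerCartan {y : E} (hy : y ∈ (extChartAt 𝓘(ℝ, E) (1 : G)).target) :
    ContDiffAt ℝ ∞ (chartMaurerCartan E G) y := by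
  have h1 : ContMDiffAt 𝓘(ℝ, E) 𝓘(ℝ, E) ∞ (extChartAt 𝓘(ℝ, E) (1 : G)).symm y :=
    (contMDiffOn_extChartAt_symm (1 : G)).contMDiffAt
      ((isOpen_extChartAt_target (1 : G)).mem_nhds hy)
  exact (((leftFrame E G).contMDiffAt_coord_inverse 1 (extChartAt_symm_mem hy)).comp y
    h1).contDiffAt

variable {M : Type*} [TopologicalSpace M] [ChartedSpace E M] [IsManifold 𝓘(ℝ, E) ∞ M]
  {Γ : Subgroup G} {q : G → M}

namespace IsQuotientMap

/-- By left-invariance the frame components of the velocity are those of the Maurer–Cartan form, the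
same for every `h`. Both the differentiation of the right action and the common transport equation
rest on this. -/
lemma hasMFDerivAt_chart (hq : IsQuotientMap (E := E) Γ q) (h : G) {y : E}
    (hy : y ∈ (extChartAt 𝓘(ℝ, E) (1 : G)).target) :
    HasMFDerivAt 𝓘(ℝ, E) 𝓘(ℝ, E) (fun y => q (h * (extChartAt 𝓘(ℝ, E) (1 : G)).symm y)) y
      ((hq.frame.toFun (q (h * (extChartAt 𝓘(ℝ, E) (1 : G)).symm y)) : E →L[ℝ] _).comp
        (chartMaurerCartan E G y)) := by
  set c := (extChartAt 𝓘(ℝ, E) (1 : G)).symm with hc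
  have h1 : HasMFDerivAt 𝓘(ℝ, E) 𝓘(ℝ, E) c y (mfderiv 𝓘(ℝ, E) 𝓘(ℝ, E) c y) :=
    (((contMDiffOn_extChartAt_symm (n := ∞) (1 : G)).contMDiffAt
      ((isOpen_extChartAt_target (1 : G)).mem_nhds hy)).mdifferentiableAt (by simp)).hasMFDerivAt
  have h2 := ((contMDiff_mul_left (I := 𝓘(ℝ, E)) (n := ∞) (a := h)).mdifferentiable (by simp)
    (c y)).hasMFDerivAt
  have h3 := (hq.localDiffeo.mdifferentiable (by simp) (h * c y)).hasMFDerivAt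
  have h4 := (h3.comp (c y) h2).comp y h1
  refine h4.congr_mfderiv ?_
  obtain ⟨e, he, he'⟩ := chartMaurerCartan_eq (E := E) (G := G) hy
  ext u
  obtain ⟨w, rfl⟩ := e.surjective u
  have h5 := (leftFrame E G).mfderiv_symm_chartFrame hy w
  rw [he, leftFrame_apply] at h5
  change (mfderiv 𝓘(ℝ, E) 𝓘(ℝ, E) q (h * c y) : E →L[ℝ] E)
    ((mfderiv 𝓘(ℝ, E) 𝓘(ℝ, E) (h * ·) (c y) : E →L[ℝ] E)
      ((mfderiv 𝓘(ℝ, E) 𝓘(ℝ, E) c y : E →L[ℝ] E) (e w))) =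
        hq.frame.toFun (q (h * c y)) (chartMaurerCartan E G y (e w))
  rw [he']
  refine Eq.trans ?_ (congrArg (hq.frame.toFun (q (h * c y))) (e.symm_apply_apply w)).symm
  refine Eq.trans ?_ (hq.frame_apply _ w).symm
  have h6 := mulInvariantVectorField_mul (E := E) w h (c y)
  refine Eq.trans ?_ (congrArg (mfderiv 𝓘(ℝ, E) 𝓘(ℝ, E) q (h * c y) : E →L[ℝ] E) h6).symm
  exact congrArg (fun z => (mfderiv 𝓘(ℝ, E) 𝓘(ℝ, E) q (h * c y) : E →L[ℝ] E)
    ((mfderiv 𝓘(ℝ, E) 𝓘(ℝ, E) (h * ·) (c y) : E →L[ℝ] E) z)) h5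

lemma rightMap_aux (hq : IsQuotientMap (E := E) Γ q) (g h : G) :
    q (Function.surjInv hq.surjective (q h) * g) = q (h * g) := by
  have h1 := Function.surjInv_eq hq.surjective (q h)
  obtain ⟨γ, hγ, h2⟩ := (hq.fibre _ _).mp h1
  rw [hq.fibre]
  exact ⟨γ, hγ, by rw [← mul_assoc, ← h2]⟩

/-- The right action of the group on the quotient. -/
noncomputable def rightMap (hq : IsQuotientMap (E := E) Γ q) (g : G) : C(M, M) where
  toFun x := q (Function.surjInv hq.surjective x * g)
  continuous_toFun := by
    have : ContinuousMul G := (topologicalGroup_of_lieGroup 𝓘(ℝ, E) ∞ (G := G)).toContinuousMul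
    have hc : Continuous q := hq.localDiffeo.contMDiff.continuous
    have h1 := hq.localDiffeo.isOpenMap.isQuotientMap hc hq.surjective
    rw [h1.continuous_iff]
    have h2 : (fun x => q (Function.surjInv hq.surjective x * g)) ∘ q = fun h => q (h * g) := by
      ext h; exact hq.rightMap_aux g h
    rw [h2]
    exact hc.comp (continuous_mul_const g)

lemma rightMap_apply (hq : IsQuotientMap (E := E) Γ q) (g h : G) :
    hq.rightMap g (q h) = q (h * g) := hq.rightMap_aux g h

lemma rightMap_one (hq : IsQuotientMap (E := E) Γ q) : hq.rightMap 1 = ContinuousMap.id M := by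
  ext x
  obtain ⟨h, rfl⟩ := hq.surjective x
  rw [rightMap_apply, mul_one]
  rfl

lemma rightMap_mul (hq : IsQuotientMap (E := E) Γ q) (g h : G) :
    hq.rightMap (g * h) = (hq.rightMap h).comp (hq.rightMap g) := by
  ext x
  obtain ⟨k, rfl⟩ := hq.surjective x
  rw [ContinuousMap.comp_apply, rightMap_apply, rightMap_apply, rightMap_apply, mul_assoc]

open MeasureTheory

/-- The integral of `f` composed with the right action of a curve through `1` does not depend on the
time. Its derivative at time zero, taken under the integral sign, is the integral of the derivative
of `f` along the frame. -/
lemma integral_dirDeriv_eq_zero [CompactSpace M] [MeasurableSpace M] [BorelSpace M]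
    (hq : IsQuotientMap (E := E) Γ q) {ν : Measure M} [IsFiniteMeasure ν]
    (hν : ∀ g, ∀ f : C(M, ℝ), ∫ x, f (hq.rightMap g x) ∂ν = ∫ x, f x ∂ν)
    {f : M → ℂ} (hf : ContMDiff 𝓘(ℝ, E) 𝓘(ℝ, ℂ) ∞ f) (v : E) :
    ∫ x, hq.frame.dirDeriv f x v ∂ν = 0 := by
  have hint : ∀ g : M → ℂ, Continuous g → Integrable g ν := fun g hg =>
    hg.integrable_of_hasCompactSupport (HasCompactSupport.of_compactSpace g)
  have hνc : ∀ g, ∫ x, f (hq.rightMap g x) ∂ν = ∫ x, f x ∂ν := by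
    intro g
    have hfc := hf.continuous
    rw [← integral_re_add_im (f := fun x => f (hq.rightMap g x))
      (hint _ (hfc.comp (hq.rightMap g).continuous)), ← integral_re_add_im (hint _ hfc)]
    have h1 := hν g ⟨fun x => (f x).re, Complex.continuous_re.comp hfc⟩
    have h2 := hν g ⟨fun x => (f x).im, Complex.continuous_im.comp hfc⟩
    simp only [ContinuousMap.coe_mk] at h1 h2
    exact congrArg₂ (fun a b : ℝ => (a : ℂ) + (b : ℂ) * Complex.I) h1 h2
  let D : M → (E →L[ℝ] ℂ) := fun y => ContinuousLinearMap.comp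
    (M₂ := TangentSpace 𝓘(ℝ, E) y) (mfderiv 𝓘(ℝ, E) 𝓘(ℝ, ℂ) f y) (hq.frame.toFun y : E →L[ℝ] _)
  have hD : Continuous D := ContMDiff.continuous (I := 𝓘(ℝ, E)) (I' := 𝓘(ℝ, E →L[ℝ] ℂ)) (n := ∞)
    fun y => contMDiffAt_clm_of_apply fun v => hq.frame.contMDiff_dirDeriv hf v y
  obtain ⟨C, hC⟩ := isCompact_univ.exists_bound_of_continuousOn hD.continuousOn
  set χ := extChartAt 𝓘(ℝ, E) (1 : G)
  set y₀ := χ 1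
  have hy₀ : y₀ ∈ χ.target := mem_extChartAt_target (1 : G)
  obtain ⟨e, -, he⟩ := chartMaurerCartan_eq (E := E) (G := G) hy₀
  -- The coordinate velocity at the identity whose frame components are `v`.
  let u := e v
  have hu : chartMaurerCartan E G y₀ u = v := by
    rw [he]; exact e.symm_apply_apply v
  let ℓ : ℝ → E := fun t => y₀ + t • u
  have hℓ : ∀ t, HasDerivAt ℓ u t := fun t => by
    have h := ((hasDerivAt_id t).smul_const u).const_add y₀
    rwa [one_smul] at h
  have hℓ0 : ℓ 0 = y₀ := by simp [ℓ]
  have hev1 : ∀ᶠ t in 𝓝 (0 : ℝ), ℓ t ∈ χ.target := by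
    apply (hℓ 0).continuousAt.eventually
    rw [hℓ0]
    exact (isOpen_extChartAt_target (1 : G)).mem_nhds hy₀
  have hev2 : ∀ᶠ t in 𝓝 (0 : ℝ), ‖chartMaurerCartan E G (ℓ t) u‖ < ‖v‖ + 1 := by
    have h1 : ContinuousAt (fun t => ‖chartMaurerCartan E G (ℓ t) u‖) 0 := by
      have h2 : ContinuousAt (chartMaurerCartan E G) (ℓ 0) := by
        rw [hℓ0]
        exact (contDiffAt_chartMaurerCartan hy₀).continuousAt
      exact ((h2.comp (hℓ 0).continuousAt).clm_apply continuousAt_const).norm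
    apply h1.eventually_lt continuousAt_const
    rw [hℓ0, hu]
    linarith
  have key := hasDerivAt_integral_of_dominated_loc_of_deriv_le (μ := ν) (𝕜 := ℝ) (x₀ := (0 : ℝ))
    (F := fun t x => f (hq.rightMap (χ.symm (ℓ t)) x))
    (F' := fun t x => D (hq.rightMap (χ.symm (ℓ t)) x) (chartMaurerCartan E G (ℓ t) u))
    (bound := fun _ => C * (‖v‖ + 1)) (hev1.and hev2)
    (Filter.Eventually.of_forall fun t => (hint _ (hf.continuous.comp
      (hq.rightMap _).continuous)).aestronglyMeasurable)
    (hint _ (hf.continuous.comp (hq.rightMap _).continuous))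
    (hint _ ((hD.comp (hq.rightMap _).continuous).clm_apply
      continuous_const)).aestronglyMeasurable
    (Filter.Eventually.of_forall fun x t ht => by
      refine (ContinuousLinearMap.le_opNorm _ _).trans ?_
      have := hC (hq.rightMap (χ.symm (ℓ t)) x) (mem_univ _)
      have h0 : 0 ≤ C := (norm_nonneg _).trans this
      exact mul_le_mul this ht.2.le (norm_nonneg _) h0)
    (integrable_const _)
    (Filter.Eventually.of_forall fun x t ht => by
      obtain ⟨h, rfl⟩ := hq.surjective x
      simp only [rightMap_apply]
      have h1 := hq.hasMFDerivAt_chart h ht.1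
      have h2 := (HasMFDerivAt.comp (g := f) (ℓ t)
        (hf.mdifferentiable (by simp) (q (h * χ.symm (ℓ t)))).hasMFDerivAt h1).hasFDerivAt
      exact h2.comp_hasDerivAt t (hℓ t))
  have h2 := key.2
  simp only [hνc] at h2
  have h3 := h2.unique (hasDerivAt_const _ _)
  rw [hℓ0, hu] at h3
  have h4 : χ.symm y₀ = 1 := extChartAt_to_inv (1 : G)
  rw [h4, rightMap_one] at h3
  exact h3

lemma exists_measure [Group.IsSolvable G] [CompactSpace M] [T2Space M] [MeasurableSpace M]
    [BorelSpace M] (hq : IsQuotientMap (E := E) Γ q) :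
    ∃ ν : Measure M, IsFiniteMeasure ν ∧ ν ≠ 0 ∧ ∀ f : M → ℂ, ContMDiff 𝓘(ℝ, E) 𝓘(ℝ, ℂ) ∞ f →
      ∀ v, ∫ x, hq.frame.dirDeriv f x v ∂ν = 0 := by
  have : Nonempty M := ⟨q 1⟩
  obtain ⟨ν, hfin, hne, hν⟩ := exists_invariant_measure hq.rightMap hq.rightMap_one hq.rightMap_mul
  exact ⟨ν, hfin, hne, fun f hf v => hq.integral_dirDeriv_eq_zero hν hf v⟩

end IsQuotientMap
end RightAction
end HKTSolv

namespace HKTSolv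

/-! ### Parallel transport in a frame -/

section ParallelTransport

variable {E : Type*} [NormedAddCommGroup E] [NormedSpace ℝ E] [FiniteDimensional ℝ E]
  {M : Type*} [TopologicalSpace M] [ChartedSpace E M] [IsManifold 𝓘(ℝ, E) ∞ M]

/-- A vector field along a curve is parallel when its components `w` in a frame satisfy
`w' = -Γ(a) w`, where `a` are the components of the velocity of the curve. -/
lemma LieFrame.isParallelAlong (φ : LieFrame E M)
    (cov : CovariantDerivative 𝓘(ℝ, E) E (TangentSpace 𝓘(ℝ, E) : M → Type _))
    {γ : ℝ → M} {a w : ℝ → E}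
    (hγ : ∀ t ∈ Icc (0 : ℝ) 1, MDifferentiableAt 𝓘(ℝ, ℝ) 𝓘(ℝ, E) γ t)
    (hγ' : ∀ t ∈ Icc (0 : ℝ) 1, mfderiv 𝓘(ℝ, ℝ) 𝓘(ℝ, E) γ t (1 : ℝ) = φ.toFun (γ t) (a t))
    (hw : ∀ t ∈ Icc (0 : ℝ) 1,
      HasDerivWithinAt w (-φ.conn cov (γ t) (a t) (w t)) (Icc 0 1) t) :
    IsParallelAlong cov fun t => (⟨γ t, φ.toFun (γ t) (w t)⟩ : TangentBundle 𝓘(ℝ, E) M) := by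
  intro t ht
  have hγt : mfderivWithin 𝓘(ℝ, ℝ) 𝓘(ℝ, E) γ (Icc 0 1) t (1 : ℝ) = φ.toFun (γ t) (a t) := by
    rw [mfderivWithin_eq_mfderiv ((uniqueDiffOn_Icc_zero_one t ht).uniqueMDiffWithinAt) (hγ t ht)]
    exact hγ' t ht
  have hs : γ t ∈ (chartAt E (γ t)).source := mem_chart_source E (γ t)
  set x := γ t with hx
  set ξ : E := φ.coord x x (w t) with hξ
  -- The frame components of the local extension used by `IsParallelAlong`, whose coordinates are
  -- the constant `ξ`.
  let u : M → E := fun y => (φ.toFun y).symm (extend E (φ.toFun x (w t)) y)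
  have hu1 : u =ᶠ[𝓝 x] fun y => (φ.coord x y).inverse ξ := by
    filter_upwards [(chartAt E x).open_source.mem_nhds hs] with y hy
    refine Eq.trans ?_ (φ.toFun_symm_trivializationAt_symm hy ξ)
    rw [hξ, φ.coord_apply hs]
    rfl
  have hu : MDifferentiableAt 𝓘(ℝ, E) 𝓘(ℝ, E) u x := by
    have h := ((φ.contMDiffAt_coord_inverse x hs).clm_apply
      (contMDiffAt_const (c := ξ))).mdifferentiableAt (by simp)
    exact h.congr_of_eventuallyEq hu1
  have hux : u x = w t := by
    change (φ.toFun x).symm (extend E (φ.toFun x (w t)) x) = w t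
    rw [extend_apply_self]
    exact (φ.toFun x).symm_apply_apply _
  have hcov : cov (extend E (φ.toFun x (w t))) x (φ.toFun x (a t)) =
      φ.toFun x (φ.dirDeriv u x (a t) + φ.conn cov x (a t) (w t)) := by
    have h := φ.cov_apply (cov := cov) hu (a t)
    rw [hux] at h
    refine Eq.trans ?_ h
    congr 2
    ext1 y
    exact ((φ.toFun y).apply_symm_apply _).symm
  have hγc : ContinuousAt γ t := (hγ t ht).continuousAt
  -- Since `coord` sends `u` to the constant `ξ`, the coordinates of the field are `coord (w - u ∘
  -- γ) + ξ`. The difference vanishes at `t`, so the derivative of `coord` drops out of the product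
  -- rule.
  have hz : HasDerivWithinAt (fun s => w s - u (γ s))
      (-φ.conn cov x (a t) (w t) - φ.dirDeriv u x (a t)) (Icc 0 1) t := by
    refine (hw t ht).sub (HasDerivAt.hasDerivWithinAt ?_)
    let L : ℝ →L[ℝ] E :=
      (mfderiv 𝓘(ℝ, E) 𝓘(ℝ, E) u x).comp (mfderiv 𝓘(ℝ, ℝ) 𝓘(ℝ, E) γ t)
    have h : HasFDerivAt (fun s => u (γ s)) L t :=
      (hu.hasMFDerivAt.comp t (hγ t ht).hasMFDerivAt).hasFDerivAt
    refine h.hasDerivAt.congr_deriv ?_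
    exact congrArg (mfderiv 𝓘(ℝ, E) 𝓘(ℝ, E) u x) (hγ' t ht)
  have hC : DifferentiableAt ℝ (fun s => φ.coord x (γ s)) t :=
    (((φ.contMDiffAt_coord x hs).mdifferentiableAt (by simp)).comp t (hγ t ht)).differentiableAt
  have hD := hC.hasDerivAt.hasDerivWithinAt.clm_apply hz
  have hzt : w t - u (γ t) = 0 := by rw [← hx, hux, sub_self]
  rw [hzt, map_zero, zero_add] at hD
  have hD2 : HasDerivWithinAt (fun s => φ.coord x (γ s) (w s - u (γ s)) + ξ)
      (φ.coord x x (-φ.conn cov x (a t) (w t) - φ.dirDeriv u x (a t))) (Icc 0 1) t :=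
    hD.add_const ξ
  have hev : (fun s => (trivializationAt E (TangentSpace 𝓘(ℝ, E) : M → Type _) x
      ⟨γ s, φ.toFun (γ s) (w s)⟩).2) =ᶠ[𝓝 t]
      fun s => φ.coord x (γ s) (w s - u (γ s)) + ξ := by
    filter_upwards [hγc.eventually hu1,
      hγc.eventually ((chartAt E x).open_source.mem_nhds hs)] with s h1 h2
    rw [map_sub, h1]
    have h3 : φ.coord x (γ s) ((φ.coord x (γ s)).inverse ξ) = ξ := by
      have h1 : φ.coord x (γ s) = ((φ.coordEquiv h2 : E ≃L[ℝ] E) : E →L[ℝ] E) := by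
        ext v; exact (φ.coordEquiv_apply h2 v).symm
      rw [h1, ContinuousLinearMap.inverse_equiv]
      exact (φ.coordEquiv h2).apply_symm_apply ξ
    rw [h3, sub_add_cancel]
    exact (φ.coord_apply h2 _).symm
  refine (hD2.congr_of_eventuallyEq (hev.filter_mono nhdsWithin_le_nhds)
    hev.self_of_nhds).congr_deriv ?_
  have h4 : -φ.conn cov x (a t) (w t) - φ.dirDeriv u x (a t) =
      -(φ.dirDeriv u x (a t) + φ.conn cov x (a t) (w t)) := by abel
  rw [h4, map_neg, φ.coord_apply hs]
  refine congrArg Neg.neg ?_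
  change _ = (trivializationAt E (TangentSpace 𝓘(ℝ, E) : M → Type _) x
    ⟨x, cov (extend E (φ.toFun x (w t))) x
      (mfderivWithin 𝓘(ℝ, ℝ) 𝓘(ℝ, E) γ (Icc 0 1) t (1 : ℝ))⟩).2
  refine Eq.trans ?_ (congrArg (fun ζ : TangentSpace 𝓘(ℝ, E) x =>
    (trivializationAt E (TangentSpace 𝓘(ℝ, E) : M → Type _) x
    ⟨x, cov (extend E (φ.toFun x (w t))) x ζ⟩).2) hγt.symm)
  exact (congrArg (fun ζ : TangentSpace 𝓘(ℝ, E) x =>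
    (trivializationAt E (TangentSpace 𝓘(ℝ, E) : M → Type _) x ⟨x, ζ⟩).2) hcov).symm

end ParallelTransport
end HKTSolv

namespace HKTSolv

/-! ### Transport along right translates of a curve -/

section RightTransport

/-- Solutions of linear differential equations with small coefficients on `[0, 1]`. -/
lemma exists_linear_ode {E : Type*} [NormedAddCommGroup E] [NormedSpace ℝ E] [CompleteSpace E]
    {N : ℝ → E →L[ℝ] E} (hN : ContinuousOn N (Icc 0 1)) {ε : ℝ} (hε : ε ≤ 1 / 2)
    (hle : ∀ t ∈ Icc (0 : ℝ) 1, ‖N t‖ ≤ ε) :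
    ∃ D : ℝ → E →L[ℝ] E, D 0 = ContinuousLinearMap.id ℝ E ∧
      (∀ t ∈ Icc (0 : ℝ) 1, HasDerivWithinAt D (-(N t).comp (D t)) (Icc 0 1) t) ∧
      ∀ t ∈ Icc (0 : ℝ) 1, ‖D t - ContinuousLinearMap.id ℝ E‖ ≤ 2 * ε := by
  have hε0 : 0 ≤ ε := (norm_nonneg _).trans (hle 0 (by simp))
  let f : ℝ → (E →L[ℝ] E) → E →L[ℝ] E := fun t D => -(N t).comp D
  let a : NNReal := ⟨2 * ε, by positivity⟩
  let K : NNReal := ⟨ε, hε0⟩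
  let t₀ : Icc (0 : ℝ) 1 := ⟨0, by simp⟩
  -- On the ball of radius `2 ε ≤ 1` about the identity `‖D‖ ≤ 2`, so the speed is at most `2 ε` and
  -- a solution cannot leave the ball in time one. The fixed point in the Picard space keeps this
  -- bound.
  have hf : IsPicardLindelof f t₀ (ContinuousLinearMap.id ℝ E) a 0 a K := by
    refine ⟨fun t ht => ?_, fun D _ => (hN.clm_comp continuousOn_const).neg, fun t ht D hD => ?_,
      ?_⟩
    · refine LipschitzOnWith.of_dist_le_mul fun D _ D' _ => ?_
      rw [dist_eq_norm, dist_eq_norm]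
      have h : f t D - f t D' = -(N t).comp (D - D') := by
        simp only [f, ContinuousLinearMap.comp_sub]; abel
      rw [h, norm_neg]
      refine ((N t).opNorm_comp_le _).trans ?_
      gcongr
      exact hle t ht
    · have h1 : ‖D‖ ≤ 2 := by
        have h2 : ‖D - ContinuousLinearMap.id ℝ E‖ ≤ 2 * ε := by
          rwa [Metric.mem_closedBall, dist_eq_norm] at hD
        have h3 := norm_le_insert' D (ContinuousLinearMap.id ℝ E)
        have h4 := ContinuousLinearMap.norm_id_le (𝕜 := ℝ) (E := E)
        linarith
      change ‖-(N t).comp D‖ ≤ 2 * ε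
      rw [norm_neg, mul_comm]
      refine ((N t).opNorm_comp_le _).trans ?_
      gcongr
      exact hle t ht
    · simp [t₀]
  obtain ⟨α, hα⟩ := ODE.FunSpace.exists_isFixedPt_next hf (Metric.mem_closedBall_self le_rfl)
  refine ⟨α.compProj, ?_, fun t ht => ?_, fun t ht => ?_⟩
  · have h : α.compProj (t₀ : ℝ) = ContinuousLinearMap.id ℝ E := by
      rw [ODE.FunSpace.compProj_val, ← hα, ODE.FunSpace.next_apply₀]
    exact h
  · apply ODE.hasDerivWithinAt_picard_Icc t₀.2 hf.continuousOn_uncurry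
      α.continuous_compProj.continuousOn (fun _ _ => α.compProj_mem_closedBall hf.mul_max_le)
      (ContinuousLinearMap.id ℝ E) ht |>.congr_of_mem _ ht
    intro t' ht'
    nth_rw 1 [← hα]
    rw [ODE.FunSpace.compProj_of_mem ht', ODE.FunSpace.next_apply]
  · have h := α.compProj_mem_closedBall hf.mul_max_le (t := t)
    rw [Metric.mem_closedBall, dist_eq_norm] at h
    exact h

variable {E : Type*} [NormedAddCommGroup E] [NormedSpace ℝ E]
  {G : Type*} [Group G] [TopologicalSpace G] [ChartedSpace E G] 
  {M : Type*} [TopologicalSpace M] [ChartedSpace E M] [IsManifold 𝓘(ℝ, E) ∞ M]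
  {Γ : Subgroup G} {q : G → M}

/-- The linear map between two tangent spaces with matrix `D` in the frame. -/
noncomputable def LieFrame.transport (φ : LieFrame E M) (D : E →L[ℝ] E) (x y : M) :
    TangentSpace 𝓘(ℝ, E) x →L[ℝ] TangentSpace 𝓘(ℝ, E) y :=
  (φ.toFun y : E →L[ℝ] TangentSpace 𝓘(ℝ, E) y).comp
    (D.comp ((φ.toFun x).symm : TangentSpace 𝓘(ℝ, E) x →L[ℝ] E))

lemma LieFrame.det_transport (φ : LieFrame E M) (D : E →L[ℝ] E) (x : M) :
    LinearMap.det (φ.transport D x x).toLinearMap = LinearMap.det D.toLinearMap :=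
  LinearMap.det_conj D.toLinearMap (φ.toFun x).toLinearEquiv

variable [FiniteDimensional ℝ E] [LieGroup 𝓘(ℝ, E) ∞ G]

namespace IsQuotientMap

/-- `D` is the matrix in the invariant frame of the parallel transport along right translates of
some curve from `1` to `g`. -/
def IsTransport (hq : IsQuotientMap (E := E) Γ q)
    (cov : CovariantDerivative 𝓘(ℝ, E) E (TangentSpace 𝓘(ℝ, E) : M → Type _))
    (g : G) (D : E →L[ℝ] E) : Prop :=
  ∀ h : G, IsParallelTransport cov (q h) (q (h * g)) (hq.frame.transport D (q h) (q (h * g)))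

variable {cov : CovariantDerivative 𝓘(ℝ, E) E (TangentSpace 𝓘(ℝ, E) : M → Type _)}

lemma IsTransport.mul {hq : IsQuotientMap (E := E) Γ q} {g g' : G} {D D' : E →L[ℝ] E}
    (h : hq.IsTransport cov g D) (h' : hq.IsTransport cov g' D') :
    hq.IsTransport cov (g * g') (D'.comp D) := by
  intro k
  have h1 := IsParallelTransport.trans _ _ _ _ _ (h k) (h' (k * g))
  have h2 : (hq.frame.transport D' (q (k * g)) (q (k * g * g'))).comp
      (hq.frame.transport D (q k) (q (k * g))) =
      hq.frame.transport (D'.comp D) (q k) (q (k * g * g')) := by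
    ext v
    exact congrArg (fun z => hq.frame.toFun (q (k * g * g')) (D' z))
      ((hq.frame.toFun (q (k * g))).symm_apply_apply _)
  rw [h2] at h1
  rw [← mul_assoc]
  exact h1

/-- When `q (h * g) = q h` the path is a loop, its transport belongs to the holonomy, and `D` is the
matrix of that endomorphism in one basis. -/
lemma IsTransport.det_eq_one {hq : IsQuotientMap (E := E) Γ q} {H : HypercomplexStructure E M}
    (hhol : ∀ x, holonomy cov x ⊆ quaternionicSL H x) {g h : G} {D : E →L[ℝ] E}
    (hD : hq.IsTransport cov g D) (hg : q (h * g) = q h) : LinearMap.det D.toLinearMap = 1 := by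
  have h1 := hD h
  rw [hg] at h1
  rw [← hq.frame.det_transport D (q h)]
  exact (hhol _ h1).2.2.2

/-- Along translates of a coordinate ray the equation is `D' = -Γ₀(s(t)) D`, with `s` the
Maurer–Cartan form on the velocity; nothing in it depends on the starting point. Small `u` keeps `D`
near the identity and its determinant near one. -/
lemma exists_isTransport (hq : IsQuotientMap (E := E) Γ q) {Γ₀ : E →ₗ[ℝ] E →ₗ[ℝ] E}
    (hΓ₀ : ∀ x, hq.frame.conn cov x = Γ₀) :
    ∃ ρ > 0, ∀ u : E, ‖u‖ < ρ → ∃ D : ℝ → E →L[ℝ] E, D 0 = ContinuousLinearMap.id ℝ E ∧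
      HasDerivWithinAt D (-LinearMap.toContinuousLinearMap
        (Γ₀ (chartMaurerCartan E G (extChartAt 𝓘(ℝ, E) (1 : G) 1) u))) (Icc 0 1) 0 ∧
      ∀ τ ∈ Icc (0 : ℝ) 1, hq.IsTransport cov ((extChartAt 𝓘(ℝ, E) (1 : G)).symm
        (extChartAt 𝓘(ℝ, E) (1 : G) 1 + τ • u)) (D τ) ∧
        1 / 2 ≤ |LinearMap.det (D τ).toLinearMap| ∧ |LinearMap.det (D τ).toLinearMap| ≤ 2 := by
  set χ := extChartAt 𝓘(ℝ, E) (1 : G) with hχ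
  set y₀ := χ 1 with hy₀
  have hy₀t : y₀ ∈ χ.target := mem_extChartAt_target (1 : G)
  have hcy : χ.symm y₀ = 1 := extChartAt_to_inv (1 : G)
  let Γc : E →L[ℝ] E →L[ℝ] E := LinearMap.toContinuousLinearMap
    ((LinearMap.toContinuousLinearMap : (E →ₗ[ℝ] E) ≃ₗ[ℝ] E →L[ℝ] E).toLinearMap.comp Γ₀)
  let S : E → E →L[ℝ] E := chartMaurerCartan E G
  have hS : ∀ y ∈ χ.target, ContinuousAt S y := fun y hy =>
    (contDiffAt_chartMaurerCartan hy).continuousAt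
  obtain ⟨δ, hδ, hdet⟩ : ∃ δ > 0, ∀ D : E →L[ℝ] E, ‖D - ContinuousLinearMap.id ℝ E‖ ≤ δ →
      1 / 2 ≤ |LinearMap.det D.toLinearMap| ∧ |LinearMap.det D.toLinearMap| ≤ 2 := by
    have hc : ContinuousAt (fun D : E →L[ℝ] E => |LinearMap.det D.toLinearMap|)
        (ContinuousLinearMap.id ℝ E) :=
      (ContinuousLinearMap.continuous_det (𝕜 := ℝ) (E := E)).abs.continuousAt
    have h1 : |LinearMap.det (ContinuousLinearMap.id ℝ E).toLinearMap| = 1 := by simp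
    have h2 := hc.eventually (Icc_mem_nhds (a := 1 / 2) (b := 2)
      (by beta_reduce; rw [h1]; norm_num) (by beta_reduce; rw [h1]; norm_num))
    obtain ⟨δ, hδ, h3⟩ := Metric.nhds_basis_closedBall.eventually_iff.mp h2
    exact ⟨δ, hδ, fun D hD => h3 (by simpa [dist_eq_norm] using hD)⟩
  obtain ⟨r, hr, hball⟩ : ∃ r > 0, ∀ y ∈ Metric.ball y₀ r, y ∈ χ.target ∧ ‖S y‖ ≤ ‖S y₀‖ + 1 := by
    have h1 : ∀ᶠ y in 𝓝 y₀, ‖S y‖ ≤ ‖S y₀‖ + 1 := by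
      filter_upwards [Metric.continuousAt_iff'.mp (hS y₀ hy₀t) 1 one_pos] with y hy
      have h2 := norm_le_insert' (S y) (S y₀)
      rw [dist_eq_norm] at hy
      linarith
    exact Metric.eventually_nhds_iff_ball.mp
      (((isOpen_extChartAt_target (1 : G)).eventually_mem hy₀t).and h1)
  set C := ‖Γc‖ * (‖S y₀‖ + 1) + 1 with hC
  have hC0 : 0 < C := by positivity
  -- The solution stays within `2 ε ≤ δ` of the identity, and `1 / 2` is the bound required by
  -- `exists_linear_ode`.
  set ε := min (δ / 2) (1 / 2) with hε
  have hε0 : 0 < ε := by positivity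
  refine ⟨min r (ε / C), by positivity, fun u hu => ?_⟩
  have hur : ‖u‖ < r := hu.trans_le (min_le_left _ _)
  have huC : C * ‖u‖ ≤ ε := by
    have := (hu.trans_le (min_le_right _ _)).le
    rwa [le_div_iff₀ hC0, mul_comm] at this
  have hmem : ∀ t ∈ Icc (0 : ℝ) 1, y₀ + t • u ∈ Metric.ball y₀ r := by
    intro t ht
    rw [Metric.mem_ball, dist_eq_norm, add_sub_cancel_left, norm_smul, Real.norm_of_nonneg ht.1]
    exact (mul_le_of_le_one_left (norm_nonneg _) ht.2).trans_lt hur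
  let N : ℝ → E →L[ℝ] E := fun t => Γc (S (y₀ + t • u) u)
  have hN : ContinuousOn N (Icc 0 1) := by
    intro t ht
    have h1 : ContinuousAt (fun t : ℝ => S (y₀ + t • u)) t :=
      ContinuousAt.comp (f := fun t : ℝ => y₀ + t • u) (hS _ (hball _ (hmem t ht)).1)
        (by fun_prop)
    exact (Γc.continuous.continuousAt.comp
      (h1.clm_apply continuousAt_const)).continuousWithinAt
  have hNle : ∀ t ∈ Icc (0 : ℝ) 1, ‖N t‖ ≤ ε := by
    intro t ht
    calc ‖N t‖ ≤ ‖Γc‖ * ((‖S y₀‖ + 1) * ‖u‖) :=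
          Γc.le_opNorm_of_le ((S _).le_of_opNorm_le (hball _ (hmem t ht)).2 u)
      _ ≤ C * ‖u‖ := by rw [hC]; nlinarith [norm_nonneg u]
      _ ≤ ε := huC
  obtain ⟨D, hD0, hD, hDle⟩ := exists_linear_ode hN (min_le_right _ _) hNle
  refine ⟨D, hD0, ?_, fun τ hτ => ⟨fun h => ?_, hdet _ ((hDle τ hτ).trans ?_)⟩⟩
  · refine (hD 0 (by simp)).congr_deriv ?_
    rw [hD0, ContinuousLinearMap.comp_id]
    simp only [N, zero_smul, add_zero]
    rfl
  · have hτt : ∀ t ∈ Icc (0 : ℝ) 1, t * τ ∈ Icc (0 : ℝ) 1 := fun t ht =>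
      ⟨mul_nonneg ht.1 hτ.1, mul_le_one₀ ht.2 hτ.1 hτ.2⟩
    -- The piece of the ray up to time `τ`, reparametrized over `[0, 1]`; its transport is `D (t *
    -- τ)`.
    let γ : ℝ → M := fun t => q (h * χ.symm (y₀ + (t * τ) • u))
    have hγd : ∀ t ∈ Icc (0 : ℝ) 1, HasMFDerivAt 𝓘(ℝ, ℝ) 𝓘(ℝ, E) γ t
        (((hq.frame.toFun (γ t) : E →L[ℝ] TangentSpace 𝓘(ℝ, E) (γ t)).comp
          (chartMaurerCartan E G (y₀ + (t * τ) • u))).comp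
          (ContinuousLinearMap.toSpanSingleton ℝ (τ • u))) := by
      intro t ht
      have h1 : HasDerivAt (fun t : ℝ => y₀ + (t * τ) • u) (τ • u) t := by
        have := (((hasDerivAt_id t).mul_const τ).smul_const u).const_add y₀
        simpa using this
      exact (hq.hasMFDerivAt_chart h (hball _ (hmem _ (hτt t ht))).1).comp t
        (f := fun t : ℝ => y₀ + (t * τ) • u) h1.hasFDerivAt.hasMFDerivAt
    have hpar : ∀ w₀ : E, IsParallelAlong cov fun t =>
        (⟨γ t, hq.frame.toFun (γ t) (D (t * τ) w₀)⟩ : TangentBundle 𝓘(ℝ, E) M) := by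
      intro w₀
      refine hq.frame.isParallelAlong cov (a := fun t =>
        chartMaurerCartan E G (y₀ + (t * τ) • u) (τ • u)) (fun t ht =>
        (hγd t ht).mdifferentiableAt) (fun t ht => ?_) (fun t ht => ?_)
      · rw [(hγd t ht).mfderiv]
        refine congrArg (fun z => hq.frame.toFun (γ t) (chartMaurerCartan E G
          (y₀ + (t * τ) • u) z)) (one_smul ℝ (τ • u))
      · have h1 : HasDerivWithinAt (fun t => D (t * τ)) (τ • -(N (t * τ)).comp (D (t * τ)))
            (Icc 0 1) t :=
          (hD _ (hτt t ht)).scomp t (g₁ := D) ((hasDerivAt_mul_const τ).hasDerivWithinAt) hτt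
        refine (h1.clm_apply (hasDerivWithinAt_const t _ w₀)).congr_deriv ?_
        rw [map_zero, add_zero, hΓ₀, map_smul, map_smul]
        change τ • -(N (t * τ) (D (t * τ) w₀)) = _
        rw [smul_neg]
        rfl
    have key : ∀ {x y : M} (_ : x = y) (v : E), (⟨x, hq.frame.toFun x v⟩ :
        TangentBundle 𝓘(ℝ, E) M) = ⟨y, hq.frame.toFun y v⟩ := by
      rintro x _ rfl v; rfl
    have h0 : γ 0 = q h := by simp [γ, hcy]
    have h1 : γ 1 = q (h * χ.symm (y₀ + τ • u)) := by simp [γ]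
    refine IsParallelTransport.smooth γ (fun t ht => ?_) _ _ _ h0 h1 fun v =>
      ⟨_, fun _ _ => rfl, ?_, ?_, hpar ((hq.frame.toFun (q h)).symm v)⟩
    · have h2 := (contMDiffOn_extChartAt_symm (n := ∞) (I := 𝓘(ℝ, E)) (1 : G)).contMDiffAt
        ((isOpen_extChartAt_target (1 : G)).mem_nhds (hball _ (hmem _ (hτt t ht))).1)
      have h3 : ContMDiffAt 𝓘(ℝ, ℝ) 𝓘(ℝ, E) ∞ (fun t : ℝ => y₀ + (t * τ) • u) t := by
        have : ContDiff ℝ ∞ (fun t : ℝ => y₀ + (t * τ) • u) := by fun_prop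
        exact this.contMDiff t
      have h4 := (contMDiff_mul_left (I := 𝓘(ℝ, E)) (n := ∞) (a := h)).contMDiffAt.comp _ h2
      have h5 := (hq.localDiffeo.contMDiff _).comp _ h4
      exact (h5.comp t h3).contMDiffWithinAt
    · refine (key h0 _).trans ?_
      rw [zero_mul, hD0]
      exact congrArg (fun z => (⟨q h, z⟩ : TangentBundle 𝓘(ℝ, E) M))
        ((hq.frame.toFun (q h)).apply_symm_apply v)
    · refine (key h1 _).trans ?_
      rw [one_mul]
      rfl
  · have := min_le_left (δ / 2) (1 / 2)
    linarith

end IsQuotientMap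
end RightTransport
end HKTSolv

namespace HKTSolv

/-! ### The Obata connection has trace zero -/

section TraceVanishes

variable {E : Type*} [NormedAddCommGroup E] [NormedSpace ℝ E] [FiniteDimensional ℝ E]

/-- The derivative of the determinant at the identity is the trace. -/
lemma hasDerivWithinAt_det {D : ℝ → E →L[ℝ] E} {A : E →L[ℝ] E} {s : Set ℝ} {t : ℝ}
    (h0 : D t = ContinuousLinearMap.id ℝ E) (hD : HasDerivWithinAt D A s t) :
    HasDerivWithinAt (fun τ => LinearMap.det (D τ).toLinearMap)
      (LinearMap.trace ℝ E A.toLinearMap) s t := by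
  classical
  let b := Module.finBasis ℝ E
  let W : ContinuousMultilinearMap ℝ (fun _ : Fin (Module.finrank ℝ E) => E) ℝ :=
    { b.det.toMultilinearMap with
      cont := by
        change Continuous fun v => b.det v
        simp only [Module.Basis.det_apply]
        refine Continuous.matrix_det (continuous_matrix fun i j => ?_)
        exact (LinearMap.continuous_of_finiteDimensional (b.coord i)).comp (continuous_apply j) }
  have hW : ∀ w, W w = b.det w := fun _ => rfl
  have h1 := HasFDerivWithinAt.multilinear_comp (f := W) (g := fun i τ => D τ (b i))
    (fun i => (hD.clm_apply (hasDerivWithinAt_const t s (b i))).hasFDerivWithinAt)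
  have h2 : (fun τ => W fun i => D τ (b i)) = fun τ => LinearMap.det (D τ).toLinearMap := by
    ext τ
    have := b.det_comp (D τ).toLinearMap b
    rw [b.det_self, mul_one] at this
    exact this
  rw [h2] at h1
  refine h1.hasDerivWithinAt.congr_deriv ?_
  have h3 := sum_update_eq_trace_mul b b.det A.toLinearMap b
  rw [b.det_self, mul_one] at h3
  rw [← h3, _root_.sum_apply]
  refine Finset.sum_congr rfl fun i _ => ?_
  simp [h0, hW, ContinuousMultilinearMap.toContinuousLinearMap]

variable {G : Type*} [Group G] [TopologicalSpace G] [ChartedSpace E G] [LieGroup 𝓘(ℝ, E) ∞ G]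
  [ConnectedSpace G]
  {M : Type*} [TopologicalSpace M] [ChartedSpace E M] [IsManifold 𝓘(ℝ, E) ∞ M] [CompactSpace M]
  {Γ : Subgroup G} {q : G → M}

/-- A submonoid of a connected group containing a neighbourhood of `1` is everything. -/
lemma submonoid_eq_top_of_mem_nhds {G : Type*} [Group G] [TopologicalSpace G]
    [IsTopologicalGroup G] [ConnectedSpace G] (S : Submonoid G) (hS : (S : Set G) ∈ 𝓝 1) (g : G) :
    g ∈ S := by
  -- The invertible elements of `S` form a subgroup that is still a neighbourhood of `1`, hence open
  -- and closed.
  let K : Subgroup G :=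
    { carrier := {g | g ∈ S ∧ g⁻¹ ∈ S}
      mul_mem' := fun ha hb => ⟨S.mul_mem ha.1 hb.1, by
        rw [mul_inv_rev]; exact S.mul_mem hb.2 ha.2⟩
      one_mem' := ⟨S.one_mem, by rw [inv_one]; exact S.one_mem⟩
      inv_mem' := fun ha => ⟨ha.2, by rw [inv_inv]; exact ha.1⟩ }
  have hK : (K : Set G) ∈ 𝓝 1 := Filter.inter_mem hS (inv_mem_nhds_one G hS)
  have ho : IsOpen (K : Set G) := K.isOpen_of_mem_nhds hK
  have hu : (K : Set G) = univ :=
    (OpenSubgroup.isClopen ⟨K, ho⟩).eq_univ ⟨1, K.one_mem⟩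
  have : g ∈ (K : Set G) := by rw [hu]; trivial
  exact this.1

namespace IsQuotientMap

variable {cov : CovariantDerivative 𝓘(ℝ, E) E (TangentSpace 𝓘(ℝ, E) : M → Type _)}

/-- If the holonomy preserves volumes, then so do all transports, by compactness. -/
lemma IsTransport.abs_det_eq_one {hq : IsQuotientMap (E := E) Γ q}
    {H : HypercomplexStructure E M} (hhol : ∀ x, holonomy cov x ⊆ quaternionicSL H x)
    {V : Set G} (hV : V ∈ 𝓝 1)
    (hVt : ∀ g ∈ V, ∃ D, hq.IsTransport cov g D ∧ 1 / 2 ≤ |LinearMap.det D.toLinearMap|)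
    {g : G} {D : E →L[ℝ] E} (hD : hq.IsTransport cov g D) :
    |LinearMap.det D.toLinearMap| = 1 := by
  have : IsTopologicalGroup G := topologicalGroup_of_lieGroup 𝓘(ℝ, E) ∞
  obtain ⟨V', hV'V, hV'o, h1V'⟩ := mem_nhds_iff.mp hV
  have hall : ∀ g, ∃ D, hq.IsTransport cov g D := by
    let S : Submonoid G :=
      { carrier := {g | ∃ D, hq.IsTransport cov g D}
        mul_mem' := fun ⟨_, ha⟩ ⟨_, hb⟩ => ⟨_, ha.mul hb⟩
        one_mem' := (hVt 1 (hV'V h1V')).imp fun _ h => h.1 }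
    exact submonoid_eq_top_of_mem_nhds S
      (Filter.mem_of_superset hV fun g hg => (hVt g hg).imp fun _ h => h.1)
  choose T hT using hall
  have hopen : ∀ f : G, IsOpen (q '' ((fun v => f * v⁻¹) '' V')) := fun f => by
    refine hq.localDiffeo.isOpenMap _ ?_
    exact ((Homeomorph.inv G).trans (Homeomorph.mulLeft f)).isOpenMap _ hV'o
  obtain ⟨F, hF⟩ := isCompact_univ.elim_finite_subcover _ hopen fun x _ => by
    obtain ⟨f, rfl⟩ := hq.surjective x
    exact mem_iUnion.mpr ⟨f, f, ⟨1, h1V', by simp⟩, rfl⟩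
  -- With `q g = q (f * v⁻¹)` for some `f` in the finite set `F` and `v` near `1`, the path to `g *
  -- v * f⁻¹` closes up to a loop at `q 1`. Thus `D` has an inverse determinant realized by a
  -- transport and bounded below by finitely many constants.
  have hloop : ∀ g D, hq.IsTransport cov g D → ∃ f ∈ F, ∃ k D', hq.IsTransport cov k D' ∧
      1 / 2 * |LinearMap.det (T f⁻¹).toLinearMap| ≤ |LinearMap.det D'.toLinearMap| ∧
      LinearMap.det D'.toLinearMap * LinearMap.det D.toLinearMap = 1 := by
    intro g D hD
    obtain ⟨f, hf⟩ := mem_iUnion.mp (hF (mem_univ (q g)))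
    obtain ⟨hfF, _, ⟨v, hv, rfl⟩, hfv⟩ := mem_iUnion.mp hf
    obtain ⟨Dv, hDv, hDv'⟩ := hVt v (hV'V hv)
    refine ⟨f, hfF, v * f⁻¹, _, hDv.mul (hT f⁻¹), ?_, ?_⟩
    · rw [ContinuousLinearMap.toLinearMap_comp, LinearMap.det_comp, abs_mul, mul_comm]
      gcongr
    · have h1 := (hD.mul (hDv.mul (hT f⁻¹))).det_eq_one hhol (h := 1) (by
        obtain ⟨γ, hγ, h⟩ := (hq.fibre _ _).mp hfv
        rw [one_mul]
        refine ((hq.fibre _ _).mpr ⟨γ, hγ, ?_⟩).symm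
        rw [h]; group)
      rw [ContinuousLinearMap.toLinearMap_comp, LinearMap.det_comp] at h1
      exact h1
  have hne : ∀ g, LinearMap.det (T g).toLinearMap ≠ 0 := fun g h => by
    obtain ⟨_, _, _, _, _, _, h1⟩ := hloop g _ (hT g)
    rw [h, mul_zero] at h1
    exact zero_ne_one h1
  obtain ⟨R, hR⟩ : ∃ R : ℝ, ∀ g D, hq.IsTransport cov g D → |LinearMap.det D.toLinearMap| ≤ R := by
    refine ⟨∑ f ∈ F, 2 / |LinearMap.det (T f⁻¹).toLinearMap|, fun g D hD => ?_⟩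
    obtain ⟨f, hf, k, D', -, h1, h2⟩ := hloop g D hD
    refine le_trans ?_ (Finset.single_le_sum (f := fun f =>
      2 / |LinearMap.det (T f⁻¹).toLinearMap|) (fun f _ => by positivity) hf)
    have h3 : 0 < |LinearMap.det (T f⁻¹).toLinearMap| := abs_pos.mpr (hne _)
    have h4 : |LinearMap.det D'.toLinearMap| * |LinearMap.det D.toLinearMap| = 1 := by
      rw [← abs_mul, h2, abs_one]
    rw [le_div_iff₀ h3]
    nlinarith [abs_nonneg (LinearMap.det D.toLinearMap)]
  -- Powers of a transport are transports, so a determinant of absolute value above one would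
  -- contradict the uniform bound. The closing transport `D'` gives the opposite inequality.
  have hle : ∀ g D, hq.IsTransport cov g D → |LinearMap.det D.toLinearMap| ≤ 1 := by
    intro g D hD
    by_contra! hlt
    obtain ⟨m, hm⟩ := pow_unbounded_of_one_lt R hlt
    have hpow : ∀ m : ℕ, ∃ k D', hq.IsTransport cov k D' ∧
        LinearMap.det D.toLinearMap ^ (m + 1) = LinearMap.det D'.toLinearMap := by
      intro m
      induction m with
      | zero => exact ⟨g, D, hD, by simp⟩
      | succ m ih =>
        obtain ⟨k, D', h1, h2⟩ := ih
        refine ⟨_, _, h1.mul hD, ?_⟩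
        rw [ContinuousLinearMap.toLinearMap_comp, LinearMap.det_comp, pow_succ', h2]
    obtain ⟨k, D', h1, h2⟩ := hpow m
    have h3 := hR k D' h1
    rw [← h2, abs_pow] at h3
    have h4 := pow_le_pow_right₀ hlt.le (Nat.le_succ m)
    exact h3.not_gt (hm.trans_le h4)
  refine le_antisymm (hle g D hD) ?_
  obtain ⟨f, hf, k, D', h0, -, h2⟩ := hloop g D hD
  have h4 : |LinearMap.det D'.toLinearMap| * |LinearMap.det D.toLinearMap| = 1 := by
    rw [← abs_mul, h2, abs_one]
  nlinarith [hle k D' h0, abs_nonneg (LinearMap.det D.toLinearMap)]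

/-- Along a short ray the determinant of the transport is continuous, starts at one and has absolute
value one. It is therefore constant near time zero, where its derivative is minus the trace of `Γ₀`
on the initial velocity. -/
theorem trace_conn_eq_zero (hq : IsQuotientMap (E := E) Γ q) {H : HypercomplexStructure E M}
    (hhol : ∀ x, holonomy cov x ⊆ quaternionicSL H x) {Γ₀ : E →ₗ[ℝ] E →ₗ[ℝ] E}
    (hΓ₀ : ∀ x, hq.frame.conn cov x = Γ₀) (v : E) : LinearMap.trace ℝ E (Γ₀ v) = 0 := by
  obtain ⟨ρ, hρ, hT⟩ := hq.exists_isTransport hΓ₀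
  set χ := extChartAt 𝓘(ℝ, E) (1 : G) with hχ
  have hV : {g | g ∈ χ.source ∧ χ g ∈ Metric.ball (χ 1) ρ} ∈ 𝓝 (1 : G) := by
    refine Filter.inter_mem (extChartAt_source_mem_nhds (1 : G)) ?_
    exact (continuousAt_extChartAt (1 : G)) (Metric.ball_mem_nhds _ hρ)
  have hVt : ∀ g ∈ {g | g ∈ χ.source ∧ χ g ∈ Metric.ball (χ 1) ρ}, ∃ D,
      hq.IsTransport cov g D ∧ 1 / 2 ≤ |LinearMap.det D.toLinearMap| := by
    rintro g ⟨hg, hgρ⟩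
    obtain ⟨D, -, -, h⟩ := hT (χ g - χ 1) (by rwa [← dist_eq_norm])
    have h1 := h 1 (by simp)
    rw [one_smul, add_sub_cancel, χ.left_inv hg] at h1
    exact ⟨D 1, h1.1, h1.2.1⟩
  have key : ∀ u, ‖u‖ < ρ →
      LinearMap.trace ℝ E (Γ₀ (chartMaurerCartan E G (χ 1) u)) = 0 := by
    intro u hu
    obtain ⟨D, hD0, hD, h⟩ := hT u hu
    have habs : ∀ τ ∈ Icc (0 : ℝ) 1, |LinearMap.det (D τ).toLinearMap| = 1 := fun τ hτ =>
      (h τ hτ).1.abs_det_eq_one hhol hV hVt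
    have h1 := hasDerivWithinAt_det hD0 hD
    have h0 : LinearMap.det (D 0).toLinearMap = 1 := by rw [hD0]; simp
    have h2 : HasDerivWithinAt (fun τ => LinearMap.det (D τ).toLinearMap) 0 (Icc 0 1) 0 := by
      refine (hasDerivWithinAt_const (0 : ℝ) (Icc (0 : ℝ) 1) (1 : ℝ)).congr_of_eventuallyEq ?_ h0
      have h3 := h1.continuousWithinAt.eventually (lt_mem_nhds (a := 0) (by simp [h0]))
      filter_upwards [h3, self_mem_nhdsWithin] with τ hτ hτ'
      rw [← abs_of_pos hτ, habs τ hτ']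
    have h3 := (uniqueDiffOn_Icc_zero_one 0 (by simp)).eq_deriv _ h1 h2
    have h4 : LinearMap.trace ℝ E (-(Γ₀ (chartMaurerCartan E G (χ 1) u))) = 0 := h3
    rwa [map_neg, neg_eq_zero] at h4
  obtain ⟨e, -, he⟩ := chartMaurerCartan_eq (E := E) (G := G) (mem_extChartAt_target (1 : G))
  have hc : 0 < ‖e v‖ + 1 := by positivity
  -- Rescaling `e v` to norm below `ρ` suffices, as the trace is linear; `+ 1` covers `v = 0`.
  have h1 := key ((ρ / (‖e v‖ + 1)) • e v) (by
    rw [norm_smul, Real.norm_of_nonneg (by positivity), div_mul_eq_mul_div, div_lt_iff₀ hc]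
    nlinarith)
  rw [he, map_smul, map_smul, map_smul, smul_eq_mul] at h1
  rcases mul_eq_zero.mp h1 with h2 | h2
  · exact absurd h2 (by positivity)
  · simpa using h2

end IsQuotientMap
end TraceVanishes
end HKTSolv

namespace HKTSolv

/-! ### The averaged metric -/

section Average

open MeasureTheory

variable {E : Type*} [NormedAddCommGroup E] [NormedSpace ℝ E] [FiniteDimensional ℝ E]
  {M : Type*} [TopologicalSpace M] [ChartedSpace E M] [IsManifold 𝓘(ℝ, E) ∞ M]
  [MeasurableSpace M] [BorelSpace M] [CompactSpace M]

/-- The average of a hyperhermitian metric over a compact manifold with an adapted frame. -/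
lemma LieFrame.exists_average (φ : LieFrame E M) {H : HypercomplexStructure E M}
    {I₀ J₀ K₀ : E →L[ℝ] E} (hφ : φ.IsAdapted H I₀ J₀ K₀) (g : HyperhermitianMetric H)
    (ν : Measure M) [IsFiniteMeasure ν] (hν : ν ≠ 0) :
    ∃ (B : E →ₗ[ℝ] E →ₗ[ℝ] ℝ) (g' : HyperhermitianMetric H),
      (∀ x v w, g'.inner x (φ.toFun x v) (φ.toFun x w) = B v w) ∧
      ∀ v w, B v w = ∫ y, g.inner y (φ.toFun y v) (φ.toFun y w) ∂ν := by
  have hi : ∀ v w, Integrable (fun y => g.inner y (φ.toFun y v) (φ.toFun y w)) ν := fun v w =>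
    integrable_of_contMDiff (φ.contMDiff_inner g v w)
  let B : E →ₗ[ℝ] E →ₗ[ℝ] ℝ := LinearMap.mk₂ ℝ
    (fun v w => ∫ y, g.inner y (φ.toFun y v) (φ.toFun y w) ∂ν)
    (fun v v' w => by
      simp only [map_add, _root_.add_apply]
      exact integral_add (hi _ _) (hi _ _))
    (fun c v w => by
      simp only [map_smul, _root_.smul_apply, smul_eq_mul]
      exact integral_const_mul _ _)
    (fun v w w' => by
      simp only [map_add]
      exact integral_add (hi _ _) (hi _ _))
    (fun c v w => by
      simp only [map_smul, smul_eq_mul]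
      exact integral_const_mul _ _)
  have hB : ∀ v w, B v w = ∫ y, g.inner y (φ.toFun y v) (φ.toFun y w) ∂ν := fun _ _ => rfl
  let Bc : E →L[ℝ] E →L[ℝ] ℝ := LinearMap.toContinuousLinearMap
    ((LinearMap.toContinuousLinearMap : (E →ₗ[ℝ] ℝ) ≃ₗ[ℝ] E →L[ℝ] ℝ).toLinearMap.comp B)
  have hBc : ∀ v w, Bc v w = B v w := fun _ _ => rfl
  -- The integrand is positive everywhere, so a nonzero measure is all that is needed.
  have hpos : ∀ v, v ≠ 0 → 0 < Bc v v := by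
    intro v hv
    have hp : ∀ y, 0 < g.inner y (φ.toFun y v) (φ.toFun y v) := fun y =>
      g.pos y _ fun h => hv ((φ.toFun y).injective (h.trans (map_zero (φ.toFun y)).symm))
    rw [hBc, hB, integral_pos_iff_support_of_nonneg (fun y => (hp y).le) (hi v v)]
    have h1 : Function.support (fun y => g.inner y (φ.toFun y v) (φ.toFun y v)) = univ :=
      eq_univ_of_forall fun y => (hp y).ne'
    rw [h1]
    exact Measure.measure_univ_pos.mpr hν
  refine ⟨B, φ.metric hφ Bc (fun v w => ?_) hpos (fun v w => ?_) (fun v w => ?_) (fun v w => ?_),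
    fun x v w => φ.bilin_toFun Bc x v w, hB⟩
  · rw [hBc, hBc, hB, hB]
    exact integral_congr_ae (.of_forall fun y => g.symm y _ _)
  · rw [hBc, hBc, hB, hB]
    refine integral_congr_ae (.of_forall fun y => ?_)
    beta_reduce
    rw [← hφ.I, ← hφ.I, g.hermitian_I]
  · rw [hBc, hBc, hB, hB]
    refine integral_congr_ae (.of_forall fun y => ?_)
    beta_reduce
    rw [← hφ.J, ← hφ.J, g.hermitian_J]
  · rw [hBc, hBc, hB, hB]
    refine integral_congr_ae (.of_forall fun y => ?_)
    beta_reduce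
    rw [← hφ.K, ← hφ.K, g.hermitian_K]

end Average
end HKTSolv

/-! ### The theorem -/

theorem mainTheorem6
    {E : Type*} [NormedAddCommGroup E] [NormedSpace ℝ E] [FiniteDimensional ℝ E]
    (n : ℕ) (hn : Module.finrank ℝ E = 4 * n)
    {G : Type*} [Group G] [TopologicalSpace G] [ChartedSpace E G] [LieGroup 𝓘(ℝ, E) ∞ G]
    [T2Space G] [ConnectedSpace G] [Group.IsSolvable G]
    (Γ : Subgroup G) [DiscreteTopology Γ]
    {M : Type*} [TopologicalSpace M] [ChartedSpace E M] [IsManifold 𝓘(ℝ, E) ∞ M]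
    [T2Space M] [CompactSpace M]
    (q : G → M) (hq : HKTSolv.IsQuotientMap (E := E) Γ q)
    (H : HKTSolv.HypercomplexStructure E M) (hinv : H.IsInvariant q)
    (hSL : HKTSolv.IsSLManifold H)
    (hHKT : ∃ g : HKTSolv.HyperhermitianMetric H, g.IsHKT) :
    ∃ g : HKTSolv.HyperhermitianMetric H, g.IsHKT ∧ g.IsBalanced n := by
  obtain ⟨cov, hcov, hhol⟩ := hSL
  obtain ⟨g, hg⟩ := hHKT
  obtain ⟨I₀, J₀, K₀, hφ⟩ := hq.exists_isAdapted hinv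
  let _ : MeasurableSpace M := borel M
  have _ : BorelSpace M := ⟨rfl⟩
  have _ : Nonempty M := ⟨q 1⟩
  obtain ⟨ν, hνf, hν0, hν⟩ := hq.exists_measure
  obtain ⟨B, g', hg', hB⟩ := hq.frame.exists_average hφ g ν hν0
  have hΓ := hq.frame.conn_sub_conn hcov (q 1)
  have hHKT' : g'.IsHKT := hq.frame.isHKT_of_average hφ hΓ hν g g'
    (fun x v w => (hg' x v w).trans (hB v w)) hg
  exact ⟨g', hHKT', HKTSolv.isBalanced_of_isHKT hφ hΓ
    (hq.frame.conn_comm hcov.preserves_I hφ.I (q 1))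
    (hq.frame.conn_comm hcov.preserves_J hφ.J (q 1))
    (hq.frame.conn_comm hcov.preserves_K hφ.K (q 1))
    (hq.trace_conn_eq_zero hhol fun x => hq.frame.conn_eq hcov hφ x (q 1))
    hn B g' hg' hHKT'⟩
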